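/- Let $A$ be a unital complex algebra, $B\subset A$ a unital subalgebra and $\varphi:A\to B$ a conditional expectation (linear, $\varphi(b)=b$, $\varphi(b_1xb_2)=b_1\varphi(x)b_2$ for $b,b_1,b_2\in B$, $x\in A$). Let $\kappa_n:A^n\to B$, $n\ge 1$, be the operator-valued free cumulants, defined by $\varphi(x_1\cdots x_n)=\sum_{\pi\in NC(n)}\kappa_\pi(x_1,\dots,x_n)$, where $\kappa_\pi$ is the nested evaluation of $(\kappa_m)_m$ along the blocks of the non-crossing partition $\pi$. For $x\in A$ let $K_x$ be the series of maps $K_x^{(n)}:B^n\to B$ with $K_x^{(0)}=1$ and $K_x^{(n)}(b_1,\dots,b_n)=\kappa_{n+1}(xb_1,\dots,xb_n,x)$ for $n\ge1$. For series $\alpha,\beta$ of maps $B^n\to B$, $n\geq 0$, put $$(\alpha\cdot\beta)_n(b_1,\dots,b_n)=\sum_{k=0}^n\alpha_k(b_1,\dots,b_k)\,\beta_{n-k}(b_{k+1},\dots,b_n),$$ and, if $\beta_0=0$, let $(\alpha\times\beta)_0=\alpha_0$ and, for $n\ge1$, $$(\alpha\times\beta)_n(b_1,\dots,b_n)=\sum_{k=1}^n\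 \sum_{\substack{p_1,\dots,p_k\ge1\\ p_1+\dots+p_k=n}}\alpha_k\big(\beta_{p_1}(b_1,\dots,b_{p_1}),\dots,\beta_{p_k}(b_{n-p_k+1},\dots,b_n)\big).$$ Let $I=(0,\mathrm{id}_B,0,\dots)$. Let $a,b\in A$ be free over $B$, that is, $\varphi(x_1\cdots x_n)=0$ whenever $n\ge1$, $\varphi(x_i)=0$ for all $i$, and the $x_i$ are taken alternatingly from the algebra generated by $B$ and $a$ and the algebra generated by $B$ and $b$. Assume $\varphi(a)=\varphi(b)=1$. For a non-crossing partition $\pi$ of $\{1,\dots,N\}$ let $\tilde\pi=\pi\cup\mathrm{Kr}(\pi)$ be the non-crossing partition of $\{1,\dots,2N\}$ with $\pi$ on the odd elements (black blocks) and its Kreweras complement on the even elements (blue blocks). View a block with $k$ elements as a vertex with $k+1$ inputs, one for each of its gaps (the front gap, the $k-1$ gaps between successive elements, and the back gap). Then $\tilde\pi$ is represented by a planar tree: the root is the blue block containing $2N$; what lies in a gap of a block is attached at the corresponding input, and empty gaps are leaves. (In this tree the leftmost and rightmost inputs of each vertex other than the root, and the rightmost input of the root, are leaves.) Erase the rightmost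 leaf of each black vertex and the leftmost leaf of each blue vertex other than the root, and then contract the vertices other than the root that have a single input. Reading a vertex with $m$ inputs as the one-block linked partition $\{\{1,\dots,m\}\}$ (and the root as $\{\{1\},\{2,\dots,m\}\}$), the result is a monomial for a bicoloured non-crossing linked partition $\tilde\pi_\ell$; it has $N+1$ inputs. Let $\hat K_{a,b}(\tilde\pi_\ell):B^{N+1}\to B$ be the composition along this tree of the maps $$k_L^a(m)(c_1,\dots,c_m)=\kappa_m(c_1a,\dots,c_ma),\qquad k_R^b(m)(c_1,\dots,c_m)=\kappa_m(bc_1,\dots,bc_{m-1},b)\,c_m,$$ $$k_{LR}^b(m+1)(c_0,\dots,c_m)=c_0\,\kappa_m(bc_1,\dots,bc_{m-1},b)\,c_m$$ at the black vertices, at the blue vertices other than the root, and at the root, respectively. Let $V_{a,b}$ be the series with $V_{a,b}^{(0)}=1$ and, for $n\ge1$, $$V_{a,b}^{(n)}(b_1,\dots,b_n)=\sum_{\pi}\hat K_{a,b}(\tilde\pi_\ell)(1,b_1,\dots,b_n,1),$$ where $\pi$ ranges over the irreducible non-crossing partitions of $\{1,\dots,n+1\}$ (those for which $1$ and $n+1$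 are in the same block). Then $$V_{a,b}=K_a\times\big[(K_b\times[I\cdot V_{a,b}])\cdot I\big]\qquad\text{and}\qquad K_{ab}=V_{a,b}\cdot\big(K_b\times[I\cdot V_{a,b}]\big).$$ -/

import Mathlib

noncomputable section

open Finset

namespace FreeProd

/-! ### Operator-valued probability spaces and freeness -/

/-- An (algebraic) operator-valued probability space `(A, φ, B)`: `B` sits in the unital algebra `A`
through the unital homomorphism `ι` (injective because of `φ_ι`), and `φ : A → B` is a
conditional expectation. -/
structure OVSpace (A B : Type*) [Ring A] [Algebra ℂ A] [Ring B] [Algebra ℂ B] where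
  ι : B →ₐ[ℂ] A
  φ : A →ₗ[ℂ] B
  φ_ι : ∀ b : B, φ (ι b) = b
  φ_bimodule : ∀ (b₁ b₂ : B) (x : A), φ (ι b₁ * x * ι b₂) = b₁ * φ x * b₂

/-- The subalgebra of `A` generated by `B` and the random variable `x`. -/
def OVSpace.generated {A B : Type*} [Ring A] [Algebra ℂ A] [Ring B] [Algebra ℂ B]
    (P : OVSpace A B) (x : A) : Subalgebra ℂ A :=
  Algebra.adjoin ℂ (insert x (Set.range P.ι))

/-- Freeness (with amalgamation over `B`) of `a` and `b`: `φ(x₁ ⋯ x_n) = 0` whenever `n ≥ 1`, the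
`x_i` are centred, and they are taken alternatingly from the algebras generated by `B` and `a`
(index `true`) and by `B` and `b` (index `false`). -/
def OVSpace.IsFree {A B : Type*} [Ring A] [Algebra ℂ A] [Ring B] [Algebra ℂ B]
    (P : OVSpace A B) (a b : A) : Prop :=
  ∀ l : List (Bool × A), l ≠ [] → l.IsChain (fun p q => p.1 ≠ q.1) →
    (∀ p ∈ l, p.2 ∈ P.generated (if p.1 then a else b) ∧ P.φ p.2 = 0) →
    P.φ (l.map Prod.snd).prod = 0

/-! ### Non-crossing partitions

The set `{1, …, n}` is replaced by `Finset.range n = {0, …, n - 1}`. -/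

/-- No two different members of the family cross. -/
def IsNonCrossing (F : Finset (Finset ℕ)) : Prop :=
  ∀ V ∈ F, ∀ W ∈ F, ∀ a b c d : ℕ, a < b → b < c → c < d →
    a ∈ V → c ∈ V → b ∈ W → d ∈ W → V = W

open Classical in
/-- The set of non-crossing partitions of `{0, …, n - 1}`. -/
def NC (n : ℕ) : Finset (Finpartition (range n)) :=
  univ.filter fun π => IsNonCrossing π.parts

open Classical in
/-- The irreducible non-crossing partitions: the first and the last element share a block. -/
def NCirr (n : ℕ) : Finset (Finpartition (range n)) :=
  (NC n).filter fun π => ∃ V ∈ π.parts, 0 ∈ V ∧ n - 1 ∈ V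

/-- The family of blocks of `π ∪ σ`: `π` is placed on the odd elements and `σ` on the even elements
of `{1, …, 2n}`. As indices start from `0` here, `π` occupies the numbers `2i` and `σ`
the numbers `2i + 1`. -/
def interleave {n : ℕ} (π σ : Finpartition (range n)) : Finset (Finset ℕ) :=
  π.parts.image (fun V => V.image fun i => 2 * i) ∪
    σ.parts.image (fun W => W.image fun i => 2 * i + 1)

/-- `i` and `j` are related if no block of `π` has both an element in the interval `(i, j]`
(or `(j, i]`) and an element outside of it. -/
def krewerasSetoid {n : ℕ} (π : Finpartition (range n)) : Setoid ℕ where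
  r i j := ∀ V ∈ π.parts, ∀ u ∈ V, ∀ v ∈ V, ((i < u ↔ j < u) ↔ (i < v ↔ j < v))
  iseqv :=
    { refl := fun i V _ u _ v _ => by simp
      symm := fun {i j} h V hV u hu v hv => by
        have := h V hV u hu v hv
        tauto
      trans := fun {i j k} h h' V hV u hu v hv => by
        have h1 := h V hV u hu v hv
        have h2 := h' V hV u hu v hv
        tauto }

open Classical in
/-- The Kreweras complement `Kr(π)`, see `kreweras_isGreatest` for its characterization. -/
def kreweras {n : ℕ} (π : Finpartition (range n)) : Finpartition (range n) :=
  Finpartition.ofSetSetoid (krewerasSetoid π) (range n)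

theorem krewerasSetoid_of_mem {n : ℕ} {π : Finpartition (range n)} {W : Finset ℕ}
    (hW : W ∈ (kreweras π).parts) {i j : ℕ} (hi : i ∈ W) (hj : j ∈ W) :
    krewerasSetoid π i j := by
  classical
  have hi' : i ∈ range n := (kreweras π).le hW hi
  have h := (Finpartition.mem_part_iff_exists (P := kreweras π) (a := i) (b := j)).2
    ⟨W, hW, hi, hj⟩
  unfold kreweras at h
  rw [Finpartition.mem_part_ofSetSetoid_iff_rel] at h
  exact (krewerasSetoid π).symm h.2.2

/-- `Kr(π)` is the greatest partition `σ`, for the refinement order, such that `π ∪ σ` is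
non-crossing. -/
theorem kreweras_isGreatest {n : ℕ} (π : Finpartition (range n)) (hπ : IsNonCrossing π.parts) :
    IsGreatest {σ : Finpartition (range n) | IsNonCrossing (interleave π σ)} (kreweras π) := by
  classical
  constructor
  · intro V hV W hW a b c d hab hbc hcd haV hcV hbW hdW
    simp only [interleave, mem_union, mem_image] at hV hW
    rcases hV with ⟨V', hV', rfl⟩ | ⟨V', hV', rfl⟩ <;>
      rcases hW with ⟨W', hW', rfl⟩ | ⟨W', hW', rfl⟩ <;>
      simp only [mem_image] at haV hcV hbW hdW <;>
      obtain ⟨a, ha, rfl⟩ := haV <;> obtain ⟨c, hc, rfl⟩ := hcV <;>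
      obtain ⟨b, hb, rfl⟩ := hbW <;> obtain ⟨d, hd, rfl⟩ := hdW
    · rw [hπ V' hV' W' hW' a b c d (by omega) (by omega) (by omega) ha hc hb hd]
    · have := krewerasSetoid_of_mem hW' hb hd V' hV' a ha c hc
      omega
    · have := krewerasSetoid_of_mem hV' ha hc W' hW' b hb d hd
      omega
    · suffices h : V' = W' by rw [h]
      have hac := krewerasSetoid_of_mem hV' ha hc
      have hbd := krewerasSetoid_of_mem hW' hb hd
      have hr : krewerasSetoid π a b := by
        intro U hU u hu v hv
        have h1 := hac U hU u hu v hv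
        have h2 := hbd U hU u hu v hv
        omega
      have hb' : b ∈ (kreweras π).part a := by
        unfold kreweras
        rw [Finpartition.mem_part_ofSetSetoid_iff_rel]
        exact ⟨(kreweras π).le hV' ha, (kreweras π).le hW' hb, hr⟩
      obtain ⟨U, hU, hbU, haU⟩ := Finpartition.mem_part_iff_exists _ |>.1 hb'
      rw [(kreweras π).eq_of_mem_parts hV' hU ha haU, (kreweras π).eq_of_mem_parts hW' hU hb hbU]
  · intro σ hσ W hW
    obtain ⟨i, hi⟩ := σ.nonempty_of_mem_parts hW
    have hin : i ∈ range n := σ.le hW hi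
    refine ⟨(kreweras π).part i, Finpartition.part_mem _ |>.2 hin, fun j hj => ?_⟩
    have key : ∀ V ∈ π.parts, ∀ u ∈ V, ∀ v ∈ V, ∀ i ∈ W, ∀ j ∈ W,
        ¬ (v ≤ i ∧ i < u ∧ u ≤ j) ∧ ¬ (i < u ∧ u ≤ j ∧ j < v) := by
      intro V hV u hu v hv i hi j hj
      have hVm : (V.image fun i => 2 * i) ∈ interleave π σ :=
        mem_union_left _ (mem_image_of_mem _ hV)
      have hWm : (W.image fun i => 2 * i + 1) ∈ interleave π σ :=
        mem_union_right _ (mem_image_of_mem _ hW)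
      have hne : (V.image fun i => 2 * i) ≠ (W.image fun i => 2 * i + 1) := by
        intro h
        have hu2 : 2 * u ∈ W.image fun i => 2 * i + 1 := h ▸ mem_image_of_mem _ hu
        obtain ⟨x, _, hx⟩ := mem_image.1 hu2
        omega
      constructor
      · rintro ⟨h1, h2, h3⟩
        exact hne (hσ _ hVm _ hWm (2 * v) (2 * i + 1) (2 * u) (2 * j + 1) (by omega) (by omega)
          (by omega) (mem_image_of_mem _ hv) (mem_image_of_mem _ hu)
          (mem_image_of_mem (fun i => 2 * i + 1) hi) (mem_image_of_mem (fun i => 2 * i + 1) hj))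
      · rintro ⟨h1, h2, h3⟩
        exact hne (hσ _ hWm _ hVm (2 * i + 1) (2 * u) (2 * j + 1) (2 * v) (by omega) (by omega)
          (by omega) (mem_image_of_mem (fun i => 2 * i + 1) hi)
          (mem_image_of_mem (fun i => 2 * i + 1) hj)
          (mem_image_of_mem _ hu) (mem_image_of_mem _ hv)).symm
    unfold kreweras
    rw [Finpartition.mem_part_ofSetSetoid_iff_rel]
    refine ⟨hin, σ.le hW hj, ?_⟩
    intro V hV u hu v hv
    have h1 := key V hV u hu v hv i hi j hj
    have h2 := key V hV v hv u hu i hi j hj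
    have h3 := key V hV u hu v hv j hj i hi
    have h4 := key V hV v hv u hu j hj i hi
    omega

/-! ### Tree monomials

In the gap-insertion operad a block with `k + 1` legs is an operator with `k + 2` inputs, one for
each gap (front gap, gaps between successive legs, back gap). -/

/-- Planar rooted trees whose inner vertices are blocks: `node k legs child` is a block with
increasingly ordered legs `legs 0, …, legs k` and one child for each of its `k + 2` gaps. -/
inductive GapTree : Type
  | leaf : GapTree
  | node (k : ℕ) (legs : Fin (k + 1) → ℕ) (child : Fin (k + 2) → GapTree) : GapTree

/-- The legs in `[i, j)` of the block containing `j - 1`. -/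
def legsIn (F : Finset (Finset ℕ)) (i j : ℕ) : Finset ℕ := by
  classical
  exact (Ico i j).filter fun v => ∃ V ∈ F, v ∈ V ∧ j - 1 ∈ V

/-- The tree monomial of the restriction to `[i, j)` of a non-crossing partition with family of
blocks `F`: its root is the block of the last element `j - 1`, hence the rightmost input of each
vertex is a leaf. -/
def treeMonomial (F : Finset (Finset ℕ)) (i j : ℕ) : GapTree :=
  if h : (legsIn F i j).Nonempty then
    let legs : Fin ((legsIn F i j).card - 1 + 1) → ℕ :=
      (legsIn F i j).orderEmbOfFin (Nat.sub_add_cancel h.card_pos).symm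
    .node ((legsIn F i j).card - 1) legs fun t =>
      treeMonomial F
        ((Fin.cons i (fun s => legs s + 1) :
          Fin ((legsIn F i j).card - 1 + 2) → ℕ) t)
        ((Fin.snoc legs j :
          Fin ((legsIn F i j).card - 1 + 2) → ℕ) t)
  else .leaf
termination_by j - i
decreasing_by
  have hlo : ∀ s, i ≤ legs s ∧ legs s < j := fun s =>
    mem_Ico.1 (mem_of_mem_filter _ (Finset.orderEmbOfFin_mem _ _ s))
  have h0 := hlo 0
  have hhi : (Fin.snoc legs j : Fin ((legsIn F i j).card - 1 + 2) → ℕ) t ≤ j := by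
    refine Fin.lastCases ?_ (fun s => ?_) t
    · simp
    · simpa using (hlo s).2.le
  refine Fin.cases (fun _ => ?_) (fun s hhi => ?_) t hhi
  · have : (Fin.snoc legs j : Fin ((legsIn F i j).card - 1 + 2) → ℕ) 0 = legs 0 :=
      Fin.snoc_castSucc (α := fun _ => ℕ) j legs 0
    rw [this, Fin.cons_zero]
    omega
  · have hs := hlo s
    rw [Fin.cons_succ]
    have aux : ∀ x, i ≤ x → x < j → j - (x + 1) < j - i := fun x h1 h2 => by omega
    exact (Nat.sub_le_sub_right hhi _).trans_lt (aux _ hs.1 hs.2)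

/-! ### Free cumulants -/

section Cumulants

variable {A B : Type*} [Ring A] [Algebra ℂ A] [Ring B] [Algebra ℂ B]

/-- The word `c₀ w₁ c₁, w₂ c₂, …, w_k c_k`. -/
def OVSpace.gapWord (P : OVSpace A B) {k : ℕ} (w : Fin (k + 1) → A) (c : Fin (k + 2) → B) :
    Fin (k + 1) → A :=
  fun t => (if t = 0 then P.ι (c 0) else 1) * w t * P.ι (c t.succ)

/-- The operadic (nested) evaluation of a tree of blocks: a block `{v₁ < ⋯ < v_k}` with values
`c₀, …, c_k` in its gaps is evaluated to `κ_k(c₀ w_{v₁} c₁, w_{v₂} c₂, …, w_{v_k} c_k)`; the leaves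
are evaluated to the unit of `B`. -/
def OVSpace.evalTree (P : OVSpace A B) (κ : (n : ℕ) → (Fin n → A) → B) (w : ℕ → A) :
    GapTree → B
  | .leaf => 1
  | .node k legs child =>
      κ (k + 1) (P.gapWord (fun t => w (legs t)) fun t => P.evalTree κ w (child t))

/-- The value `κ_π(w₁, …, w_n)` for a non-crossing partition `π` of a family of functions `κ_n`. -/
def OVSpace.partitioned (P : OVSpace A B) (κ : (n : ℕ) → (Fin n → A) → B) {n : ℕ}
    (π : Finpartition (range n)) (w : Fin n → A) : B :=
  P.evalTree κ (fun i => if h : i < n then w ⟨i, h⟩ else 1) (treeMonomial π.parts 0 n)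

/-- The operator-valued free cumulants `κ_n : A^n → B`, defined recursively by the
moment-cumulant relations `φ(w₁ ⋯ w_n) = ∑_{π ∈ NC(n)} κ_π(w₁, …, w_n)`
(see `OVSpace.moment_eq_sum`). -/
def OVSpace.freeCumulant (P : OVSpace A B) (n : ℕ) (w : Fin n → A) : B :=
  P.φ (List.ofFn w).prod -
    ∑ π ∈ (NC n).filter (fun π => π.parts ≠ {range n}),
      P.partitioned (fun m v => if m < n then P.freeCumulant m v else 0) π w
termination_by n

theorem treeMonomial_of_card {F : Finset (Finset ℕ)} {i j k : ℕ}
    (h : (legsIn F i j).card = k + 1) :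
    treeMonomial F i j = .node k ((legsIn F i j).orderEmbOfFin h) fun t =>
      treeMonomial F
        ((Fin.cons i (fun s => (legsIn F i j).orderEmbOfFin h s + 1) : Fin (k + 2) → ℕ) t)
        ((Fin.snoc ((legsIn F i j).orderEmbOfFin h) j : Fin (k + 2) → ℕ) t) := by
  obtain rfl : k = (legsIn F i j).card - 1 := by omega
  rw [treeMonomial, dif_pos (card_pos.1 (by omega))]

theorem treeMonomial_of_empty {F : Finset (Finset ℕ)} {i j : ℕ} (h : legsIn F i j = ∅) :
    treeMonomial F i j = .leaf := by
  rw [treeMonomial, dif_neg (by simp [h])]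

theorem treeMonomial_self (F : Finset (Finset ℕ)) (i : ℕ) : treeMonomial F i i = .leaf :=
  treeMonomial_of_empty (by simp [legsIn])

theorem OVSpace.evalTree_congr (P : OVSpace A B) {κ κ' : (n : ℕ) → (Fin n → A) → B} (w : ℕ → A)
    {n : ℕ} (hκ : ∀ m < n, κ m = κ' m) {F : Finset (Finset ℕ)}
    (hF : ∀ i j, (legsIn F i j).card < n) (i j : ℕ) :
    P.evalTree κ w (treeMonomial F i j) = P.evalTree κ' w (treeMonomial F i j) := by
  suffices h : ∀ T : GapTree, (∃ i j, T = treeMonomial F i j) →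
      P.evalTree κ w T = P.evalTree κ' w T from h _ ⟨i, j, rfl⟩
  intro T
  induction T with
  | leaf => intro _; rfl
  | node k legs child ih =>
    rintro ⟨i, j, h⟩
    have hne : legsIn F i j ≠ ∅ := fun h0 => by
      rw [treeMonomial_of_empty h0] at h
      cases h
    obtain ⟨m, hm⟩ : ∃ m, (legsIn F i j).card = m + 1 :=
      Nat.exists_eq_succ_of_ne_zero (by simpa using hne)
    rw [treeMonomial_of_card hm] at h
    obtain ⟨rfl, h1, h2⟩ := GapTree.node.inj h
    have h2 := eq_of_heq h2
    simp only [evalTree]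
    rw [hκ _ (hm ▸ hF i j)]
    congr 2
    funext t
    exact ih t ⟨_, _, congrFun h2 t⟩

theorem legsIn_card_lt {n : ℕ} {π : Finpartition (range n)} (hn : 0 < n)
    (hπ : π.parts ≠ {range n}) (i j : ℕ) : (legsIn π.parts i j).card < n := by
  classical
  by_cases hj : j - 1 ∈ range n
  · obtain ⟨V, ⟨hV, hjV⟩, huniq⟩ := π.existsUnique_mem hj
    have hsub : legsIn π.parts i j ⊆ V := by
      intro v hv
      obtain ⟨_, W, hW, hvW, hjW⟩ := mem_filter.1 hv
      exact huniq W ⟨hW, hjW⟩ ▸ hvW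
    have hlt : V ⊂ range n := by
      refine ssubset_of_subset_of_ne (π.le hV) fun h => hπ ?_
      refine eq_singleton_iff_unique_mem.2 ⟨h ▸ hV, fun W hW => ?_⟩
      obtain ⟨x, hx⟩ := π.nonempty_of_mem_parts hW
      rw [← h]
      exact π.eq_of_mem_parts hW hV hx (h ▸ π.le hW hx)
    calc _ ≤ V.card := card_le_card hsub
      _ < (range n).card := card_lt_card hlt
      _ = n := card_range n
  · have : legsIn π.parts i j = ∅ := by
      refine eq_empty_of_forall_notMem fun v hv => hj ?_
      obtain ⟨_, W, hW, _, hjW⟩ := mem_filter.1 hv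
      exact π.le hW hjW
    simpa [this] using hn

theorem legsIn_range (n : ℕ) : legsIn {range (n + 1)} 0 (n + 1) = range (n + 1) := by
  ext v
  simp [legsIn]

theorem treeMonomial_range (n : ℕ) :
    treeMonomial {range (n + 1)} 0 (n + 1) =
      .node n (fun t => (t : ℕ)) fun _ => .leaf := by
  have hc : (legsIn {range (n + 1)} 0 (n + 1)).card = n + 1 := by simp [legsIn_range]
  have hl : ∀ t, (legsIn {range (n + 1)} 0 (n + 1)).orderEmbOfFin hc t = (t : ℕ) := by
    intro t
    refine (congrFun (Finset.orderEmbOfFin_unique hc (f := fun t : Fin (n + 1) => (t : ℕ))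
      (fun x => ?_) (fun a b h => h)) t).symm
    rw [legsIn_range]
    exact mem_range.2 x.2
  rw [treeMonomial_of_card hc]
  simp only [hl]
  congr 1
  · exact funext hl
  funext t
  have : ((Fin.cons 0 (fun s : Fin (n + 1) => (s : ℕ) + 1) : Fin (n + 2) → ℕ) t) = t := by
    refine Fin.cases ?_ (fun s => ?_) t <;> simp
  rw [this]
  have h2 : (((legsIn {range (n + 1)} 0 (n + 1)).orderEmbOfFin hc : Fin (n + 1) → ℕ)) =
      fun s : Fin (n + 1) => (s : ℕ) := funext hl
  rw [h2]
  have : ((Fin.snoc (fun s : Fin (n + 1) => (s : ℕ)) (n + 1) : Fin (n + 2) → ℕ) t) = t := by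
    refine Fin.lastCases ?_ (fun s => ?_) t <;> simp
  rw [this, treeMonomial_self]

theorem OVSpace.partitioned_one (P : OVSpace A B) (κ : (n : ℕ) → (Fin n → A) → B) {n : ℕ}
    (π : Finpartition (range (n + 1))) (hπ : π.parts = {range (n + 1)}) (w : Fin (n + 1) → A) :
    P.partitioned κ π w = κ (n + 1) w := by
  rw [partitioned, hπ, treeMonomial_range]
  simp only [evalTree]
  congr 1
  funext t
  simp [gapWord, Nat.not_lt.2 (Nat.lt_succ_iff.1 t.2)]

/-- The moment-cumulant relations. -/
theorem OVSpace.moment_eq_sum (P : OVSpace A B) {n : ℕ} (w : Fin n → A) :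
    P.φ (List.ofFn w).prod = ∑ π ∈ NC n, P.partitioned P.freeCumulant π w := by
  classical
  rw [← sum_filter_add_sum_filter_not (NC n) (fun π => π.parts ≠ {range n})]
  have h1 : ∑ π ∈ (NC n).filter (fun π => π.parts ≠ {range n}),
      P.partitioned P.freeCumulant π w = P.φ (List.ofFn w).prod - P.freeCumulant n w := by
    rw [freeCumulant, sub_sub_cancel]
    refine sum_congr (by congr) fun π hπ => ?_
    rcases Nat.eq_zero_or_pos n with rfl | hn
    · simp [partitioned, treeMonomial_self, evalTree]
    · refine P.evalTree_congr _ (n := n) (fun m hm => ?_)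
        (legsIn_card_lt hn (mem_filter.1 hπ).2) _ _
      funext v
      simp [hm]
  rw [h1]
  rcases n with _ | n
  · have h2 : P.freeCumulant 0 w = 0 := by
      have h0 : (⊥ : Finpartition (range 0)).parts = ∅ := rfl
      have : (NC 0).filter (fun π => π.parts ≠ {range 0}) = {⊥} := by
        ext π
        obtain rfl : π = (⊥ : Finpartition (range 0)) := by
          change π = (⊥ : Finpartition (∅ : Finset ℕ))
          exact Subsingleton.elim (α := Finpartition (⊥ : Finset ℕ)) _ _
        simp only [NC, mem_filter, mem_univ, true_and, mem_singleton, iff_true]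
        refine ⟨fun V hV => absurd hV (by rw [h0]; exact notMem_empty V), fun h => ?_⟩
        have h4 : (∅ : Finset ℕ) ∈ (⊥ : Finpartition (range 0)).parts := by rw [h]; simp
        exact Finpartition.ne_bot _ h4 rfl
      have h1 : P.φ 1 = 1 := by simpa using P.φ_ι 1
      rw [freeCumulant, sum_congr (s₂ := {⊥}) (by convert this) (fun _ _ => rfl), sum_singleton]
      simp [partitioned, treeMonomial_self, evalTree, h1]
    rw [h2, sub_zero, left_eq_add]
    refine sum_eq_zero fun π hπ => ?_
    have h3 := not_not.1 (mem_filter.1 hπ).2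
    have h4 : (∅ : Finset ℕ) ∈ π.parts := by rw [h3]; simp
    exact absurd rfl (π.ne_bot h4)
  · have h2 : (NC (n + 1)).filter (fun π => ¬ π.parts ≠ {range (n + 1)}) =
        {Finpartition.indiscrete (by simp)} := by
      ext π
      simp only [NC, mem_filter, mem_univ, true_and, not_not, mem_singleton,
        Finpartition.ext_iff, Finpartition.indiscrete_parts]
      refine ⟨fun h => h.2, fun h => ⟨?_, h⟩⟩
      rw [h]
      intro V hV W hW
      simp [mem_singleton.1 hV, mem_singleton.1 hW]
    rw [h2, sum_singleton, P.partitioned_one _ _ rfl, sub_add_cancel]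

end Cumulants

/-! ### Linked partitions

Planar monomials in (three coloured copies of) the operad of non-crossing linked partitions, in
which a one-block partition `1_m = {{1, …, m}}` has `m` inputs, one for each leg, and grafting a
monomial at an input links it to this leg. -/

/-- Monomials representing the linked partitions `π̃_ℓ`: the vertex `black m` is a black one-block
linked partition `1_{m+1}`, the vertex `blue m` is a blue `1_{m+1}`, and `outer m`, used
for the root, is the blue linked partition `θ_{m+2} = {{1}, {2, …, m+2}}`. -/
inductive LinkedTree : Type
  | leaf : LinkedTree
  | black (m : ℕ) (child : Fin (m + 1) → LinkedTree) : LinkedTree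
  | blue (m : ℕ) (child : Fin (m + 1) → LinkedTree) : LinkedTree
  | outer (m : ℕ) (child : Fin (m + 2) → LinkedTree) : LinkedTree

/-- The number of inputs (leaves). -/
def LinkedTree.arity : LinkedTree → ℕ
  | .leaf => 1
  | .black _ child => ∑ t, (child t).arity
  | .blue _ child => ∑ t, (child t).arity
  | .outer _ child => ∑ t, (child t).arity

/-- Below the root: the rightmost leaf of each black vertex (legs at even numbers, as indices start
from `0`) and the leftmost leaf of each blue vertex are erased, and the vertices which are
left with a single input (those of the one-element blocks) are erased, too. -/
def eraseLeaves : GapTree → LinkedTree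
  | .leaf => .leaf
  | .node 0 legs child =>
      if Even (legs 0) then eraseLeaves (child 0) else eraseLeaves (child 1)
  | .node (k + 1) legs child =>
      if Even (legs 0) then .black (k + 1) fun t => eraseLeaves (child t.castSucc)
      else .blue (k + 1) fun t => eraseLeaves (child t.succ)

/-- The linked partition of a tree of blocks whose root is blue; the root keeps all its inputs. -/
def linkedOfTree : GapTree → LinkedTree
  | .leaf => .leaf
  | .node k _ child => .outer k fun t => eraseLeaves (child t)

/-- The bicoloured linked partition `π̃_ℓ` associated with `π̃ = π ∪ Kr(π)`. -/
def linked {n : ℕ} (π : Finpartition (range n)) : LinkedTree :=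
  linkedOfTree (treeMonomial (interleave π (kreweras π)) 0 (2 * n))

/-! ### Multilinear function series

A series is the sequence of its homogeneous components `B^n → B`. -/

/-- Series of maps `B^n → B`, `n ≥ 0`. -/
abbrev MSeries (B : Type*) := (n : ℕ) → (Fin n → B) → B

section Series

variable {B : Type*} [Ring B]

/-- The identity series `I = (0, id, 0, …)`. -/
def MSeries.I : MSeries B
  | 1, c => c 0
  | _, _ => 0

/-- The concatenation product
`(α · β)_n(b₁, …, b_n) = ∑_k α_k(b₁, …, b_k) β_{n-k}(b_{k+1}, …, b_n)`. -/
def MSeries.dot (α β : MSeries B) : MSeries B := fun n c =>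
  ∑ k : Fin (n + 1),
    α k (fun i => c ⟨i, by omega⟩) * β (n - k) (fun i => c ⟨k + i, by omega⟩)

/-- The composition product of `α` with a series `β` without constant term, a sum over
the compositions `p₁ + ⋯ + p_k = n` with `p_i ≥ 1`. -/
def MSeries.times (α β : MSeries B) : MSeries B := fun n c =>
  ∑ p : Composition n, α p.length fun i => β (p.blocksFun i) (c ∘ p.embedding i)

end Series

section Product

variable {A B : Type*} [Ring A] [Algebra ℂ A] [Ring B] [Algebra ℂ B]

/-- The multilinear map `(c₁, …, c_n) ↦ κ_{n+1}(x c₁, x c₂, …, x c_n, x)`. -/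
def OVSpace.cumulantMap (P : OVSpace A B) (x : A) : MSeries B := fun n c =>
  P.freeCumulant (n + 1) (Fin.snoc (fun i => x * P.ι (c i)) x)

/-- The cumulant series `K_x`, with constant term `1`. -/
def OVSpace.K (P : OVSpace A B) (x : A) : MSeries B
  | 0, _ => 1
  | n + 1, c => P.cumulantMap x (n + 1) c

/-- `k_L^a(m+1)(c₁, …, c_{m+1}) = κ_{m+1}(c₁ a, …, c_{m+1} a)`. -/
def OVSpace.kL (P : OVSpace A B) (a : A) (m : ℕ) (c : Fin (m + 1) → B) : B :=
  P.freeCumulant (m + 1) fun t => P.ι (c t) * a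

/-- `k_R^b(m+1)(c₁, …, c_{m+1}) = κ_{m+1}(b c₁, …, b c_m, b) c_{m+1}`. -/
def OVSpace.kR (P : OVSpace A B) (b : A) (m : ℕ) (c : Fin (m + 1) → B) : B :=
  P.cumulantMap b m (fun i => c i.castSucc) * c (Fin.last m)

/-- `k_LR^b(m+2)(c₀, …, c_{m+1}) = c₀ κ_{m+1}(b c₁, …, b c_m, b) c_{m+1}`. -/
def OVSpace.kLR (P : OVSpace A B) (b : A) (m : ℕ) (c : Fin (m + 2) → B) : B :=
  c 0 * P.kR b m fun i => c i.succ

/-- The operadic morphism `K̂_{a,b}` with values in the endomorphism operad of `B` which evaluates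
black vertices as `k_L^a`, blue vertices as `k_R^b` and the outer blue vertex as `k_LR^b`. The
inputs `x 0, x 1, …` are attached to the leaves from left to right. -/
def OVSpace.Khat (P : OVSpace A B) (a b : A) : LinkedTree → (ℕ → B) → B
  | .leaf, x => x 0
  | .black m child, x =>
      P.kL a m fun t => P.Khat a b (child t) fun i => x ((∑ s ∈ Iio t, (child s).arity) + i)
  | .blue m child, x =>
      P.kR b m fun t => P.Khat a b (child t) fun i => x ((∑ s ∈ Iio t, (child s).arity) + i)
  | .outer m child, x =>
      P.kLR b m fun t => P.Khat a b (child t) fun i => x ((∑ s ∈ Iio t, (child s).arity) + i)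

/-- The series `V_{a,b}` with constant term `1` and, for `n ≥ 1`,
`V_n(c₁, …, c_n) = ∑_π K̂_{a,b}(π̃_ℓ)(1, c₁, …, c_n, 1)`, where `π` ranges over the irreducible
non-crossing partitions of `n + 1` elements (for these `π̃_ℓ` has `n + 2` inputs). -/
def OVSpace.V (P : OVSpace A B) (a b : A) : MSeries B
  | 0, _ => 1
  | n + 1, c => ∑ π ∈ NCirr (n + 2),
      P.Khat a b (linked π) fun i => if h : 1 ≤ i ∧ i ≤ n + 1 then c ⟨i - 1, by omega⟩ else 1

end Product

end FreeProd

end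

noncomputable section

open Finset

namespace FreeProd

/-! A series of maps is treated as a function on words in `B`. With concatenation as product such
series form a ring, `φ` acts coefficientwise (call this E) and is bimodular over `B`-valued series,
and composition with a fixed inner series is a ring homomorphism in the outer one (`comp_mul`). Both
claims become identities in these rings. Write I for the letter series and K_x for the cumulant
series of x.

Product formula. Grouping partitions by the block of the last element turns the moment-cumulant
relations into Φ = 1 + Φ (K∘(IΦ)) I for the moment series Φ of x. Equivalently, as far as needed:
the resolvent (1 - (x - K) I)⁻¹ has expectation 1 (`expect_resolvent`), and a resolvent identity
shows that this property determines K (`eq_of_expect_resolvent`). So it suffices to test the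
candidate Vk for x = ab, where k = K_b∘(IV). Put y = a - V and z = b - k. Since V = K_a∘(kI), the
series u = (1 - ykI)⁻¹y and v = (1 - zIV)⁻¹z are centred, and 1 - (ab - Vk) I = (1 - ykI)(1 - Q)(1 -
VzI) with Q = u(1 + kIV)vI. The inverse of the right side is 1 plus alternating centred products, up
to coefficients in `B`, so freeness gives expectation 1 (`cumulant_mul_of_free`).

Equation for V. A non-crossing partition is a tree: the block of the last element is the root, and
the gaps carry subtrees. If π is irreducible, the last blue element of π ∪ Kr(π) is a singleton, and
the rest runs through exactly the trees in which every block has one parity and spans its interval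
(`sum_NCirr_eq_sum_trees`). Black and blue blocks then alternate along nesting, and summing over the
legs of the root gives V = K_a∘((K_b∘(IV)) I) (`spanSeries_eq`). The erased leaves count as 1, and
the contracted vertices contribute φ(a) = 1 or φ(b) = 1, so the operadic evaluation agrees with this
sum (`Khat_eraseLeaves`).

Both halves need the scalars of `B` to move through cumulants and the cumulants to be additive; this
is extracted from their recursive definition in `cumulantSeries_aux`. -/

/-! ### Series indexed by words

A series of maps `B^n → A` is encoded as a function on the lists of elements of `B`. With the
concatenation product these series form a ring. -/

/-- Series of maps `B^n → A`, as functions on lists. -/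
@[ext] structure WordSeries (B A : Type*) where
  /-- The value at a word. -/
  coeff : List B → A

namespace WordSeries

variable {B A : Type*}

instance : CoeFun (WordSeries B A) fun _ => List B → A := ⟨coeff⟩

/-- The series `l ↦ F (c :: l)`. -/
def der (c : B) (F : WordSeries B A) : WordSeries B A := ⟨fun l => F (c :: l)⟩

@[simp] theorem der_apply (c : B) (F : WordSeries B A) (l : List B) : der c F l = F (c :: l) := rfl

theorem ext' {F G : WordSeries B A} (h : ∀ l, F l = G l) : F = G := WordSeries.ext (funext h)

section Ring

variable [Ring A]

instance : Add (WordSeries B A) := ⟨fun F G => ⟨fun l => F l + G l⟩⟩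
instance : Sub (WordSeries B A) := ⟨fun F G => ⟨fun l => F l - G l⟩⟩
instance : Neg (WordSeries B A) := ⟨fun F => ⟨fun l => -F l⟩⟩
instance : Zero (WordSeries B A) := ⟨⟨fun _ => 0⟩⟩

@[simp] theorem add_apply (F G : WordSeries B A) (l : List B) : (F + G) l = F l + G l := rfl
@[simp] theorem sub_apply (F G : WordSeries B A) (l : List B) : (F - G) l = F l - G l := rfl
@[simp] theorem neg_apply (F : WordSeries B A) (l : List B) : (-F) l = -F l := rfl
@[simp] theorem zero_apply (l : List B) : (0 : WordSeries B A) l = 0 := rfl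

/-- The concatenation product. -/
def conv : List B → WordSeries B A → WordSeries B A → A
  | [], F, G => F [] * G []
  | c :: l, F, G => F [] * G (c :: l) + conv l (der c F) G

/-- The constant series. -/
def const (x : A) : WordSeries B A :=
  ⟨fun l => match l with
    | [] => x
    | _ :: _ => 0⟩

instance : Mul (WordSeries B A) := ⟨fun F G => ⟨fun l => conv l F G⟩⟩
instance : One (WordSeries B A) := ⟨const 1⟩

@[simp] theorem const_nil (x : A) : (const x : WordSeries B A) [] = x := rfl
@[simp] theorem const_cons (x : A) (c : B) (l : List B) : const x (c :: l) = 0 := rfl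
theorem one_def : (1 : WordSeries B A) = const 1 := rfl
@[simp] theorem one_nil : (1 : WordSeries B A) [] = 1 := rfl
@[simp] theorem one_cons (c : B) (l : List B) : (1 : WordSeries B A) (c :: l) = 0 := rfl

@[simp] theorem mul_nil (F G : WordSeries B A) : (F * G) [] = F [] * G [] := rfl
theorem mul_cons (F G : WordSeries B A) (c : B) (l : List B) :
    (F * G) (c :: l) = F [] * G (c :: l) + (der c F * G) l := rfl

theorem der_add (c : B) (F G : WordSeries B A) : der c (F + G) = der c F + der c G := rfl
@[simp] theorem der_const (c : B) (x : A) : der c (const x) = 0 := rfl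
@[simp] theorem der_zero (c : B) : der c (0 : WordSeries B A) = 0 := rfl

protected theorem add_mul' (l : List B) (F G H : WordSeries B A) :
    ((F + G) * H) l = (F * H) l + (G * H) l := by
  induction l generalizing F G with
  | nil => simp [add_mul]
  | cons c l ih => simp only [mul_cons, der_add, ih, add_apply]; noncomm_ring

protected theorem mul_add' (l : List B) (F G H : WordSeries B A) :
    (F * (G + H)) l = (F * G) l + (F * H) l := by
  induction l generalizing F with
  | nil => simp [mul_add]
  | cons c l ih => simp only [mul_cons, ih, add_apply]; noncomm_ring

protected theorem zero_mul' (l : List B) (F : WordSeries B A) :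
    ((0 : WordSeries B A) * F) l = 0 := by
  induction l with
  | nil => simp
  | cons c l ih => simp [mul_cons, ih]

protected theorem mul_zero' (l : List B) (F : WordSeries B A) : (F * 0) l = 0 := by
  induction l generalizing F with
  | nil => simp
  | cons c l ih => simp [mul_cons, ih]

theorem const_mul_apply (x : A) (F : WordSeries B A) (l : List B) :
    (const x * F : WordSeries B A) l = x * F l := by
  cases l with
  | nil => rfl
  | cons c l => simp [mul_cons, WordSeries.zero_mul']

theorem mul_const_apply (x : A) (F : WordSeries B A) (l : List B) :
    (F * const x : WordSeries B A) l = F l * x := by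
  induction l generalizing F with
  | nil => rfl
  | cons c l ih => simp [mul_cons, ih]

/-- A twisted Leibniz rule: the first letter falls into `G` exactly when `F` takes the empty word.
Associativity and the multiplicativity of composition rest on it. -/
theorem der_mul (c : B) (F G : WordSeries B A) :
    der c (F * G) = const (F []) * der c G + der c F * G := by
  refine ext' fun l => ?_
  simp [mul_cons, const_mul_apply]

protected theorem smul_mul' (x : A) (l : List B) (F G : WordSeries B A) :
    ((const x * F) * G : WordSeries B A) l = x * (F * G) l := by
  induction l generalizing F with
  | nil => simp [mul_assoc]
  | cons c l ih =>
    have : der c (const x * F) = const x * der c F := by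
      refine ext' fun l => ?_; simp [const_mul_apply]
    rw [mul_cons, this, ih, mul_cons]
    simp [mul_add, mul_assoc]

protected theorem mul_assoc' (l : List B) (F G H : WordSeries B A) :
    ((F * G) * H) l = (F * (G * H)) l := by
  induction l generalizing F with
  | nil => simp [mul_assoc]
  | cons c l ih =>
    rw [mul_cons, der_mul, WordSeries.add_mul', ih, WordSeries.smul_mul', mul_cons F, mul_cons G]
    simp [mul_add, mul_assoc, add_assoc]

instance : Ring (WordSeries B A) where
  add_assoc F G H := ext' fun l => add_assoc _ _ _
  add_comm F G := ext' fun l => add_comm _ _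
  zero_add F := ext' fun l => zero_add _
  add_zero F := ext' fun l => add_zero _
  neg_add_cancel F := ext' fun l => neg_add_cancel _
  sub_eq_add_neg F G := ext' fun l => sub_eq_add_neg _ _
  nsmul := nsmulRec
  mul_assoc F G H := ext' fun l => WordSeries.mul_assoc' l F G H
  left_distrib F G H := ext' fun l => WordSeries.mul_add' l F G H
  right_distrib F G H := ext' fun l => WordSeries.add_mul' l F G H
  zero_mul F := ext' fun l => WordSeries.zero_mul' l F
  mul_zero F := ext' fun l => WordSeries.mul_zero' l F
  one_mul F := ext' fun l => by rw [one_def, const_mul_apply, one_mul]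
  mul_one F := ext' fun l => by rw [one_def, mul_const_apply, mul_one]
  zsmul := zsmulRec

/-- Membership of the values of a product. -/
theorem mul_apply_mem {T : Type*} [SetLike T A] [AddMemClass T A] (t : T) (F G : WordSeries B A)
    (l : List B) (h : ∀ l₁ l₂, l = l₁ ++ l₂ → F l₁ * G l₂ ∈ t) : (F * G) l ∈ t := by
  induction l generalizing F with
  | nil => exact h [] [] rfl
  | cons c l ih =>
    rw [mul_cons]
    exact add_mem (h [] _ rfl) (ih _ fun l₁ l₂ hl => h (c :: l₁) l₂ (by simp [hl]))

/-- Only complementary pieces of the given word matter, which is what allows lengths to be tracked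
in inductions. -/
theorem mul_congr {F F' G G' : WordSeries B A} {l : List B}
    (h : ∀ l₁ l₂, l = l₁ ++ l₂ → F l₁ * G l₂ = F' l₁ * G' l₂) : (F * G) l = (F' * G') l := by
  induction l generalizing F F' with
  | nil => exact h [] [] rfl
  | cons c l ih =>
    rw [mul_cons, mul_cons, h [] _ rfl,
      ih (F := der c F) (F' := der c F') fun l₁ l₂ hl => h (c :: l₁) l₂ (by simp [hl])]

theorem mul_eq_zero_of {F G : WordSeries B A} {l : List B}
    (h : ∀ l₁ l₂, l = l₁ ++ l₂ → F l₁ * G l₂ = 0) : (F * G) l = 0 := by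
  rw [← zero_apply (B := B) l, ← zero_mul (0 : WordSeries B A)]
  exact mul_congr (by simpa using h)

/-- The letter series, with values in an algebra over `B`. -/
def letter (ι : B → A) : WordSeries B A :=
  ⟨fun l => match l with
    | [c] => ι c
    | _ => 0⟩

@[simp] theorem letter_nil (ι : B → A) : letter ι [] = 0 := rfl
@[simp] theorem letter_single (ι : B → A) (c : B) : letter ι [c] = ι c := rfl
@[simp] theorem letter_cons_cons (ι : B → A) (c d : B) (l : List B) :
    letter ι (c :: d :: l) = 0 := rfl

theorem der_letter (ι : B → A) (c : B) : der c (letter ι) = const (ι c) := by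
  refine ext' fun l => ?_; cases l <;> rfl

theorem letter_mul_cons (ι : B → A) (F : WordSeries B A) (c : B) (l : List B) :
    (letter ι * F) (c :: l) = ι c * F l := by
  rw [mul_cons, der_letter, const_mul_apply]; simp

theorem mul_letter_append (ι : B → A) (F : WordSeries B A) (l : List B) (c : B) :
    (F * letter ι) (l ++ [c]) = F l * ι c := by
  induction l generalizing F with
  | nil => simp [mul_cons]
  | cons d l ih =>
    rw [List.cons_append, mul_cons, ih]
    rcases l with _ | ⟨e, l⟩ <;> simp

/-! ### Inverses -/

/-- Approximations of the geometric series. -/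
def geomAux (F : WordSeries B A) : ℕ → WordSeries B A
  | 0 => 1
  | n + 1 => 1 + F * geomAux F n

/-- The geometric series `(1 - F)⁻¹` of a series without constant term. -/
def geom (F : WordSeries B A) : WordSeries B A :=
  ⟨fun l => geomAux F l.length l⟩

/-- Without constant term, each further factor `F` consumes at least one letter, so the
approximations are stable on words no longer than their order. -/
theorem geomAux_eq {F : WordSeries B A} (hF : F [] = 0) (n m : ℕ) (l : List B)
    (hn : l.length ≤ n) (hm : l.length ≤ m) : geomAux F n l = geomAux F m l := by
  induction n generalizing m l with
  | zero =>
    obtain rfl : l = [] := by simpa using hn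
    cases m <;> simp [geomAux, hF]
  | succ n ih =>
    cases m with
    | zero =>
      obtain rfl : l = [] := by simpa using hm
      simp [geomAux, hF]
    | succ m =>
      simp only [geomAux, add_apply]
      congr 1
      refine mul_congr fun l₁ l₂ hl => ?_
      rcases l₁ with _ | ⟨c, l₁⟩
      · simp [hF]
      · have : l.length = l₁.length + 1 + l₂.length := by simp [hl]; omega
        rw [ih m l₂ (by omega) (by omega)]

theorem geom_apply (F : WordSeries B A) (l : List B) : geom F l = geomAux F l.length l := rfl

theorem geom_eq {F : WordSeries B A} (hF : F [] = 0) : geom F = 1 + F * geom F := by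
  refine ext' fun l => ?_
  rw [geom_apply, geomAux_eq hF l.length (l.length + 1) l le_rfl (by omega), geomAux, add_apply,
    add_apply]
  congr 1
  refine mul_congr fun l₁ l₂ hl => ?_
  rw [geom_apply, geomAux_eq hF l.length l₂.length l₂ (by simp [hl]) le_rfl]

theorem one_sub_mul_geom {F : WordSeries B A} (hF : F [] = 0) : (1 - F) * geom F = 1 := by
  have h := geom_eq hF
  rw [sub_mul, one_mul, sub_eq_iff_eq_add]
  exact h

/-- The right inverse `geom F` of `1 - F` is again 1 plus a series without constant term, so it has
a right inverse itself, which must be `1 - F`. -/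
theorem geom_mul_one_sub {F : WordSeries B A} (hF : F [] = 0) : geom F * (1 - F) = 1 := by
  have h1 := one_sub_mul_geom hF
  have hG : (-(F * geom F)) [] = 0 := by simp [hF]
  have h2 := one_sub_mul_geom hG
  have h3 : 1 - -(F * geom F) = geom F := by rw [sub_neg_eq_add, ← geom_eq hF]
  rw [h3] at h2
  rwa [← left_inv_eq_right_inv h1 h2] at h2

end Ring

/-! ### Composition -/

section Comp

variable [Ring A]

/-- The sum over all ways to cut `u ++ l` into nonempty pieces, `u` being part of the first one. -/
def compAux (f : WordSeries B B) : List B → WordSeries B A → List B → A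
  | [], F, u => F [f u]
  | c :: l, F, u => compAux f l F (u ++ [c]) + compAux f l (der (f u) F) [c]

/-- The composition of series: `f` is evaluated at the pieces of a word. -/
def comp (F : WordSeries B A) (f : WordSeries B B) : WordSeries B A :=
  ⟨fun l => match l with
    | [] => F []
    | c :: l => compAux f l F [c]⟩

@[simp] theorem comp_nil (F : WordSeries B A) (f : WordSeries B B) : comp F f [] = F [] := rfl
theorem comp_cons (F : WordSeries B A) (f : WordSeries B B) (c : B) (l : List B) :
    comp F f (c :: l) = compAux f l F [c] := rfl

theorem compAux_add (f : WordSeries B B) (F G : WordSeries B A) (u l : List B) :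
    compAux f l (F + G) u = compAux f l F u + compAux f l G u := by
  induction l generalizing F G u with
  | nil => rfl
  | cons c l ih => simp only [compAux, der_add, ih]; abel

theorem compAux_zero (f : WordSeries B B) (u l : List B) :
    compAux f l (0 : WordSeries B A) u = 0 := by
  induction l generalizing u with
  | nil => rfl
  | cons c l ih => simp only [compAux, der_zero, ih, add_zero]

theorem compAux_const_mul (f : WordSeries B B) (x : A) (F : WordSeries B A) (u l : List B) :
    compAux f l (const x * F) u = x * compAux f l F u := by
  induction l generalizing F u with
  | nil => simp [compAux, const_mul_apply]
  | cons c l ih =>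
    have : ∀ d, der d (const x * F) = const x * der d F := fun d => by
      refine ext' fun l => ?_; simp [const_mul_apply]
    simp only [compAux, this, ih, mul_add]

theorem comp_add (F G : WordSeries B A) (f : WordSeries B B) :
    comp (F + G) f = comp F f + comp G f := by
  refine ext' fun l => ?_
  cases l with
  | nil => rfl
  | cons c l => exact compAux_add ..

theorem comp_zero (f : WordSeries B B) : comp (0 : WordSeries B A) f = 0 := by
  refine ext' fun l => ?_
  cases l with
  | nil => rfl
  | cons c l => exact compAux_zero ..

theorem comp_const (x : A) (f : WordSeries B B) : comp (const x : WordSeries B A) f = const x := by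
  refine ext' fun l => ?_
  cases l with
  | nil => rfl
  | cons c l =>
    rw [comp_cons, const_cons]
    have : ∀ u l, compAux f l (const x) u = 0 := fun u l => by
      induction l generalizing u with
      | nil => rfl
      | cons c l ih => rw [compAux, ih, der_const, compAux_zero, add_zero]
    exact this _ _

theorem comp_one (f : WordSeries B B) : comp (1 : WordSeries B A) f = 1 := comp_const 1 f

/-- When the pieces of a cut are shared out between `F` and `G`, either `F` receives none of them,
or the pending piece beginning with `u` goes to `F`. In the second case the point where the pieces
pass from `F` to `G` splits `l` by concatenation. -/
theorem compAux_mul (f : WordSeries B B) (F G : WordSeries B A) (u l : List B) :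
    compAux f l (F * G) u = F [] * compAux f l G u +
      (⟨fun l => compAux f l F u⟩ * comp G f : WordSeries B A) l := by
  induction l generalizing F G u with
  | nil => simp [compAux, mul_cons]
  | cons c l ih =>
    have hder : der c (⟨fun l => compAux f l F u⟩ : WordSeries B A) =
        (⟨fun l => compAux f l F (u ++ [c])⟩ : WordSeries B A) +
          (⟨fun l => compAux f l (der (f u) F) [c]⟩ : WordSeries B A) := rfl
    rw [compAux, ih, der_mul, compAux_add, compAux_const_mul, ih, mul_cons, hder, add_mul,
      comp_cons, compAux]
    simp only [der_apply, add_apply, compAux, mul_add]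
    abel

theorem comp_mul (F G : WordSeries B A) (f : WordSeries B B) :
    comp (F * G) f = comp F f * comp G f := by
  refine ext' fun l => ?_
  cases l with
  | nil => rfl
  | cons c l =>
    rw [comp_cons, compAux_mul, mul_cons]
    rfl

theorem comp_sub (F G : WordSeries B A) (f : WordSeries B B) :
    comp (F - G) f = comp F f - comp G f := by
  rw [eq_sub_iff_add_eq, ← comp_add, sub_add_cancel]

theorem comp_letter (ι : B → A) {f : WordSeries B B} (hf : ι (f []) = 0) :
    comp (letter ι) f = ⟨fun l => ι (f l)⟩ := by
  have h : ∀ l u, compAux f l (letter ι) u = ι (f (u ++ l)) := fun l => by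
    induction l with
    | nil => intro u; simp [compAux]
    | cons c l ih =>
      intro u
      have h0 : compAux f l (const (ι (f u))) [c] = 0 := by
        rw [← comp_cons, comp_const, const_cons]
      rw [compAux, ih, der_letter, h0]
      simp
  refine ext' fun l => ?_
  cases l with
  | nil => exact hf.symm
  | cons c l => rw [comp_cons, h]; simp

/-- Membership of the values of a composition. -/
theorem comp_mem {T : Type*} [SetLike T A] [AddMemClass T A] (t : T) (F : WordSeries B A)
    (f : WordSeries B B) (h : ∀ l, F l ∈ t) (l : List B) : comp F f l ∈ t := by
  have key : ∀ (l : List B) (F : WordSeries B A) (u : List B), (∀ l, F l ∈ t) →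
      compAux f l F u ∈ t := fun l => by
    induction l with
    | nil => intro F u h; exact h _
    | cons c l ih => intro F u h; exact add_mem (ih _ _ h) (ih _ _ fun l => h _)
  cases l with
  | nil => exact h _
  | cons c l => exact key _ _ _ h

theorem compAux_congr {F F' : WordSeries B A} {f f' : WordSeries B B} {n : ℕ} (l u : List B)
    (hl : u.length + l.length ≤ n) (hu : u ≠ [])
    (hF : ∀ l, l.length ≤ n → F l = F' l) (hf : ∀ l, l.length ≤ n → f l = f' l) :
    compAux f l F u = compAux f' l F' u := by
  induction l generalizing F F' u n with
  | nil =>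
    have := List.length_pos_iff.2 hu
    rw [compAux, compAux, hf u (by simpa using hl), hF [_] (by simp at hl ⊢; omega)]
  | cons c l ih =>
    have := List.length_pos_iff.2 hu
    simp only [List.length_cons] at hl
    rw [compAux, compAux, ih (n := n) _ (by simp; omega) (by simp) hF hf,
      ih (n := n - 1) (F := der (f u) F) (F' := der (f' u) F') _ (by simp; omega) (by simp)
      (fun l h => ?_) (fun l h => hf l (by omega))]
    rw [der_apply, der_apply, hf u (by omega), hF _ (by simp; omega)]

theorem comp_congr {F F' : WordSeries B A} {f f' : WordSeries B B} {l : List B}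
    (hF : ∀ l' : List B, l'.length ≤ l.length → F l' = F' l')
    (hf : ∀ l' : List B, l'.length ≤ l.length → f l' = f' l') :
    comp F f l = comp F' f' l := by
  cases l with
  | nil => exact hF _ le_rfl
  | cons c l => exact compAux_congr l [c] (by simp; omega) (by simp) hF hf

/-- The word `d ++ l` has at most `m` letters. A cut with a piece of two or more letters has fewer
than `m` pieces and meets a zero of `G`; only the cut into single letters can survive, and `f` fixes
single letters. -/
theorem compAux_of_eq_zero {f : WordSeries B B} (hf1 : ∀ c, f [c] = c) {l d : List B} {m : ℕ}
    {G : WordSeries B A} (hG : ∀ l : List B, l.length < m → G l = 0) (hd : d ≠ [])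
    (hm : d.length + l.length ≤ m) :
    compAux f l G d = if d.length = 1 then G (d ++ l) else 0 := by
  induction l generalizing d m G with
  | nil =>
    have := List.length_pos_iff.2 hd
    rw [compAux]
    split_ifs with h1
    · obtain ⟨x, rfl⟩ := List.length_eq_one_iff.1 h1
      simp [hf1]
    · exact hG _ (by simp at hm ⊢; omega)
  | cons c l ih =>
    have := List.length_pos_iff.2 hd
    simp only [List.length_cons] at hm
    rw [compAux, ih hG (by simp) (by simp; omega),
      ih (m := m - 1) (G := der (f d) G) (d := [c])
        (fun l hl => hG _ (by simp; omega)) (by simp) (by simp; omega), if_neg (by simp; omega),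
      if_pos (by simp), zero_add]
    split_ifs with h1
    · obtain ⟨x, rfl⟩ := List.length_eq_one_iff.1 h1
      simp [hf1]
    · exact hG _ (by simp; omega)

/-- Composition with a series of the form `I + ⋯` is injective. -/
theorem eq_zero_of_comp_eq_zero {F : WordSeries B A} {f : WordSeries B B}
    (hf1 : ∀ c, f [c] = c) (h : comp F f = 0) : F = 0 := by
  have key : ∀ n, ∀ l : List B, l.length < n → F l = 0 := by
    intro n
    induction n with
    | zero => intro l hl; simp at hl
    | succ n ih =>
      intro l hl
      have h' : comp F f l = 0 := by rw [h, zero_apply]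
      cases l with
      | nil => exact h'
      | cons c l =>
        rw [comp_cons, compAux_of_eq_zero hf1 ih (by simp) (by simp at hl ⊢; omega)] at h'
        simpa using h'
  exact ext' fun l => key _ l (Nat.lt_succ_self _)

end Comp

/-! ### Multiadditive series -/

/-- Additivity in each argument. -/
def IsAdd [Add B] [Add A] (F : WordSeries B A) : Prop :=
  ∀ l₁ u v l₂, F (l₁ ++ (u + v) :: l₂) = F (l₁ ++ u :: l₂) + F (l₁ ++ v :: l₂)

section Add

variable [Ring B] [Ring A]

theorem IsAdd.der {F : WordSeries B A} (hF : IsAdd F) (c : B) : IsAdd (F.der c) :=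
  fun l₁ u v l₂ => hF (c :: l₁) u v l₂

theorem IsAdd.der_add {F : WordSeries B A} (hF : IsAdd F) (c d : B) :
    F.der (c + d) = F.der c + F.der d := by
  refine ext' fun l => ?_; exact hF [] c d l

theorem IsAdd.mul {F G : WordSeries B A} (hF : IsAdd F) (hG : IsAdd G) : IsAdd (F * G) := by
  intro l₁ u v l₂
  induction l₁ generalizing F with
  | nil =>
    have := hG [] u v l₂
    simp only [List.nil_append] at this ⊢
    rw [mul_cons, hF.der_add, add_mul, this, mul_cons, mul_cons, mul_add]
    simp only [add_apply]
    abel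
  | cons c l₁ ih =>
    have := hG (c :: l₁) u v l₂
    simp only [List.cons_append] at this ⊢
    rw [mul_cons, this, ih (hF.der c), mul_cons, mul_cons, mul_add]
    abel

theorem IsAdd.sub {F G : WordSeries B A} (hF : IsAdd F) (hG : IsAdd G) : IsAdd (F - G) := by
  intro l₁ u v l₂
  simp only [sub_apply]
  rw [hF, hG]
  abel

theorem IsAdd.compAux_left {F : WordSeries B A} {f : WordSeries B B} (hF : IsAdd F)
    (hf : IsAdd f) (l u₁ u₂ : List B) (x y : B) :
    compAux f l F (u₁ ++ (x + y) :: u₂) =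
      compAux f l F (u₁ ++ x :: u₂) + compAux f l F (u₁ ++ y :: u₂) := by
  induction l generalizing u₂ with
  | nil => rw [compAux, hf]; exact hF [] _ _ []
  | cons c l ih =>
    simp only [compAux, List.append_assoc, List.cons_append] at ih ⊢
    rw [ih, hf, hF.der_add, compAux_add]
    abel

theorem IsAdd.comp {F : WordSeries B A} {f : WordSeries B B} (hF : IsAdd F) (hf : IsAdd f) :
    IsAdd (F.comp f) := by
  have key : ∀ (l₁ : List B) (F : WordSeries B A) (w l₂ : List B) (u v : B), IsAdd F →
      compAux f (l₁ ++ (u + v) :: l₂) F w =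
        compAux f (l₁ ++ u :: l₂) F w + compAux f (l₁ ++ v :: l₂) F w := by
    intro l₁
    induction l₁ with
    | nil =>
      intro F w l₂ u v hF
      have h1 := hF.compAux_left hf l₂ w [] u v
      have h2 := (hF.der (f w)).compAux_left hf l₂ [] [] u v
      simp only [List.nil_append, compAux] at h1 h2 ⊢
      rw [h1, h2]
      abel
    | cons c l₁ ih =>
      intro F w l₂ u v hF
      simp only [List.cons_append, compAux]
      rw [ih _ _ _ _ _ hF, ih _ _ _ _ _ (hF.der _)]
      abel
  intro l₁ u v l₂
  cases l₁ with
  | nil => exact hF.compAux_left hf l₂ [] [] u v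
  | cons c l₁ => exact key l₁ F [c] l₂ u v hF

theorem isAdd_letter : IsAdd (letter (id : B → B)) := by
  intro l₁ u v l₂
  rcases l₁ with _ | ⟨c, _ | ⟨d, l₁⟩⟩ <;> rcases l₂ with _ | ⟨e, l₂⟩ <;> simp

end Add

end WordSeries

end FreeProd

namespace FreeProd

namespace WordSeries

/-! ### Applying maps to the coefficients of a series -/

section Map

variable {B A A' : Type*}

/-- Application of a map to the values of a series. -/
def map (g : A → A') (F : WordSeries B A) : WordSeries B A' := ⟨fun l => g (F l)⟩

@[simp] theorem map_apply (g : A → A') (F : WordSeries B A) (l : List B) :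
    map g F l = g (F l) := rfl

variable [Ring A] [Ring A']

/-- Compatibility is asked only for the products that occur, so that this applies to `ι` and also to
`φ` when one factor has values in `B`. -/
theorem map_mul_eq {g : A → A'} (hg : ∀ x y, g (x + y) = g x + g y)
    {F G : WordSeries B A} {F' G' : WordSeries B A'}
    (h : ∀ l₁ l₂, g (F l₁ * G l₂) = F' l₁ * G' l₂) : map g (F * G) = F' * G' := by
  refine ext' fun l => ?_
  rw [map_apply]
  induction l generalizing F F' with
  | nil => exact h _ _
  | cons c l ih =>
    rw [mul_cons, mul_cons, hg, h]
    congr 1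
    exact ih (F := der c F) (F' := der c F') fun l₁ l₂ => h _ _

theorem map_comp {g : A → A'} (hg : ∀ x y, g (x + y) = g x + g y) (F : WordSeries B A)
    (f : WordSeries B B) : map g (comp F f) = comp (map g F) f := by
  have h : ∀ l F u, g (compAux f l F u) = compAux f l (map g F) u := fun l => by
    induction l with
    | nil => intro F u; rfl
    | cons c l ih => intro F u; rw [compAux, hg, ih, ih]; rfl
  refine ext' fun l => ?_
  cases l with
  | nil => rfl
  | cons c l => exact h l F [c]

end Map

end WordSeries

open WordSeries

/-! ### The identity series -/

section Ident

variable {B : Type*} [Ring B]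

/-- The identity series with values in `B`. -/
def ident : WordSeries B B := letter id

/-- Putting the last letter equal to 1 recovers the coefficients of `F`. -/
theorem mul_ident_cancel {F : WordSeries B B} (h : F * ident = 0) : F = 0 := by
  refine ext' fun l => ?_
  have := mul_letter_append (id : B → B) F l 1
  change (F * ident : WordSeries B B) _ = _ at this
  rw [h] at this
  simpa using this.symm

theorem comp_ident {f : WordSeries B B} (hf : f [] = 0) : comp ident f = f :=
  comp_letter id hf

end Ident

/-! ### Moment series, resolvents and the characterization of the cumulant series -/

section Space

variable {A B : Type*} [Ring A] [Algebra ℂ A] [Ring B] [Algebra ℂ B] (P : OVSpace A B)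

theorem OVSpace.φ_left (b : B) (x : A) : P.φ (P.ι b * x) = b * P.φ x := by
  simpa using P.φ_bimodule b 1 x

theorem OVSpace.φ_right (b : B) (x : A) : P.φ (x * P.ι b) = P.φ x * b := by
  simpa using P.φ_bimodule 1 b x

/-- Series with values in `B` as series with values in `A`. -/
def OVSpace.incl : WordSeries B B →+* WordSeries B A where
  toFun := map P.ι
  map_one' := ext' fun l => by cases l <;> simp
  map_mul' F G := map_mul_eq (by simp) (by simp)
  map_zero' := ext' fun l => by simp
  map_add' F G := ext' fun l => by simp

@[simp] theorem OVSpace.incl_apply (F : WordSeries B B) (l : List B) :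
    P.incl F l = P.ι (F l) := rfl

/-- The conditional expectation of series. -/
def OVSpace.expect : WordSeries B A →+ WordSeries B B where
  toFun := map P.φ
  map_zero' := ext' fun l => by simp
  map_add' F G := ext' fun _ => by simp

@[simp] theorem OVSpace.expect_apply (F : WordSeries B A) (l : List B) :
    P.expect F l = P.φ (F l) := rfl

theorem OVSpace.expect_incl_mul (F : WordSeries B B) (G : WordSeries B A) :
    P.expect (P.incl F * G) = F * P.expect G :=
  map_mul_eq (by simp) (fun _ _ => P.φ_left _ _)

theorem OVSpace.expect_mul_incl (F : WordSeries B B) (G : WordSeries B A) :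
    P.expect (G * P.incl F) = P.expect G * F :=
  map_mul_eq (by simp) (fun _ _ => P.φ_right _ _)

theorem OVSpace.expect_incl (F : WordSeries B B) : P.expect (P.incl F) = F :=
  ext' fun _ => P.φ_ι _

theorem OVSpace.expect_one : P.expect 1 = 1 := by
  rw [← P.incl.map_one, P.expect_incl]

theorem OVSpace.expect_comp (F : WordSeries B A) (f : WordSeries B B) :
    P.expect (comp F f) = comp (P.expect F) f :=
  map_comp (by simp) F f

theorem OVSpace.incl_comp (F f : WordSeries B B) :
    P.incl (comp F f) = comp (P.incl F) f :=
  map_comp (by simp) F f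

/-- The series `(1 - x I)⁻¹` with values `x c₁ x c₂ ⋯ x c_n`. -/
def OVSpace.word (x : A) : WordSeries B A := geom (const x * P.incl ident)

/-- The moment series with values `φ(x c₁ x c₂ ⋯ x c_n)`. -/
def OVSpace.moment (x : A) : WordSeries B B := P.expect (P.word x)

/-- The resolvent `(1 - (x - K) I)⁻¹`. -/
def OVSpace.resolvent (K : WordSeries B B) (x : A) : WordSeries B A :=
  geom ((const x - P.incl K) * P.incl ident)

variable {P} {x : A} {K : WordSeries B B}

theorem resolvent_mul : P.resolvent K x * (1 - (const x - P.incl K) * P.incl ident) = 1 :=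
  geom_mul_one_sub (by simp [ident])

theorem mul_resolvent : (1 - (const x - P.incl K) * P.incl ident) * P.resolvent K x = 1 :=
  one_sub_mul_geom (by simp [ident])

/-- Composition with f = IΦ turns the resolvent into (1 - kI) times the word series, where k = K∘f.
The expectation of this is (1 - kI)Φ, which is 1 because the hypothesis makes Φ and 1 - kI inverse
to each other. Since f = I + ⋯, composition with f is injective and the statement descends. -/
theorem expect_resolvent (h : P.moment x =
    1 + P.moment x * comp K (ident * P.moment x) * ident) :
    P.expect (P.resolvent K x) = 1 := by
  set Φ := P.moment x with hΦ
  set f := ident * Φ with hf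
  set k := comp K f with hk
  have hf0 : f [] = 0 := by simp [hf, ident]
  have h1 : Φ * (1 - k * ident) = 1 := by
    rw [mul_sub, mul_one, ← mul_assoc, sub_eq_iff_eq_add]; exact h
  have hki : (k * ident : WordSeries B B) [] = 0 := by simp [ident]
  have h2 : (1 - k * ident) * Φ = 1 := by
    have := left_inv_eq_right_inv h1 (one_sub_mul_geom hki)
    rw [this]; exact one_sub_mul_geom hki
  have hc := congrArg (fun F => comp F f) (resolvent_mul (P := P) (x := x) (K := K))
  simp only [comp_mul, comp_sub, comp_one, comp_const, ← P.incl_comp, comp_ident hf0] at hc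
  have hw : (1 - const x * P.incl ident) * P.word x = 1 := one_sub_mul_geom (by simp [ident])
  -- The relation Φ = 1 + kf absorbs the cumulant term.
  have h3 : 1 - (const x - P.incl k) * P.incl f = (1 - const x * P.incl ident) * P.incl Φ := by
    have : Φ = 1 + k * f := by
      rw [sub_mul, one_mul, sub_eq_iff_eq_add, mul_assoc, ← hf] at h2; exact h2
    have h4 := congrArg P.incl this
    have hf' : P.incl f = P.incl ident * P.incl Φ := by rw [hf, map_mul]
    rw [map_add, map_one, map_mul] at h4
    rw [sub_mul, sub_mul, one_mul, mul_assoc (const x), ← hf', h4]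
    abel
  have h5 : comp (P.resolvent K x) f = P.incl (1 - k * ident) * P.word x := by
    refine left_inv_eq_right_inv hc ?_
    rw [h3, ← mul_assoc, mul_assoc _ (P.incl Φ), ← map_mul, h1, map_one, mul_one, hw]
  have h6 : comp (P.expect (P.resolvent K x) - 1) f = 0 := by
    rw [comp_sub, ← P.expect_comp, h5, P.expect_incl_mul, comp_one, sub_eq_zero]
    exact h2
  refine sub_eq_zero.1 (eq_zero_of_comp_eq_zero (fun c => ?_) h6)
  have : Φ [] = 1 := by rw [h]; simp [ident]
  rw [hf, ident, letter_mul_cons, this]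
  simp

/-- For the resolvent R, the series R(x - K)I equals R - 1, which has expectation zero; the factor I
can be cancelled. -/
theorem expect_resolvent_mul (h : P.expect (P.resolvent K x) = 1) :
    P.expect (P.resolvent K x * (const x - P.incl K)) = 0 := by
  apply mul_ident_cancel
  rw [← P.expect_mul_incl]
  have h1 := resolvent_mul (P := P) (x := x) (K := K)
  rw [mul_sub, mul_one, sub_eq_iff_eq_add, ← sub_eq_iff_eq_add', ← mul_assoc] at h1
  rw [← h1, map_sub, h, P.expect_one, sub_self]

/-- The expectation of the resolvent determines the cumulant series. -/
theorem eq_of_expect_resolvent {K' : WordSeries B B} (h : P.expect (P.resolvent K x) = 1)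
    (h' : P.expect (P.resolvent K' x) = 1) : K = K' := by
  have e1 : ∀ {K : WordSeries B B}, P.expect (P.resolvent K x) = 1 →
      P.expect (P.resolvent K x * const x) = K := by
    intro K h
    have := expect_resolvent_mul h
    rw [mul_sub, map_sub, P.expect_mul_incl, h, one_mul, sub_eq_zero] at this
    exact this
  -- The resolvent identity.
  have e2 : P.resolvent K x - P.resolvent K' x =
      P.resolvent K x * (P.incl (K' - K) * (P.incl ident * P.resolvent K' x)) := by
    have a1 := resolvent_mul (P := P) (x := x) (K := K)
    have a2 := mul_resolvent (P := P) (x := x) (K := K')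
    calc _ = P.resolvent K x * ((1 - (const x - P.incl K') * P.incl ident) * P.resolvent K' x) -
          P.resolvent K x * (1 - (const x - P.incl K) * P.incl ident) * P.resolvent K' x := by
            rw [a1, a2, mul_one, one_mul]
      _ = _ := by rw [map_sub]; noncomm_ring
  -- The resolvent identity is multiplied by x on the right, because E(Rx) = K by `e1`. The factor
  -- `ident` consumes a letter, so at a given word the right side involves `K' - K` only at shorter
  -- words, and induction on the length applies.
  have e3 : K - K' = P.expect (P.resolvent K x *
      (P.incl (K' - K) * (P.incl ident * (P.resolvent K' x * const x)))) := by
    conv_lhs => rw [← e1 h, ← e1 h', ← map_sub, ← sub_mul, e2]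
    simp only [mul_assoc]
  have key : ∀ n, ∀ l : List B, l.length < n → K l = K' l := by
    intro n
    induction n with
    | zero => intro l hl; simp at hl
    | succ n ih =>
      intro l hl
      rw [← sub_eq_zero, ← WordSeries.sub_apply, e3, P.expect_apply, mul_eq_zero_of, map_zero]
      intro l₁ l₂ h12
      rw [mul_eq_zero_of, mul_zero]
      intro l₃ l₄ h34
      rcases l₄ with _ | ⟨c, l₄⟩
      · simp [ident]
      · have := congrArg List.length h12
        have h3 := congrArg List.length h34
        simp only [List.length_append, List.length_cons] at this h3
        rw [P.incl_apply, WordSeries.sub_apply, ih l₃ (by omega), sub_self, map_zero, zero_mul]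
  exact ext' fun l => key _ l (Nat.lt_succ_self _)

end Space

/-! ### Free products -/

section Free

variable {A B : Type*} [Ring A] [Algebra ℂ A] [Ring B] [Algebra ℂ B] (P : OVSpace A B)

/-- The span of the products of alternating centred words starting with the colour `ε`. -/
def OVSpace.alternating (a b : A) (ε : Bool) : AddSubgroup A :=
  AddSubgroup.closure {y | ∃ x l, y = (((ε, x) :: l : List (Bool × A)).map Prod.snd).prod ∧
    ((ε, x) :: l).IsChain (fun p q => p.1 ≠ q.1) ∧
    ∀ p ∈ (ε, x) :: l, p.2 ∈ P.generated (if p.1 then a else b) ∧ P.φ p.2 = 0}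

/-- The centred elements of the algebras generated by `B` and one of the variables. -/
def OVSpace.centred (x : A) : AddSubgroup A where
  carrier := {y | y ∈ P.generated x ∧ P.φ y = 0}
  add_mem' h h' := ⟨add_mem h.1 h'.1, by rw [map_add, h.2, h'.2, add_zero]⟩
  zero_mem' := ⟨zero_mem _, map_zero _⟩
  neg_mem' h := ⟨neg_mem h.1, by rw [map_neg, h.2, neg_zero]⟩

variable {P} {a b : A}

theorem φ_eq_zero_of_mem_alternating (hfree : P.IsFree a b) {ε : Bool} {y : A}
    (hy : y ∈ P.alternating a b ε) : P.φ y = 0 := by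
  induction hy using AddSubgroup.closure_induction with
  | mem y hy =>
    obtain ⟨x, l, rfl, hc, hm⟩ := hy
    exact hfree _ (by simp) hc hm
  | zero => exact map_zero _
  | add y z _ _ hy hz => rw [map_add, hy, hz, add_zero]
  | neg y _ hy => rw [map_neg, hy, neg_zero]

theorem mem_alternating_of_centred {ε : Bool} {x : A}
    (hx : x ∈ P.centred (if ε then a else b)) : x ∈ P.alternating a b ε :=
  AddSubgroup.subset_closure ⟨x, [], by simp, by simp, by
    simpa using ⟨hx.1, hx.2⟩⟩

theorem mul_mem_alternating {ε : Bool} {x y : A} (hx : x ∈ P.centred (if ε then a else b))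
    (hy : y ∈ P.alternating a b (!ε)) : x * y ∈ P.alternating a b ε := by
  induction hy using AddSubgroup.closure_induction with
  | mem y hy =>
    obtain ⟨z, l, rfl, hc, hm⟩ := hy
    refine AddSubgroup.subset_closure ⟨x, (!ε, z) :: l, by simp, ?_, ?_⟩
    · exact List.isChain_cons_cons.2 ⟨by simp, hc⟩
    · intro p hp
      rcases List.mem_cons.1 hp with rfl | hp
      · exact hx
      · exact hm p hp
  | zero => rw [mul_zero]; exact zero_mem _
  | add y z _ _ hy hz => rw [mul_add]; exact add_mem hy hz
  | neg y _ hy => rw [mul_neg]; exact neg_mem hy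

theorem incl_mem_generated (x : A) (F : WordSeries B B) (l : List B) :
    P.incl F l ∈ P.generated x :=
  Algebra.subset_adjoin (Set.mem_insert_of_mem _ ⟨_, rfl⟩)

theorem const_mem_generated (x : A) (l : List B) : const x l ∈ P.generated x := by
  cases l with
  | nil => exact Algebra.subset_adjoin (Set.mem_insert _ _)
  | cons c l => exact zero_mem _

theorem mul_mem_generated {x : A} {F G : WordSeries B A} (hF : ∀ l, F l ∈ P.generated x)
    (hG : ∀ l, G l ∈ P.generated x) (l : List B) : (F * G) l ∈ P.generated x :=
  mul_apply_mem _ _ _ _ fun _ _ _ => mul_mem (hF _) (hG _)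

theorem geom_mem_generated {x : A} {F : WordSeries B A}
    (hF : ∀ l, F l ∈ P.generated x) (l : List B) : geom F l ∈ P.generated x := by
  have key : ∀ n, ∀ l, geomAux F n l ∈ P.generated x := by
    intro n
    induction n with
    | zero =>
      intro l
      cases l with
      | nil => exact one_mem _
      | cons c l => exact zero_mem _
    | succ n ih =>
      intro l
      refine add_mem ?_ (mul_mem_generated hF ih l)
      cases l with
      | nil => exact one_mem _
      | cons c l => exact zero_mem _
  exact key _ l

theorem mul_incl_mem_centred {x : A} {F : WordSeries B A} (hF : ∀ l, F l ∈ P.centred x)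
    (G : WordSeries B B) (l : List B) : (F * P.incl G) l ∈ P.centred x := by
  refine mul_apply_mem _ _ _ _ fun l₁ l₂ _ => ⟨mul_mem (hF _).1 (incl_mem_generated _ _ _), ?_⟩
  rw [P.incl_apply, P.φ_right, (hF _).2, zero_mul]

/-- The centred series `(x - K∘f) (1 - f (x - K∘f))⁻¹`. -/
theorem exists_centred {x : A} {K : WordSeries B B} (h : P.expect (P.resolvent K x) = 1)
    {f : WordSeries B B} (hf : f [] = 0) :
    ∃ u : WordSeries B A, (∀ l, u l ∈ P.centred x) ∧
      (1 - (const x - P.incl (comp K f)) * P.incl f) * u = const x - P.incl (comp K f) ∧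
      u * (1 - P.incl f * (const x - P.incl (comp K f))) = const x - P.incl (comp K f) := by
  set y := const x - P.incl (comp K f) with hy
  set R := comp (P.resolvent K x) f with hR
  have h1 := congrArg (fun F => comp F f) (resolvent_mul (P := P) (x := x) (K := K))
  have h2 := congrArg (fun F => comp F f) (mul_resolvent (P := P) (x := x) (K := K))
  simp only [comp_mul, comp_sub, comp_one, comp_const, ← P.incl_comp, comp_ident hf] at h1 h2
  rw [← hy, ← hR] at h1 h2
  have hu : comp (P.resolvent K x * (const x - P.incl K)) f = R * y := by
    rw [comp_mul, comp_sub, comp_const, ← P.incl_comp]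
  have hgen : ∀ l, (const x - P.incl K : WordSeries B A) l ∈ P.generated x := fun l =>
    sub_mem (const_mem_generated _ _) (incl_mem_generated _ _ _)
  -- By `hu` the witness is the centred series of `expect_resolvent_mul` composed with `f`, and
  -- composition commutes with the expectation.
  refine ⟨R * y, fun l => ⟨?_, ?_⟩, ?_, ?_⟩
  · rw [← hu]
    refine comp_mem _ _ _ (mul_mem_generated (geom_mem_generated
      (mul_mem_generated hgen (incl_mem_generated _ _))) hgen) l
  · have := P.expect_comp (P.resolvent K x * (const x - P.incl K)) f
    rw [expect_resolvent_mul h, comp_zero, hu] at this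
    have := congrArg (fun F : WordSeries B B => F l) this
    simpa using this
  · rw [← mul_assoc, h2, one_mul]
  · calc R * y * (1 - P.incl f * y) = R * (1 - y * P.incl f) * y := by noncomm_ring
      _ = y := by rw [h1, one_mul]

/-- The cumulant series of a product of free random variables. -/
theorem cumulant_mul_of_free (hfree : P.IsFree a b) {Ka Kb Kab V : WordSeries B B}
    (ha : P.expect (P.resolvent Ka a) = 1) (hb : P.expect (P.resolvent Kb b) = 1)
    (hab : P.expect (P.resolvent Kab (a * b)) = 1)
    (hV : V = comp Ka (comp Kb (ident * V) * ident)) :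
    Kab = V * comp Kb (ident * V) := by
  refine eq_of_expect_resolvent hab ?_
  set k := comp Kb (ident * V) with hk
  obtain ⟨u, hu, hu1, -⟩ := exists_centred ha (f := k * ident) (by simp [ident])
  obtain ⟨v, hv, hv1, hv2⟩ := exists_centred hb (f := ident * V) (by simp [ident])
  -- The equation for `V` enters here: the amount by which `a` has to be centred is `V` itself.
  rw [← hV] at hu1
  rw [← hk] at hv1 hv2
  set I := P.incl ident with hI
  set V' := P.incl V with hV'
  set k' := P.incl k with hk'
  simp only [map_mul, ← hI, ← hV', ← hk'] at hu1 hv1 hv2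
  set y := const a - V' with hy
  set z := const b - k' with hz
  set Q := u * (1 + k' * I * V') * (v * I) with hQ
  have hQ0 : Q [] = 0 := by simp [hQ, hI, ident]
  have hc : (const (a * b) : WordSeries B A) = const a * const b := by
    refine ext' fun l => ?_
    rw [const_mul_apply]
    cases l <;> simp
  have hac : const a = y + V' := by simp [hy]
  have hbc : const b = z + k' := by simp [hz]
  -- From ab = (y + V)(z + k) one gets ab - Vk = yz + yk + Vz. The outer factors multiply to 1 - ykI
  -- - VzI + ykIVzI, so the middle factor has to contribute -y(1 + kIV)zI. It does, since (1 - ykI)u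
  -- = y and v(1 - IVz) = z.
  have fact : 1 - (const (a * b) - P.incl (V * k)) * I =
      (1 - y * (k' * I)) * (1 - Q) * (1 - V' * z * I) := by
    have e1 : (1 - y * (k' * I)) * Q = y * (1 + k' * I * V') * (v * I) := by
      rw [hQ, mul_assoc u, ← mul_assoc _ u, hu1, mul_assoc y]
    have e2 : v * I * (1 - V' * z * I) = z * I := by
      calc v * I * (1 - V' * z * I) = v * (1 - I * V' * z) * I := by noncomm_ring
        _ = _ := by rw [hv2]
    have e3 : (1 - y * (k' * I)) * (1 - Q) * (1 - V' * z * I) =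
        (1 - y * (k' * I)) * (1 - V' * z * I) - y * (1 + k' * I * V') * (z * I) := by
      rw [mul_sub _ 1 Q, mul_one, e1, sub_mul, mul_assoc (y * (1 + k' * I * V')), e2]
    rw [e3, hc, hac, hbc, map_mul, ← hV', ← hk']
    noncomm_ring
  set Z := geom Q with hZ
  set Y := Z * (1 + u * (k' * I)) with hY
  have i1 : (1 - V' * z * I) * (1 + V' * v * I) = 1 := by
    have : v - z * (I * V') * v = z := by rwa [sub_mul, one_mul] at hv1
    calc (1 - V' * z * I) * (1 + V' * v * I) =
          1 + V' * ((v - z * (I * V') * v) - z) * I := by noncomm_ring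
      _ = 1 := by rw [this]; simp
  have i2 : (1 - y * (k' * I)) * (1 + u * (k' * I)) = 1 := by
    calc (1 - y * (k' * I)) * (1 + u * (k' * I)) =
          1 - y * (k' * I) + (1 - y * (k' * I)) * u * (k' * I) := by noncomm_ring
      _ = 1 := by rw [hu1]; simp
  have i2' : (1 + u * (k' * I)) * (1 - y * (k' * I)) = 1 := by
    have h0 : (y * (k' * I) : WordSeries B A) [] = 0 := by simp [hI, ident]
    have := left_inv_eq_right_inv (geom_mul_one_sub h0) i2
    rw [← this]; exact geom_mul_one_sub h0
  have inv : (1 - (const (a * b) - P.incl (V * k)) * I) * ((1 + V' * v * I) * Y) =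
      (1 : WordSeries B A) := by
    rw [fact]
    calc _ = (1 - y * (k' * I)) * ((1 - Q) * (((1 - V' * z * I) * (1 + V' * v * I)) * Z) *
          (1 + u * (k' * I))) := by rw [hY]; simp only [mul_assoc]
      _ = 1 := by rw [i1, one_mul, hZ, one_sub_mul_geom hQ0, one_mul, i2]
  have hres : P.resolvent (V * k) (a * b) = (1 + V' * v * I) * Y :=
    left_inv_eq_right_inv resolvent_mul inv
  -- This recursion exhibits `Y - 1` as a sum of alternating products starting with a centred
  -- element on the side of `a`. The `B`-valued coefficients are absorbed into the centred factors
  -- on their left, and `v * I` has no constant term, so the remaining word is shorter.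
  have hYeq : Y - 1 = u * (k' * I) + u * (1 + k' * I * V') * (v * I) +
      u * (1 + k' * I * V') * (v * I * (Y - 1)) := by
    have h1 : Y = (1 + Q * Z) * (1 + u * (k' * I)) := by rw [← geom_eq hQ0]
    rw [add_mul, one_mul, mul_assoc Q, ← hY] at h1
    nth_rw 1 [h1]
    rw [hQ]
    noncomm_ring
  have hP : ∀ l, (u * (1 + k' * I * V')) l ∈ P.centred a := by
    have : 1 + k' * I * V' = P.incl (1 + k * ident * V) := by simp [hk', hI, hV']
    rw [this]
    exact mul_incl_mem_centred hu _
  have hvI : ∀ l, (v * I) l ∈ P.centred b := mul_incl_mem_centred hv _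
  have hvI0 : (v * I) [] = 0 := by simp [hI, ident]
  have hukI : ∀ l, (u * (k' * I)) l ∈ P.centred a := by
    rw [hk', hI, ← map_mul]; exact mul_incl_mem_centred hu _
  have hYmem : ∀ n, ∀ l : List B, l.length < n → (Y - 1) l ∈ P.alternating a b true := by
    intro n
    induction n with
    | zero => intro l hl; simp at hl
    | succ n ih =>
      intro l hl
      rw [hYeq]
      refine add_mem (add_mem (mem_alternating_of_centred (hukI l)) ?_) ?_
      · exact mul_apply_mem _ _ _ _ fun l₁ l₂ _ => mul_mem_alternating (ε := true) (hP _)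
          (mem_alternating_of_centred (ε := false) (hvI _))
      · refine mul_apply_mem _ _ _ _ fun l₁ l₂ h12 => mul_mem_alternating (ε := true) (hP _) ?_
        refine mul_apply_mem _ _ _ _ fun l₃ l₄ h34 => ?_
        have h1 := congrArg List.length h12
        have h3 := congrArg List.length h34
        simp only [List.length_append] at h1 h3
        rcases l₃ with _ | ⟨c, l₃⟩
        · rw [hvI0, zero_mul]; exact zero_mem _
        · simp only [List.length_cons] at h3
          exact mul_mem_alternating (ε := false) (hvI _) (ih _ (by omega))
  have hYmem' : ∀ l, (Y - 1) l ∈ P.alternating a b true := fun l => hYmem _ l (Nat.lt_succ_self _)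
  have hEY : P.expect (Y - 1) = 0 := ext' fun l =>
    φ_eq_zero_of_mem_alternating hfree (hYmem' l)
  have hEv : P.expect (v * I) = 0 := ext' fun l => (hvI l).2
  have hEvY : P.expect (v * I * (Y - 1)) = 0 := ext' fun l =>
    φ_eq_zero_of_mem_alternating hfree (ε := false) <| mul_apply_mem _ _ _ _ fun l₁ l₂ _ =>
      mul_mem_alternating (ε := false) (hvI _) (hYmem' _)
  -- Apart from 1, every summand is alternating and centred up to a left factor with values in `B`,
  -- hence has expectation zero.
  have : (1 + V' * v * I) * Y = 1 + (Y - 1) + V' * (v * I) + V' * (v * I * (Y - 1)) := by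
    noncomm_ring
  rw [hres, this, map_add, map_add, map_add, P.expect_incl_mul, P.expect_incl_mul, hEY, hEv, hEvY,
    P.expect_one]
  simp

end Free

end FreeProd

namespace FreeProd

/-! ### Gaps of a block -/

section Gaps

variable {k : ℕ} {i j : ℕ} {legs : Fin (k + 1) → ℕ}

/-- The left ends of the gaps of a block in `[i, j)`. -/
def gapL (i : ℕ) {k : ℕ} (legs : Fin (k + 1) → ℕ) : Fin (k + 2) → ℕ :=
  Fin.cons i fun s => legs s + 1

/-- The right ends of the gaps of a block in `[i, j)`. -/
def gapR {k : ℕ} (legs : Fin (k + 1) → ℕ) (j : ℕ) : Fin (k + 2) → ℕ := Fin.snoc legs j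

@[simp] theorem gapL_zero : gapL i legs 0 = i := rfl
@[simp] theorem gapL_succ (s : Fin (k + 1)) : gapL i legs s.succ = legs s + 1 := by simp [gapL]
@[simp] theorem gapR_castSucc (s : Fin (k + 1)) : gapR legs j s.castSucc = legs s := by
  simp [gapR]
@[simp] theorem gapR_last : gapR legs j (Fin.last (k + 1)) = j := by simp [gapR]
@[simp] theorem gapR_zero : gapR legs j 0 = legs 0 := gapR_castSucc 0
@[simp] theorem gapL_last : gapL i legs (Fin.last (k + 1)) = legs (Fin.last k) + 1 :=
  gapL_succ (Fin.last k)

/-- The legs `legs` are increasing, lie in `[i, j)` and end at `j - 1`. -/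
structure IsLegs (i j : ℕ) (legs : Fin (k + 1) → ℕ) : Prop where
  mono : StrictMono legs
  le : i ≤ legs 0
  last : legs (Fin.last k) + 1 = j

namespace IsLegs

theorem le_legs (h : IsLegs i j legs) (s : Fin (k + 1)) : i ≤ legs s :=
  h.le.trans (h.mono.monotone (Fin.zero_le _))

theorem legs_lt (h : IsLegs i j legs) (s : Fin (k + 1)) : legs s < j := by
  have := h.mono.monotone (Fin.le_last s)
  have := h.last
  omega

theorem lt (h : IsLegs i j legs) : i < j := (h.le_legs 0).trans_lt (h.legs_lt 0)

theorem legs_lt_gapL (h : IsLegs i j legs) {s : Fin (k + 1)} {t : Fin (k + 2)}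
    (hst : (s : ℕ) < t) : legs s < gapL i legs t := by
  induction t using Fin.cases with
  | zero => simp at hst
  | succ t =>
    rw [gapL_succ, Nat.lt_succ_iff]
    exact h.mono.monotone (Fin.le_def.2 (by simpa [Nat.lt_succ_iff] using hst))

theorem gapR_le_legs (h : IsLegs i j legs) {s : Fin (k + 1)} {t : Fin (k + 2)}
    (hst : (t : ℕ) ≤ s) : gapR legs j t ≤ legs s := by
  induction t using Fin.lastCases with
  | last => simp at hst; omega
  | cast t =>
    rw [gapR_castSucc]
    exact h.mono.monotone (Fin.le_def.2 (by simpa using hst))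

theorem le_gapL (h : IsLegs i j legs) (t : Fin (k + 2)) : i ≤ gapL i legs t := by
  induction t using Fin.cases with
  | zero => simp
  | succ t => have := h.le_legs t; simp; omega

theorem gapR_le (h : IsLegs i j legs) (t : Fin (k + 2)) : gapR legs j t ≤ j := by
  induction t using Fin.lastCases with
  | last => simp
  | cast t => have := h.legs_lt t; simp; omega

theorem gapL_le_gapR (h : IsLegs i j legs) (t : Fin (k + 2)) :
    gapL i legs t ≤ gapR legs j t := by
  induction t using Fin.lastCases with
  | last => simp [h.last]
  | cast t =>
    induction t using Fin.cases with
    | zero => simpa using h.le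
    | succ t =>
      rw [← Fin.succ_castSucc, gapL_succ, Fin.succ_castSucc, gapR_castSucc]
      exact h.mono (Fin.castSucc_lt_succ)

theorem gap_lt (h : IsLegs i j legs) (t : Fin (k + 2)) :
    gapR legs j t - gapL i legs t < j - i := by
  have h1 := h.le_gapL t
  have h2 := h.gapR_le t
  have h3 := h.gapL_le_gapR t
  have h4 := h.lt
  rcases Nat.lt_or_ge 0 (t : ℕ) with ht | ht
  · have := h.legs_lt_gapL (s := 0) (t := t) (by simpa using ht)
    have := h.le
    omega
  · have := h.gapR_le_legs (s := 0) (t := t) (by simpa using ht)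
    have := h.legs_lt 0
    omega

theorem notMem_gap (h : IsLegs i j legs) (s : Fin (k + 1)) (t : Fin (k + 2)) :
    ¬ (gapL i legs t ≤ legs s ∧ legs s < gapR legs j t) := by
  rintro ⟨h1, h2⟩
  rcases Nat.lt_or_ge s t with hst | hst
  · exact absurd (h.legs_lt_gapL hst) (by omega)
  · exact absurd (h.gapR_le_legs hst) (by omega)

theorem exists_between (h : IsLegs i j legs) {t t' : Fin (k + 2)} (htt : t < t') :
    ∃ s, gapR legs j t ≤ legs s ∧ legs s < gapL i legs t' := by
  have h1 : (t : ℕ) < t' := htt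
  refine ⟨⟨t, by omega⟩, h.gapR_le_legs le_rfl, h.legs_lt_gapL htt⟩

theorem gap_unique (h : IsLegs i j legs) {t t' : Fin (k + 2)} {v : ℕ}
    (h1 : gapL i legs t ≤ v) (h2 : v < gapR legs j t) (h3 : gapL i legs t' ≤ v)
    (h4 : v < gapR legs j t') : t = t' := by
  rcases lt_trichotomy t t' with hl | hl | hl
  · obtain ⟨s, h5, h6⟩ := h.exists_between hl
    omega
  · exact hl
  · obtain ⟨s, h5, h6⟩ := h.exists_between hl
    omega

theorem exists_gap (h : IsLegs i j legs) {v : ℕ} (hi : i ≤ v) (hj : v < j)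
    (hv : ∀ s, legs s ≠ v) : ∃ t, gapL i legs t ≤ v ∧ v < gapR legs j t := by
  -- The gap sought ends at the first leg beyond `v`; there is one because the last leg is `j - 1`
  -- and differs from `v`.
  have hex : ∃ n, ∃ hn : n < k + 1, v < legs ⟨n, hn⟩ := by
    refine ⟨k, by omega, ?_⟩
    have h1 := h.last
    have h2 := hv (Fin.last k)
    change v < legs (Fin.last k)
    omega
  classical
  obtain ⟨hn, hlt⟩ := Nat.find_spec hex
  set n := Nat.find hex with hn'
  refine ⟨Fin.castSucc ⟨n, hn⟩, ?_, by rw [gapR_castSucc]; exact hlt⟩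
  rcases Nat.eq_zero_or_pos n with h0 | h0
  · have : (Fin.castSucc ⟨n, hn⟩ : Fin (k + 2)) = 0 := Fin.ext h0
    rw [this]
    exact hi
  · have h1 := Nat.find_min hex (m := n - 1) (by omega)
    have : (Fin.castSucc ⟨n, hn⟩ : Fin (k + 2)) = Fin.succ ⟨n - 1, by omega⟩ :=
      Fin.ext (by simp; omega)
    rw [this, gapL_succ]
    have h2 := hv ⟨n - 1, by omega⟩
    have h3 : ¬ v < legs ⟨n - 1, by omega⟩ := fun h4 => h1 ⟨_, h4⟩
    omega

end IsLegs

end Gaps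

/-! ### Sets of trees -/

open Classical in
/-- The legs of the possible root blocks in `[i, j)`. -/
def legSet (Q : ℕ → (k : ℕ) → (Fin (k + 1) → ℕ) → Prop) (i j : ℕ) :
    Finset (Σ k : ℕ, (Fin (k + 1) → ℕ)) :=
  (range (j - i)).sigma fun k =>
    (Fintype.piFinset fun _ : Fin (k + 1) => Ico i j).filter fun legs =>
      IsLegs i j legs ∧ Q i k legs

theorem mem_legSet {Q : ℕ → (k : ℕ) → (Fin (k + 1) → ℕ) → Prop} {i j : ℕ}
    {p : Σ k : ℕ, (Fin (k + 1) → ℕ)} :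
    p ∈ legSet Q i j ↔ IsLegs i j p.2 ∧ Q i p.1 p.2 := by
  obtain ⟨k, legs⟩ := p
  simp only [legSet, mem_sigma, mem_range, mem_filter, Fintype.mem_piFinset, mem_Ico]
  constructor
  · exact fun h => h.2.2
  · intro h
    refine ⟨?_, fun s => ⟨h.1.le_legs s, h.1.legs_lt s⟩, h⟩
    -- Strictly increasing legs in `[i, j)` number at most `j - i`, so the finite range of `k` in
    -- `legSet` loses nothing.
    have : ∀ n (hn : n < k + 1), i + n ≤ legs ⟨n, hn⟩ := by
      intro n
      induction n with
      | zero => intro hn; exact h.1.le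
      | succ n ih =>
        intro hn
        have h1 := ih (by omega)
        have h2 := h.1.mono (a := ⟨n, by omega⟩) (b := ⟨n + 1, hn⟩) (by simp)
        omega
    have h1 := this k (by omega)
    have h2 := h.1.legs_lt ⟨k, by omega⟩
    omega

open Classical in
/-- The trees on `[i, j)` all of whose blocks have the property `Q`. -/
def trees (Q : ℕ → (k : ℕ) → (Fin (k + 1) → ℕ) → Prop) : ℕ → ℕ → ℕ → Finset GapTree
  | 0, _, _ => {.leaf}
  | m + 1, i, j =>
    if i < j then
      (legSet Q i j).biUnion fun p =>
        (Fintype.piFinset fun t => trees Q m (gapL i p.2 t) (gapR p.2 j t)).image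
          (GapTree.node p.1 p.2)
    else {.leaf}

variable {Q : ℕ → (k : ℕ) → (Fin (k + 1) → ℕ) → Prop}

theorem trees_of_le {m i j : ℕ} (h : j ≤ i) : trees Q m i j = {.leaf} := by
  cases m with
  | zero => rfl
  | succ m => rw [trees, if_neg (by omega)]

/-- The first argument of `trees` only bounds the recursion depth. It suffices that it is at least
the length `j - i`, which is the role of the hypotheses `hm` below. -/
theorem mem_trees {m i j : ℕ} (h : i < j) {T : GapTree} :
    T ∈ trees Q (m + 1) i j ↔ ∃ k legs child, T = .node k legs child ∧ IsLegs i j legs ∧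
      Q i k legs ∧ ∀ t, child t ∈ trees Q m (gapL i legs t) (gapR legs j t) := by
  classical
  rw [trees, if_pos h]
  simp only [mem_biUnion, mem_legSet, mem_image, Fintype.mem_piFinset]
  constructor
  · rintro ⟨⟨k, legs⟩, ⟨h1, h2⟩, child, h3, rfl⟩
    exact ⟨k, legs, child, rfl, h1, h2, h3⟩
  · rintro ⟨k, legs, child, rfl, h1, h2, h3⟩
    exact ⟨⟨k, legs⟩, ⟨h1, h2⟩, child, h3, rfl⟩

/-- Induction for members of `trees`. -/
theorem trees_induction {C : ℕ → ℕ → GapTree → Prop} (hleaf : ∀ i j, j ≤ i → C i j .leaf)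
    (hnode : ∀ i j k legs child, IsLegs i j legs → Q i k legs →
      (∃ m, j - i ≤ m + 1 ∧ ∀ t, child t ∈ trees Q m (gapL i legs t) (gapR legs j t)) →
      (∀ t, C (gapL i legs t) (gapR legs j t) (child t)) → C i j (.node k legs child))
    {m i j : ℕ} (hm : j - i ≤ m) {T : GapTree} (hT : T ∈ trees Q m i j) : C i j T := by
  induction m generalizing i j T with
  | zero =>
    obtain rfl : T = .leaf := by simpa [trees] using hT
    exact hleaf i j (by omega)
  | succ m ih =>
    rcases Nat.lt_or_ge i j with h | h
    · obtain ⟨k, legs, child, rfl, h1, h2, h3⟩ := (mem_trees h).1 hT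
      exact hnode i j k legs child h1 h2 ⟨m, hm, h3⟩ fun t =>
        ih (by have := h1.gap_lt t; omega) (h3 t)
    · rw [trees_of_le h, mem_singleton] at hT
      subst hT
      exact hleaf i j h

theorem sum_trees {M : Type*} [AddCommMonoid M] {m i j : ℕ} (h : i < j) (g : GapTree → M) :
    ∑ T ∈ trees Q (m + 1) i j, g T = ∑ p ∈ legSet Q i j,
      ∑ child ∈ Fintype.piFinset fun t => trees Q m (gapL i p.2 t) (gapR p.2 j t),
        g (.node p.1 p.2 child) := by
  classical
  rw [trees, if_pos h, sum_biUnion]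
  · refine sum_congr rfl fun p _ => sum_image fun c _ c' _ hc => ?_
    simpa using hc
  · rintro ⟨k, legs⟩ _ ⟨k', legs'⟩ _ hne
    rw [Function.onFun, disjoint_left]
    intro T hT hT'
    obtain ⟨c, -, rfl⟩ := mem_image.1 hT
    obtain ⟨c', -, hc'⟩ := mem_image.1 hT'
    obtain ⟨rfl, h1, h2⟩ := GapTree.node.inj hc'
    exact hne (Sigma.ext rfl h1.symm)

/-! ### Families of blocks -/

/-- Two elements share a block. -/
def Related (F : Finset (Finset ℕ)) (u v : ℕ) : Prop := ∃ V ∈ F, u ∈ V ∧ v ∈ V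

/-- The blocks of a family are disjoint. -/
def IsDisjoint (F : Finset (Finset ℕ)) : Prop :=
  ∀ V ∈ F, ∀ W ∈ F, ∀ v, v ∈ V → v ∈ W → V = W

theorem Related.symm {F : Finset (Finset ℕ)} {u v : ℕ} (h : Related F u v) : Related F v u :=
  let ⟨V, hV, hu, hv⟩ := h; ⟨V, hV, hv, hu⟩

theorem Related.trans {F : Finset (Finset ℕ)} (hF : IsDisjoint F) {u v w : ℕ}
    (h : Related F u v) (h' : Related F v w) : Related F u w := by
  obtain ⟨V, hV, hu, hv⟩ := h
  obtain ⟨W, hW, hv', hw⟩ := h'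
  obtain rfl := hF V hV W hW v hv hv'
  exact ⟨V, hV, hu, hw⟩

theorem IsNonCrossing.related {F : Finset (Finset ℕ)} (hF : IsNonCrossing F) {a b c d : ℕ}
    (hab : a < b) (hbc : b < c) (hcd : c < d) (h1 : Related F a c) (h2 : Related F b d) :
    Related F a b := by
  obtain ⟨V, hV, ha, hc⟩ := h1
  obtain ⟨W, hW, hb, hd⟩ := h2
  obtain rfl := hF V hV W hW a b c d hab hbc hcd ha hc hb hd
  exact ⟨V, hV, ha, hb⟩

theorem IsDisjoint.isNonCrossing {F : Finset (Finset ℕ)} (hF : IsDisjoint F)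
    (h : ∀ a b c d, a < b → b < c → c < d → Related F a c → Related F b d → Related F a b) :
    IsNonCrossing F := by
  intro V hV W hW a b c d hab hbc hcd ha hc hb hd
  obtain ⟨U, hU, ha', hb'⟩ := h a b c d hab hbc hcd ⟨V, hV, ha, hc⟩ ⟨W, hW, hb, hd⟩
  rw [hF V hV U hU a ha ha', hF W hW U hU b hb hb']

theorem mem_legsIn {F : Finset (Finset ℕ)} {i j v : ℕ} :
    v ∈ legsIn F i j ↔ i ≤ v ∧ v < j ∧ Related F v (j - 1) := by
  simp [legsIn, Related, and_assoc]

theorem treeMonomial_eq_node {F : Finset (Finset ℕ)} {i j k : ℕ} {legs : Fin (k + 1) → ℕ}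
    (hmono : StrictMono legs) (h : ∀ v, v ∈ legsIn F i j ↔ ∃ s, legs s = v) :
    treeMonomial F i j =
      .node k legs fun t => treeMonomial F (gapL i legs t) (gapR legs j t) := by
  have himg : legsIn F i j = univ.image legs := by ext v; simp [h]
  have hc : (legsIn F i j).card = k + 1 := by
    rw [himg, card_image_of_injective _ hmono.injective]; simp
  rw [treeMonomial_of_card hc]
  have hl : ((legsIn F i j).orderEmbOfFin hc : Fin (k + 1) → ℕ) = legs :=
    (orderEmbOfFin_unique hc (fun s => (h _).2 ⟨s, rfl⟩) hmono).symm
  rw [hl]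
  rfl

theorem exists_treeMonomial_eq_node {F : Finset (Finset ℕ)} {i j : ℕ} (hij : i < j)
    (hj : Related F (j - 1) (j - 1)) :
    ∃ (k : ℕ) (legs : Fin (k + 1) → ℕ), IsLegs i j legs ∧
      (∀ v, (∃ s, legs s = v) ↔ i ≤ v ∧ v < j ∧ Related F v (j - 1)) ∧
      treeMonomial F i j =
        .node k legs fun t => treeMonomial F (gapL i legs t) (gapR legs j t) := by
  have hmem : j - 1 ∈ legsIn F i j := mem_legsIn.2 ⟨by omega, by omega, hj⟩
  obtain ⟨k, hk⟩ : ∃ k, (legsIn F i j).card = k + 1 :=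
    Nat.exists_eq_succ_of_ne_zero (card_ne_zero_of_mem hmem)
  have hr : ∀ v, v ∈ legsIn F i j ↔ ∃ s, (legsIn F i j).orderEmbOfFin hk s = v := by
    intro v
    have := range_orderEmbOfFin (legsIn F i j) hk
    rw [← mem_coe, ← this]
    rfl
  have hlt : ∀ s, _ := fun s => mem_legsIn.1 ((hr _).2 ⟨s, rfl⟩)
  refine ⟨k, (legsIn F i j).orderEmbOfFin hk, ⟨?_, ?_, ?_⟩, fun v => ?_, ?_⟩
  · exact (OrderEmbedding.strictMono _)
  · exact (hlt 0).1
  · obtain ⟨s, hs⟩ := (hr _).1 hmem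
    have h1 := ((legsIn F i j).orderEmbOfFin hk).monotone (Fin.le_last s)
    have h2 := (hlt (Fin.last k)).2.1
    omega
  · rw [← hr, mem_legsIn]
  · exact treeMonomial_eq_node (OrderEmbedding.strictMono _) hr

theorem treeMonomial_of_le (F : Finset (Finset ℕ)) {i j : ℕ} (h : j ≤ i) :
    treeMonomial F i j = .leaf :=
  treeMonomial_of_empty (by simp [legsIn, Ico_eq_empty_of_le h])

theorem treeMonomial_congr {F F' : Finset (Finset ℕ)} {i j : ℕ}
    (hcov : ∀ v, i ≤ v → v < j → Related F v v)
    (h : ∀ u v, i ≤ u → u < j → i ≤ v → v < j → (Related F u v ↔ Related F' u v)) :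
    treeMonomial F i j = treeMonomial F' i j := by
  induction hn : j - i using Nat.strong_induction_on generalizing i j with
  | _ n ih =>
    rcases Nat.lt_or_ge i j with hij | hij
    · obtain ⟨k, legs, hl, hr, he⟩ := exists_treeMonomial_eq_node hij
        (hcov _ (by omega) (by omega))
      rw [he, treeMonomial_eq_node (F := F') hl.mono]
      · congr 1
        funext t
        have h1 := hl.le_gapL t
        have h2 := hl.gapR_le t
        refine ih _ (hn ▸ hl.gap_lt t) (fun v hv hv' => hcov v (by omega) (by omega))
          (fun u v h3 h4 h5 h6 => h u v (by omega) (by omega) (by omega) (by omega)) rfl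
      · intro v
        rw [hr, mem_legsIn]
        refine ⟨fun ⟨h1, h2, h3⟩ => ⟨h1, h2, ?_⟩, fun ⟨h1, h2, h3⟩ => ⟨h1, h2, ?_⟩⟩
        · exact (h v _ h1 h2 (by omega) (by omega)).2 h3
        · exact (h v _ h1 h2 (by omega) (by omega)).1 h3
    · rw [treeMonomial_of_le _ hij, treeMonomial_of_le _ hij]

/-- The blocks of a tree. -/
def blocks : GapTree → Finset (Finset ℕ)
  | .leaf => ∅
  | .node _ legs child => insert (univ.image legs) (univ.biUnion fun t => blocks (child t))

/-- A non-crossing partition of `[i, j)`. -/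
structure IsNCPartition (F : Finset (Finset ℕ)) (i j : ℕ) : Prop where
  mem : ∀ V ∈ F, V.Nonempty ∧ ∀ v ∈ V, i ≤ v ∧ v < j
  cover : ∀ v, i ≤ v → v < j → Related F v v
  disjoint : IsDisjoint F
  nonCrossing : IsNonCrossing F

theorem mem_blocks_node {k : ℕ} {legs : Fin (k + 1) → ℕ} {child : Fin (k + 2) → GapTree}
    {V : Finset ℕ} :
    V ∈ blocks (.node k legs child) ↔ V = univ.image legs ∨ ∃ t, V ∈ blocks (child t) := by
  simp [blocks]

/-- The legs of the root and its gaps cut the interval into disjoint parts, and a gap contains no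
leg. Hence a block inside a gap can neither meet nor cross the root block or a block in another gap.
-/
theorem isNCPartition_blocks {m i j : ℕ} (hm : j - i ≤ m) {T : GapTree}
    (hT : T ∈ trees Q m i j) : IsNCPartition (blocks T) i j := by
  refine trees_induction (C := fun i j T => IsNCPartition (blocks T) i j) ?_ ?_ hm hT
  · intro i j hij
    refine ⟨?_, fun v _ _ => by omega, ?_, ?_⟩ <;> simp [blocks, IsDisjoint, IsNonCrossing]
  · intro i j k legs child hl _ _ ih
    have hS : ∀ v, v ∈ univ.image legs ↔ ∃ s, legs s = v := by simp
    have hgap : ∀ t, ∀ V ∈ blocks (child t), ∀ v ∈ V,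
        gapL i legs t ≤ v ∧ v < gapR legs j t := fun t V hV => ((ih t).mem V hV).2
    have hSgap : ∀ t, ∀ V ∈ blocks (child t), ∀ v ∈ V, v ∉ univ.image legs := by
      intro t V hV v hv hvS
      obtain ⟨s, rfl⟩ := (hS v).1 hvS
      exact hl.notMem_gap s t (hgap t V hV _ hv)
    refine ⟨?_, ?_, ?_, ?_⟩
    · intro V hV
      rcases mem_blocks_node.1 hV with rfl | ⟨t, hV⟩
      · refine ⟨⟨legs 0, by simp⟩, fun v hv => ?_⟩
        obtain ⟨s, rfl⟩ := (hS v).1 hv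
        exact ⟨hl.le_legs s, hl.legs_lt s⟩
      · refine ⟨((ih t).mem V hV).1, fun v hv => ?_⟩
        have h1 := hgap t V hV v hv
        have h2 := hl.le_gapL t
        have h3 := hl.gapR_le t
        omega
    · intro v hi hj
      by_cases hv : ∃ s, legs s = v
      · exact ⟨_, mem_blocks_node.2 (Or.inl rfl), (hS v).2 hv, (hS v).2 hv⟩
      · obtain ⟨t, h1, h2⟩ := hl.exists_gap hi hj (by simpa using hv)
        obtain ⟨V, hV, h3, _⟩ := (ih t).cover v h1 h2
        exact ⟨V, mem_blocks_node.2 (Or.inr ⟨t, hV⟩), h3, h3⟩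
    · intro V hV W hW v hvV hvW
      rcases mem_blocks_node.1 hV with rfl | ⟨t, hV⟩ <;>
        rcases mem_blocks_node.1 hW with rfl | ⟨t', hW⟩
      · rfl
      · exact absurd hvV (hSgap t' W hW v hvW)
      · exact absurd hvW (hSgap t V hV v hvV)
      · have h1 := hgap t V hV v hvV
        have h2 := hgap t' W hW v hvW
        obtain rfl := hl.gap_unique h1.1 h1.2 h2.1 h2.2
        exact (ih t).disjoint V hV W hW v hvV hvW
    · intro V hV W hW a b c d hab hbc hcd ha hc hb hd
      rcases mem_blocks_node.1 hV with rfl | ⟨t, hV⟩ <;>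
        rcases mem_blocks_node.1 hW with rfl | ⟨t', hW⟩
      · rfl
      · obtain ⟨s, rfl⟩ := (hS c).1 hc
        have h1 := hgap t' W hW b hb
        have h2 := hgap t' W hW d hd
        exact absurd ⟨by omega, by omega⟩ (hl.notMem_gap s t')
      · obtain ⟨s, rfl⟩ := (hS b).1 hb
        have h1 := hgap t V hV a ha
        have h2 := hgap t V hV c hc
        exact absurd ⟨by omega, by omega⟩ (hl.notMem_gap s t)
      · have h1 := hgap t V hV a ha
        have h2 := hgap t V hV c hc
        have h3 := hgap t' W hW b hb
        obtain rfl := hl.gap_unique (v := b) (t := t) (t' := t') (by omega) (by omega) h3.1 h3.2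
        exact (ih t).nonCrossing V hV W hW a b c d hab hbc hcd ha hc hb hd

theorem related_blocks_gap {m i j k : ℕ} {legs : Fin (k + 1) → ℕ}
    {child : Fin (k + 2) → GapTree} (hl : IsLegs i j legs) (hm : j - i ≤ m + 1)
    (hc : ∀ t, child t ∈ trees Q m (gapL i legs t) (gapR legs j t)) {t : Fin (k + 2)} {u v : ℕ}
    (hu : gapL i legs t ≤ u) (hu' : u < gapR legs j t) :
    Related (blocks (.node k legs child)) u v ↔ Related (blocks (child t)) u v := by
  constructor
  · rintro ⟨V, hV, huV, hvV⟩
    rcases mem_blocks_node.1 hV with rfl | ⟨t', hV⟩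
    · obtain ⟨s, -, rfl⟩ := mem_image.1 huV
      exact absurd ⟨hu, hu'⟩ (hl.notMem_gap s t)
    · have h1 := ((isNCPartition_blocks (by have := hl.gap_lt t'; omega) (hc t')).mem V hV).2 u huV
      obtain rfl := hl.gap_unique hu hu' h1.1 h1.2
      exact ⟨V, hV, huV, hvV⟩
  · rintro ⟨V, hV, huV, hvV⟩
    exact ⟨V, mem_blocks_node.2 (Or.inr ⟨t, hV⟩), huV, hvV⟩

theorem related_blocks_legs {m i j k : ℕ} {legs : Fin (k + 1) → ℕ}
    {child : Fin (k + 2) → GapTree} (hl : IsLegs i j legs) (hm : j - i ≤ m + 1)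
    (hc : ∀ t, child t ∈ trees Q m (gapL i legs t) (gapR legs j t)) {s : Fin (k + 1)} {v : ℕ} :
    Related (blocks (.node k legs child)) v (legs s) ↔ ∃ s, legs s = v := by
  constructor
  · rintro ⟨V, hV, hvV, hsV⟩
    rcases mem_blocks_node.1 hV with rfl | ⟨t', hV⟩
    · obtain ⟨s, -, rfl⟩ := mem_image.1 hvV
      exact ⟨s, rfl⟩
    · have h1 := ((isNCPartition_blocks (by have := hl.gap_lt t'; omega) (hc t')).mem V hV).2 _ hsV
      exact absurd h1 (hl.notMem_gap s t')
  · rintro ⟨s', rfl⟩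
    exact ⟨_, mem_blocks_node.2 (Or.inl rfl), by simp, by simp⟩

/-- One half of the bijection between trees and non-crossing partitions: the root is recognized as
the block of the last element, and inside a gap only the blocks of the corresponding child are seen.
-/
theorem treeMonomial_blocks {m i j : ℕ} (hm : j - i ≤ m) {T : GapTree}
    (hT : T ∈ trees Q m i j) : treeMonomial (blocks T) i j = T := by
  induction m generalizing i j T with
  | zero =>
    obtain rfl : T = .leaf := by simpa [trees] using hT
    exact treeMonomial_of_le _ (by omega)
  | succ m ih =>
    rcases Nat.lt_or_ge i j with h | h
    · obtain ⟨k, legs, child, rfl, hl, _, hc⟩ := (mem_trees h).1 hT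
      rw [treeMonomial_eq_node hl.mono]
      · congr 1
        funext t
        have hgm : gapR legs j t - gapL i legs t ≤ m := by have := hl.gap_lt t; omega
        rw [← ih hgm (hc t)]
        rw [ih hgm (hc t)]
        refine (treeMonomial_congr (F' := blocks (child t)) ?_ ?_).trans (ih hgm (hc t))
        · intro v h1 h2
          rw [related_blocks_gap hl hm hc h1 h2]
          exact (isNCPartition_blocks hgm (hc t)).cover v h1 h2
        · intro u v h1 h2 h3 h4
          rw [related_blocks_gap hl hm hc h1 h2]
      · intro v
        have hj : j - 1 = legs (Fin.last k) := by have := hl.last; omega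
        rw [mem_legsIn, hj, related_blocks_legs hl hm hc]
        refine ⟨fun h => h.2.2, ?_⟩
        rintro ⟨s, rfl⟩
        exact ⟨hl.le_legs s, hl.legs_lt s, s, rfl⟩
    · rw [trees_of_le h, mem_singleton] at hT
      rw [hT, treeMonomial_of_le _ h]

/-- No condition on the blocks of a tree. -/
def anyLegs : ℕ → (k : ℕ) → (Fin (k + 1) → ℕ) → Prop := fun _ _ _ => True

theorem treeMonomial_mem_trees {F : Finset (Finset ℕ)} {m i j : ℕ} (hm : j - i ≤ m)
    (hcov : ∀ v, i ≤ v → v < j → Related F v v) :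
    treeMonomial F i j ∈ trees anyLegs m i j := by
  induction m generalizing i j with
  | zero => simp [trees, treeMonomial_of_le F (show j ≤ i by omega)]
  | succ m ih =>
    rcases Nat.lt_or_ge i j with h | h
    · obtain ⟨k, legs, hl, hr, he⟩ := exists_treeMonomial_eq_node h (hcov _ (by omega) (by omega))
      rw [he, mem_trees h]
      refine ⟨k, legs, _, rfl, hl, trivial, fun t => ih (by have := hl.gap_lt t; omega) ?_⟩
      intro v h1 h2
      have h3 := hl.le_gapL t
      have h4 := hl.gapR_le t
      exact hcov v (by omega) (by omega)
    · rw [trees_of_le h, treeMonomial_of_le _ h, mem_singleton]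

/-- The other half of the bijection. Non-crossing is used at one point: two related elements in
different gaps would have a leg between them, and the pair would cross the pair formed by this leg
and `j - 1`. -/
theorem related_blocks_treeMonomial {F : Finset (Finset ℕ)} {i j : ℕ}
    (hcov : ∀ v, i ≤ v → v < j → Related F v v) (hd : IsDisjoint F) (hnc : IsNonCrossing F)
    {u v : ℕ} (hu : i ≤ u) (hu' : u < j) (hv : i ≤ v) (hv' : v < j) :
    Related (blocks (treeMonomial F i j)) u v ↔ Related F u v := by
  induction hn : j - i using Nat.strong_induction_on generalizing i j u v with
  | _ n ih =>
    have hij : i < j := by omega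
    obtain ⟨k, legs, hl, hr, he⟩ := exists_treeMonomial_eq_node hij (hcov _ (by omega) (by omega))
    have hcov' : ∀ t v, gapL i legs t ≤ v → v < gapR legs j t → Related F v v := by
      intro t v h1 h2
      have h3 := hl.le_gapL t
      have h4 := hl.gapR_le t
      exact hcov v (by omega) (by omega)
    have hc : ∀ t, treeMonomial F (gapL i legs t) (gapR legs j t) ∈
        trees anyLegs (j - i) (gapL i legs t) (gapR legs j t) := fun t =>
      treeMonomial_mem_trees (hl.gap_lt t).le (hcov' t)
    have hm : j - i ≤ (j - i) + 1 := by omega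
    have hj : j - 1 = legs (Fin.last k) := by have := hl.last; omega
    rw [he]
    have legcase : ∀ {u v}, i ≤ u → u < j → (∃ s, legs s = v) →
        ((Related (blocks (.node k legs fun t =>
        treeMonomial F (gapL i legs t) (gapR legs j t))) u v) ↔ Related F u v) := by
      rintro u v hu hu' ⟨s, rfl⟩
      rw [related_blocks_legs hl hm hc, hr]
      have h1 := ((hr _).1 ⟨s, rfl⟩).2.2
      exact ⟨fun h => h.2.2.trans hd h1.symm, fun h => ⟨hu, hu', h.trans hd h1⟩⟩
    by_cases hvl : ∃ s, legs s = v
    · exact legcase hu hu' hvl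
    by_cases hul : ∃ s, legs s = u
    · have := legcase hv hv' hul
      exact ⟨fun h => (this.1 h.symm).symm, fun h => (this.2 h.symm).symm⟩
    obtain ⟨t, h1, h2⟩ := hl.exists_gap hu hu' (by simpa using hul)
    obtain ⟨t', h3, h4⟩ := hl.exists_gap hv hv' (by simpa using hvl)
    rw [related_blocks_gap hl hm hc h1 h2]
    have hgap : ∀ {u v : ℕ} {t t' : Fin (k + 2)}, (¬ ∃ s, legs s = u) → (¬ ∃ s, legs s = v) →
        i ≤ u → v < j → u < gapR legs j t → gapL i legs t' ≤ v → t < t' → ¬ Related F u v := by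
      intro u v t t' hul hvl hu hv' h2 h3 htt hR
      obtain ⟨s, h5, h6⟩ := hl.exists_between htt
      have hs := (hr _).1 ⟨s, rfl⟩
      have hlast := hl.last
      have hvne : v ≠ j - 1 := fun h => hvl ⟨Fin.last k, by omega⟩
      have := hnc.related (a := u) (b := legs s) (c := v) (d := j - 1) (by omega) (by omega)
        (by omega) hR hs.2.2
      exact hul ((hr u).2 ⟨hu, by omega, this.trans hd hs.2.2⟩)
    rcases lt_trichotomy t t' with htt | rfl | htt
    · refine iff_of_false ?_ (hgap hul hvl hu hv' h2 h3 htt)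
      rintro ⟨V, hV, -, hvV⟩
      have := ((isNCPartition_blocks (hl.gap_lt t).le (hc t)).mem V hV).2 v hvV
      exact htt.ne (hl.gap_unique this.1 this.2 h3 h4)
    · exact ih _ (hn ▸ hl.gap_lt t) (hcov' t) h1 h2 h3 h4 rfl
    · refine iff_of_false ?_ fun h => hgap hvl hul hv hu' h4 h1 htt h.symm
      rintro ⟨V, hV, -, hvV⟩
      have := ((isNCPartition_blocks (hl.gap_lt t).le (hc t)).mem V hV).2 v hvV
      exact htt.ne' (hl.gap_unique this.1 this.2 h3 h4)

/-! ### Partitions -/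

section Partition

variable {n : ℕ}

theorem related_parts_iff {π : Finpartition (range n)} {u v : ℕ} :
    Related π.parts u v ↔ v ∈ π.part u ∧ u < n := by
  constructor
  · rintro ⟨V, hV, hu, hv⟩
    exact ⟨Finpartition.mem_part_iff_exists _ |>.2 ⟨V, hV, hv, hu⟩, mem_range.1 (π.le hV hu)⟩
  · rintro ⟨h, _⟩
    obtain ⟨V, hV, hv, hu⟩ := Finpartition.mem_part_iff_exists _ |>.1 h
    exact ⟨V, hV, hu, hv⟩

theorem isDisjoint_parts (π : Finpartition (range n)) : IsDisjoint π.parts :=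
  fun _ hV _ hW _ hv hw => π.eq_of_mem_parts hV hW hv hw

theorem related_parts_self (π : Finpartition (range n)) {v : ℕ} (hv : v < n) :
    Related π.parts v v := by
  obtain ⟨V, ⟨hV, hvV⟩, -⟩ := π.existsUnique_mem (mem_range.2 hv)
  exact ⟨V, hV, hvV, hvV⟩

theorem partition_ext {π π' : Finpartition (range n)}
    (h : ∀ u v, u < n → v < n → (Related π.parts u v ↔ Related π'.parts u v)) : π = π' := by
  have key : ∀ {π π' : Finpartition (range n)},
      (∀ u v, u < n → v < n → (Related π.parts u v ↔ Related π'.parts u v)) →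
      ∀ V ∈ π.parts, V ∈ π'.parts := by
    intro π π' h V hV
    obtain ⟨u, hu⟩ := π.nonempty_of_mem_parts hV
    have hun : u < n := mem_range.1 (π.le hV hu)
    have : V = π'.part u := by
      ext v
      constructor
      · intro hv
        exact (related_parts_iff.1 ((h u v hun (mem_range.1 (π.le hV hv))).1 ⟨V, hV, hu, hv⟩)).1
      · intro hv
        have hvn : v < n := mem_range.1 (π'.le (π'.part_mem.2 (mem_range.2 hun)) hv)
        obtain ⟨W, hW, huW, hvW⟩ := (h u v hun hvn).2 (related_parts_iff.2 ⟨hv, hun⟩)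
        rwa [π.eq_of_mem_parts hV hW hu huW]
    rw [this]
    exact π'.part_mem.2 (mem_range.2 hun)
  ext V
  exact ⟨key h V, key (fun u v hu hv => (h u v hu hv).symm) V⟩

/-- The partition of `range n` given by the relation of a family of blocks. -/
theorem exists_partition (r : Setoid ℕ) :
    ∃ π : Finpartition (range n), ∀ u v, u < n → v < n → (Related π.parts u v ↔ r u v) := by
  classical
  refine ⟨Finpartition.ofSetSetoid r (range n), fun u v hu hv => ?_⟩
  rw [related_parts_iff, Finpartition.mem_part_ofSetSetoid_iff_rel]
  simp [hu, hv]

/-- A sum over non-crossing partitions is a sum over trees. -/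
theorem sum_NC_eq_sum_trees {M : Type*} [AddCommMonoid M] (g : GapTree → M) :
    ∑ π ∈ NC n, g (treeMonomial π.parts 0 n) = ∑ T ∈ trees anyLegs n 0 n, g T := by
  have hcov : ∀ π : Finpartition (range n), ∀ v, 0 ≤ v → v < n → Related π.parts v v :=
    fun π v _ hv => related_parts_self π hv
  refine sum_nbij (fun π => treeMonomial π.parts 0 n) ?_ ?_ ?_ (fun _ _ => rfl)
  · intro π _
    exact treeMonomial_mem_trees (by omega) (hcov π)
  · intro π hπ π' hπ' h
    simp only [NC, coe_filter, mem_univ, true_and, Set.mem_ofPred_eq] at hπ hπ'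
    refine partition_ext fun u v hu hv => ?_
    rw [← related_blocks_treeMonomial (hcov π) (isDisjoint_parts π) hπ u.zero_le hu v.zero_le hv,
      ← related_blocks_treeMonomial (hcov π') (isDisjoint_parts π') hπ' u.zero_le hu v.zero_le hv]
    simp only at h
    rw [h]
  · intro T hT
    have hT' := mem_coe.1 hT
    have hp := isNCPartition_blocks (by omega) hT'
    -- Equality is adjoined because the relation has to be reflexive at numbers outside `range n`
    -- too.
    obtain ⟨π, hπ⟩ := exists_partition (n := n)
      { r := fun u v => u = v ∨ Related (blocks T) u v
        iseqv := ⟨fun u => Or.inl rfl, fun {u v} h => h.imp Eq.symm Related.symm,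
            fun {u v w} h h' => by
          rcases h with rfl | h
          · exact h'
          · rcases h' with rfl | h'
            · exact Or.inr h
            · exact Or.inr (h.trans hp.disjoint h')⟩ }
    have hπ' : ∀ u v, u < n → v < n → (Related π.parts u v ↔ Related (blocks T) u v) := by
      intro u v hu hv
      rw [hπ u v hu hv]
      refine ⟨?_, Or.inr⟩
      rintro (rfl | h)
      · exact hp.cover u u.zero_le hu
      · exact h
    have hlt : ∀ {u v}, Related π.parts u v → u < n ∧ v < n := by
      rintro u v ⟨V, hV, hu, hv⟩
      exact ⟨mem_range.1 (π.le hV hu), mem_range.1 (π.le hV hv)⟩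
    refine ⟨π, ?_, ?_⟩
    · simp only [NC, coe_filter, mem_univ, true_and, Set.mem_ofPred_eq]
      refine (isDisjoint_parts π).isNonCrossing fun a b c d hab hbc hcd h1 h2 => ?_
      have h3 := hlt h1
      have h4 := hlt h2
      rw [hπ' _ _ h3.1 h3.2] at h1
      rw [hπ' _ _ h4.1 h4.2] at h2
      rw [hπ' _ _ h3.1 h4.1]
      exact hp.nonCrossing.related hab hbc hcd h1 h2
    · simp only
      rw [treeMonomial_congr (hcov π) (F' := blocks T) fun u v _ hu _ hv => hπ' u v hu hv]
      exact treeMonomial_blocks (by omega) hT'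

end Partition

end FreeProd

namespace FreeProd

open WordSeries

/-! ### Multiadditive evaluation of trees -/

section Distribute

variable {B : Type*} [Ring B]

/-- Additivity in each argument is `ℤ`-multilinearity, for which the expansion of sums is available.
-/
theorem map_sum_piFinset {n : ℕ} {α : Type*} {H : (Fin n → B) → B}
    (hH : ∀ c t x y, H (Function.update c t (x + y)) =
      H (Function.update c t x) + H (Function.update c t y))
    (S : Fin n → Finset α) (g : Fin n → α → B) :
    H (fun t => ∑ x ∈ S t, g t x) = ∑ c ∈ Fintype.piFinset S, H fun t => g t (c t) := by
  classical
  let M : MultilinearMap ℤ (fun _ : Fin n => B) B :=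
    { toFun := H
      map_update_add' := by
        intro inst c t x y
        cases Subsingleton.elim inst (instDecidableEqFin n)
        exact hH c t x y
      map_update_smul' := by
        intro inst c t z x
        cases Subsingleton.elim inst (instDecidableEqFin n)
        exact map_zsmul (AddMonoidHom.mk' (fun x => H (Function.update c t x)) (hH c t)) z x }
  exact M.map_sum_finset g S

theorem WordSeries.IsAdd.ofFn_update {F : WordSeries B B} (hF : IsAdd F) {n : ℕ}
    (c : Fin n → B) (t : Fin n) (x y : B) : F (List.ofFn (Function.update c t (x + y))) =
      F (List.ofFn (Function.update c t x)) + F (List.ofFn (Function.update c t y)) := by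
  induction n generalizing F with
  | zero => exact t.elim0
  | succ n ih =>
    induction t using Fin.cases with
    | zero =>
      simp only [List.ofFn_succ, Function.update_self]
      simpa using hF [] x y (List.ofFn fun i => c i.succ)
    | succ t =>
      have h : ∀ z, List.ofFn (Function.update c t.succ z) =
          c 0 :: List.ofFn (Function.update (fun i => c i.succ) t z) := by
        intro z
        rw [List.ofFn_succ]
        refine congrArg₂ List.cons ?_ (congrArg List.ofFn (funext fun i => ?_))
        · exact Function.update_of_ne (Fin.succ_ne_zero t).symm _ _
        · simp [Function.update]
      simp only [h]
      exact ih (hF.der (c 0)) _ t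

/-- The value of a tree: the leaf at the position `p` is evaluated to `lam p`, and a block with
values `c₀, …, c_k` in its gaps is evaluated to `c₀ K(c₁, …, c_{k-1}) c_k`. -/
def treeValue (K : ℕ → WordSeries B B) (lam : ℕ → B) : GapTree → ℕ → B
  | .leaf, i => lam i
  | .node k legs child, i =>
      treeValue K lam (child 0) i *
        K (legs 0) (List.ofFn fun t : Fin k =>
          treeValue K lam (child t.castSucc.succ) (legs t.castSucc + 1)) *
        treeValue K lam (child (Fin.last (k + 1))) (legs (Fin.last k) + 1)

/-- A tree is a choice of root legs together with independent choices of subtrees in the gaps, and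
additivity of `K` moves the sums over subtrees into its arguments. -/
theorem sum_treeValue {Q : ℕ → (k : ℕ) → (Fin (k + 1) → ℕ) → Prop} {K : ℕ → WordSeries B B}
    (hK : ∀ s, IsAdd (K s)) (lam : ℕ → B) {m i j : ℕ} (hij : i < j) :
    ∑ T ∈ trees Q (m + 1) i j, treeValue K lam T i = ∑ p ∈ legSet Q i j,
      (∑ T ∈ trees Q m i (p.2 0), treeValue K lam T i) *
        K (p.2 0) (List.ofFn fun t : Fin p.1 =>
          ∑ T ∈ trees Q m (p.2 t.castSucc + 1) (p.2 t.succ),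
            treeValue K lam T (p.2 t.castSucc + 1)) *
        ∑ T ∈ trees Q m (p.2 (Fin.last p.1) + 1) j,
          treeValue K lam T (p.2 (Fin.last p.1) + 1) := by
  rw [sum_trees hij]
  refine sum_congr rfl fun p _ => ?_
  obtain ⟨k, legs⟩ := p
  have hadd : ∀ (c : Fin (k + 2) → B) t x y,
      (fun c : Fin (k + 2) → B => c 0 * K (legs 0) (List.ofFn fun t : Fin k => c t.castSucc.succ) *
        c (Fin.last (k + 1))) (Function.update c t (x + y)) =
      (fun c : Fin (k + 2) → B => c 0 * K (legs 0) (List.ofFn fun t : Fin k => c t.castSucc.succ) *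
        c (Fin.last (k + 1))) (Function.update c t x) +
      (fun c : Fin (k + 2) → B => c 0 * K (legs 0) (List.ofFn fun t : Fin k => c t.castSucc.succ) *
        c (Fin.last (k + 1))) (Function.update c t y) := by
    intro c t x y
    induction t using Fin.cases with
    | zero =>
      have h1 : ∀ z, (fun t : Fin k => Function.update c 0 z t.castSucc.succ) =
          fun t => c t.castSucc.succ := fun z => by
        funext t
        exact Function.update_of_ne (Fin.succ_ne_zero _) _ _
      have h2 : ∀ z, Function.update c 0 z (Fin.last (k + 1)) = c (Fin.last (k + 1)) := fun z =>
        Function.update_of_ne (Fin.last_pos.ne') _ _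
      simp only [h1, h2, Function.update_self, add_mul]
    | succ t =>
      have h0 : ∀ z, Function.update c t.succ z 0 = c 0 := fun z =>
        Function.update_of_ne (Fin.succ_ne_zero _).symm _ _
      induction t using Fin.lastCases with
      | last =>
        have h1 : ∀ z, (fun t : Fin k => Function.update c (Fin.last k).succ z t.castSucc.succ) =
            fun t => c t.castSucc.succ := fun z => by
          funext t
          exact Function.update_of_ne
            (fun h => (Fin.castSucc_lt_last t).ne (Fin.succ_injective _ h)) _ _
        have h2 : ∀ z, Function.update c (Fin.last k).succ z (Fin.last (k + 1)) = z := fun z =>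
          Function.update_self _ _ _
        simp only [h1, h2, h0, mul_add]
      | cast t =>
        have h2 : ∀ z, Function.update c t.castSucc.succ z (Fin.last (k + 1)) =
            c (Fin.last (k + 1)) := fun z => Function.update_of_ne
              (fun h => (Fin.castSucc_lt_last t).ne' (Fin.succ_injective _ h)) _ _
        have h1 : ∀ z, (fun u : Fin k => Function.update c t.castSucc.succ z u.castSucc.succ) =
            Function.update (fun u : Fin k => c u.castSucc.succ) t z := fun z => by
          funext u
          simp [Function.update]
        simp only [h0, h1, h2, (hK _).ofFn_update, mul_add, add_mul]
  have key := map_sum_piFinset (H := fun c : Fin (k + 2) → B => c 0 *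
    K (legs 0) (List.ofFn fun t : Fin k => c t.castSucc.succ) * c (Fin.last (k + 1))) hadd
    (fun t => trees Q m (gapL i legs t) (gapR legs j t))
    fun t T => treeValue K lam T (gapL i legs t)
  simp only [gapL_zero, gapR_zero, gapL_last, gapR_last, Fin.succ_castSucc,
    gapR_castSucc] at key
  have hg : ∀ t : Fin k, gapL i legs t.succ.castSucc = legs t.castSucc + 1 := fun t => by
    rw [← Fin.succ_castSucc, gapL_succ]
  simp only [hg] at key
  simp only [treeValue, Fin.succ_castSucc]
  exact key.symm

end Distribute

/-! ### Cutting words -/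

section Cuts

/-- The increasing lists of elements of `[p, p + m]` ending with `p + m`. -/
def cuts : ℕ → ℕ → List (List ℕ)
  | 0, p => [[p]]
  | m + 1, p => (cuts m (p + 1)).map (p :: ·) ++ cuts m (p + 1)

/-- The lists `l` such that `o :: l` is increasing and ends with `o + m`. -/
def cutsFrom (o : ℕ) : ℕ → List (List ℕ)
  | 0 => [[]]
  | m + 1 => cuts m (o + 1)

theorem mem_cuts {m p : ℕ} {l : List ℕ} :
    l ∈ cuts m p ↔ l.Pairwise (· < ·) ∧ (∀ x ∈ l, p ≤ x) ∧ l.getLast? = some (p + m) := by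
  induction m generalizing p l with
  | zero =>
    rw [cuts, List.mem_singleton]
    constructor
    · rintro rfl; simp
    · rintro ⟨h1, h2, h3⟩
      rcases l with _ | ⟨x, _ | ⟨y, l⟩⟩
      · simp at h3
      · simpa using h3
      · have h4 : p + 0 ∈ y :: l := by
          rw [List.getLast?_cons_cons] at h3
          exact List.mem_of_getLast? h3
        have := List.rel_of_pairwise_cons h1 h4
        have := h2 x (by simp)
        omega
  | succ m ih =>
    rw [cuts, List.mem_append, List.mem_map]
    constructor
    · rintro (⟨l, hl, rfl⟩ | hl)
      · obtain ⟨h1, h2, h3⟩ := ih.1 hl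
        refine ⟨List.pairwise_cons.2 ⟨fun x hx => h2 x hx, h1⟩, ?_, ?_⟩
        · intro x hx
          rcases List.mem_cons.1 hx with rfl | hx
          · exact le_rfl
          · have := h2 x hx; omega
        · cases l with
          | nil => simp at h3
          | cons y l => rw [List.getLast?_cons_cons, h3]; congr 1; omega
      · obtain ⟨h1, h2, h3⟩ := ih.1 hl
        exact ⟨h1, fun x hx => by have := h2 x hx; omega, by rw [h3]; congr 1; omega⟩
    · rintro ⟨h1, h2, h3⟩
      rcases l with _ | ⟨x, l⟩
      · simp at h3
      · have hx := h2 x (by simp)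
        have hl : ∀ y ∈ l, x < y := fun y hy => List.rel_of_pairwise_cons h1 hy
        rcases hx.eq_or_lt with rfl | hx
        · refine Or.inl ⟨l, ih.2 ⟨h1.of_cons, fun y hy => hl y hy, ?_⟩, rfl⟩
          cases l with
          | nil => simp at h3
          | cons y l => rw [List.getLast?_cons_cons] at h3; rw [h3]; congr 1; omega
        · refine Or.inr (ih.2 ⟨h1, ?_, by rw [h3]; congr 1; omega⟩)
          intro y hy
          rcases List.mem_cons.1 hy with rfl | hy
          · exact hx
          · have := hl y hy; omega

theorem nodup_cuts (m p : ℕ) : (cuts m p).Nodup := by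
  induction m generalizing p with
  | zero => simp [cuts]
  | succ m ih =>
    rw [cuts]
    refine List.nodup_append.2 ⟨(ih _).map (List.cons_injective), ih _, ?_⟩
    rintro a ha b hb rfl
    obtain ⟨l, -, rfl⟩ := List.mem_map.1 ha
    have := (mem_cuts.1 hb).2.1 p (by simp)
    omega

theorem nodup_cutsFrom (o m : ℕ) : (cutsFrom o m).Nodup := by
  cases m with
  | zero => simp [cutsFrom]
  | succ m => exact nodup_cuts _ _

theorem mem_cutsFrom {o m : ℕ} {l : List ℕ} : l ∈ cutsFrom o m ↔ o :: l ∈ cuts m o := by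
  cases m with
  | zero => simp [cutsFrom, cuts]
  | succ m =>
    rw [cutsFrom, cuts, List.mem_append, List.mem_map]
    constructor
    · exact fun h => Or.inl ⟨l, h, rfl⟩
    · rintro (⟨l', h, h'⟩ | h)
      · rwa [← (List.cons.inj h').2]
      · have := (mem_cuts.1 h).2.1 o (by simp)
        omega

theorem ofFn_mem_cuts {k i j : ℕ} (hij : i < j) {legs : Fin (k + 1) → ℕ} :
    List.ofFn legs ∈ cuts (j - 1 - i) i ↔ IsLegs i j legs := by
  rw [mem_cuts, List.pairwise_ofFn, List.forall_mem_ofFn_iff]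
  have hlast : (List.ofFn legs).getLast? = some (legs (Fin.last k)) := by
    rw [List.getLast?_eq_some_getLast (by simp), List.getLast_ofFn_succ]
  rw [hlast, Option.some_inj]
  constructor
  · rintro ⟨h1, h2, h3⟩
    exact ⟨fun s t hst => h1 hst, h2 0, by omega⟩
  · intro h
    refine ⟨fun s t hst => h.mono hst, h.le_legs, ?_⟩
    have := h.last
    omega

theorem sigma_ext_ofFn {p q : Σ k : ℕ, (Fin (k + 1) → ℕ)}
    (h : List.ofFn p.2 = List.ofFn q.2) : p = q := by
  obtain ⟨k, f⟩ := p
  obtain ⟨k', f'⟩ := q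
  have : k + 1 = k' + 1 := by simpa using congrArg List.length h
  obtain rfl : k = k' := by omega
  obtain rfl := List.ofFn_injective h
  rfl

theorem sum_legSet_any {M : Type*} [AddCommMonoid M] {i j : ℕ} (hij : i < j) (G : List ℕ → M) :
    ∑ p ∈ legSet anyLegs i j, G (List.ofFn p.2) = ((cuts (j - 1 - i) i).map G).sum := by
  rw [← List.sum_toFinset _ (nodup_cuts _ _)]
  refine sum_nbij (fun p => List.ofFn p.2) ?_ ?_ ?_ fun _ _ => rfl
  · intro p hp
    exact List.mem_toFinset.2 ((ofFn_mem_cuts hij).2 (mem_legSet.1 hp).1)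
  · intro p _ q _ h
    exact sigma_ext_ofFn h
  · intro l hl
    have hl' := List.mem_toFinset.1 (mem_coe.1 hl)
    rcases l with _ | ⟨s, l⟩
    · simp [mem_cuts] at hl'
    · refine ⟨⟨l.length, (s :: l).get⟩, ?_, List.ofFn_get _⟩
      refine mem_coe.2 (mem_legSet.2 ⟨(ofFn_mem_cuts hij).1 ?_, trivial⟩)
      rw [show List.ofFn _ = s :: l from List.ofFn_get (s :: l)]
      exact hl'

/-- The values of `g` at the pairs of successive elements of a list. -/
def pieces {M : Type*} (g : ℕ → ℕ → M) : ℕ → List ℕ → List M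
  | _, [] => []
  | s, t :: l => g s t :: pieces g t l

theorem ofFn_eq_pieces {M : Type*} (g : ℕ → ℕ → M) {k : ℕ} (legs : Fin (k + 1) → ℕ) :
    (List.ofFn fun t : Fin k => g (legs t.castSucc) (legs t.succ)) =
      pieces g (legs 0) (List.ofFn fun t : Fin k => legs t.succ) := by
  induction k with
  | zero => rfl
  | succ k ih =>
    rw [List.ofFn_succ, List.ofFn_succ, pieces]
    exact congrArg _ (ih fun t => legs t.succ)

variable {B : Type*}

/-- The word `lam p, …, lam (p + m - 1)`. -/
def seg (lam : ℕ → B) (p m : ℕ) : List B := (List.range' p m).map lam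

@[simp] theorem seg_zero (lam : ℕ → B) (p : ℕ) : seg lam p 0 = [] := rfl
theorem seg_succ (lam : ℕ → B) (p m : ℕ) : seg lam p (m + 1) = lam p :: seg lam (p + 1) m := rfl
theorem seg_succ' (lam : ℕ → B) (p m : ℕ) :
    seg lam p (m + 1) = seg lam p m ++ [lam (p + m)] := by
  simp [seg, List.range'_concat]
@[simp] theorem length_seg (lam : ℕ → B) (p m : ℕ) : (seg lam p m).length = m := by simp [seg]

variable [Ring B]

/-- Here `o` is the last cut made, and the letters at `o + 1, …, p` form the pending piece. Either
`p` is a cut and closes this piece, or the next letter joins it: the recursions of `cuts` and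
`compAux` coincide. -/
theorem sum_cuts (F f : WordSeries B B) (lam : ℕ → B) (m o p : ℕ) (hop : o < p) :
    ((cuts m p).map fun l => F (pieces (fun u v => f (seg lam (u + 1) (v - u))) o l)).sum =
      compAux f (seg lam (p + 1) m) F (seg lam (o + 1) (p - o)) := by
  induction m generalizing F o p with
  | zero => simp [cuts, pieces, compAux]
  | succ m ih =>
    rw [cuts, List.map_append, List.sum_append, List.map_map, seg_succ, compAux, add_comm]
    congr 1
    · rw [ih F o (p + 1) (by omega), show p + 1 - o = p - o + 1 by omega, seg_succ']
      rw [show o + 1 + (p - o) = p + 1 by omega]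
    · have := ih (der (f (seg lam (o + 1) (p - o))) F) p (p + 1) (by omega)
      rw [show p + 1 - p = 0 + 1 by omega, seg_succ, seg_zero] at this
      exact this

theorem sum_cutsFrom (F f : WordSeries B B) (lam : ℕ → B) (m o : ℕ) :
    ((cutsFrom o m).map fun l =>
      F (pieces (fun u v => f (seg lam (u + 1) (v - u))) o l)).sum =
      comp F f (seg lam (o + 1) m) := by
  cases m with
  | zero => simp [cutsFrom, pieces]
  | succ m =>
    rw [cutsFrom, sum_cuts _ _ _ _ _ _ (by omega), seg_succ, comp_cons,
      show o + 1 - o = 0 + 1 by omega, seg_succ, seg_zero]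

/-- The first element of the list marks where the word passes from `Φ` to `comp F f`. The lists are
nonempty, so the default value of `headD` plays no role. -/
theorem sum_cuts_mul (Φ F f : WordSeries B B) (lam : ℕ → B) (m p : ℕ) {o : ℕ} (hop : o ≤ p) :
    ((cuts m p).map fun l => Φ (seg lam (o + 1) (l.headD 0 - o)) *
      F (pieces (fun u v => f (seg lam (u + 1) (v - u))) (l.headD 0) l.tail)).sum =
      ((⟨fun l => Φ (seg lam (o + 1) (p - o) ++ l)⟩ : WordSeries B B) * comp F f)
        (seg lam (p + 1) m) := by
  induction m generalizing p with
  | zero => simp [cuts, pieces]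
  | succ m ih =>
    rw [cuts, List.map_append, List.sum_append, List.map_map, ih (p + 1) (by omega), seg_succ,
      mul_cons]
    congr 1
    · have := sum_cutsFrom F f lam (m + 1) p
      rw [seg_succ, cutsFrom] at this
      rw [← this, ← List.sum_map_mul_left]
      simp [Function.comp_def]
    · rw [show p + 1 - o = p - o + 1 by omega, seg_succ', show o + 1 + (p - o) = p + 1 by omega]
      congr 2
      refine ext' fun l => ?_
      simp

end Cuts

/-! ### Sums over all trees -/

section AllTrees

variable {B : Type*} [Ring B]

/-- The sum of the values of all trees as a series. -/
def treeSeries (K : WordSeries B B) : WordSeries B B :=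
  ⟨fun l => ∑ T ∈ trees anyLegs l.length 0 l.length,
    treeValue (fun _ => K) (fun p => (1 :: l).getD p 1) T 0⟩

theorem seg_getD (l : List B) (c : B) :
    seg (fun p => (c :: l).getD p 1) 1 l.length = l := by
  refine List.ext_getElem (by simp) fun n h1 h2 => ?_
  simp [seg, Nat.add_comm 1, h2]

theorem seg_mul_ident (F : WordSeries B B) (lam : ℕ → B) (p m : ℕ) :
    (F * ident : WordSeries B B) (seg lam p (m + 1)) = F (seg lam p m) * lam (p + m) := by
  rw [seg_succ']
  exact mul_letter_append id F _ _

theorem ident_mul_seg (F : WordSeries B B) (lam : ℕ → B) (p m : ℕ) :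
    (ident * F : WordSeries B B) (seg lam p (m + 1)) = lam p * F (seg lam (p + 1) m) :=
  letter_mul_cons id F _ _

/-- Both parts go into one induction, since the gaps of the root are summed by the first part for
shorter intervals. The front gap yields Ψ, the inner gaps the arguments IΨ of `K`, and the back gap
is empty because the root contains the last element; its leaf is the final factor I. -/
theorem sum_trees_and_eq {K : WordSeries B B} (hK : IsAdd K) (n : ℕ) :
    (∀ lam i m, n ≤ m → ∑ T ∈ trees anyLegs m i (i + n), treeValue (fun _ => K) lam T i =
      lam i * treeSeries K (seg lam (i + 1) n)) ∧
    ∀ l : List B, l.length = n → treeSeries K l =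
      (1 + treeSeries K * comp K (ident * treeSeries K) * ident : WordSeries B B) l := by
  induction n using Nat.strong_induction_on with
  | _ n ih =>
    set Ψ := treeSeries K with hΨ
    rcases n with _ | n
    · have h0 : Ψ [] = 1 := by simp [hΨ, treeSeries, trees, treeValue]
      refine ⟨fun lam i m _ => ?_, fun l hl => ?_⟩
      · rw [add_zero, trees_of_le le_rfl, sum_singleton, seg_zero, h0, mul_one, treeValue]
      · obtain rfl := List.length_eq_zero_iff.1 hl
        simp [h0, ident]
    · have step : ∀ lam i m, n + 1 ≤ m →
          ∑ T ∈ trees anyLegs m i (i + (n + 1)), treeValue (fun _ => K) lam T i =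
          lam i * (Ψ * comp K (ident * Ψ) * ident : WordSeries B B) (seg lam (i + 1) (n + 1)) := by
        intro lam i m hm
        obtain ⟨m, rfl⟩ : ∃ m', m = m' + 1 := ⟨m - 1, by omega⟩
        have hi : i < i + (n + 1) := by omega
        have ih' : ∀ u v, u ≤ v → v - u < n + 1 →
            ∑ T ∈ trees anyLegs m u v, treeValue (fun _ => K) lam T u =
            lam u * Ψ (seg lam (u + 1) (v - u)) := by
          intro u v huv hlt
          have := (ih (v - u) hlt).1 lam u m (by omega)
          rwa [show u + (v - u) = v by omega] at this
        rw [sum_treeValue (fun _ => hK) lam hi]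
        let G : List ℕ → B := fun l => lam i * ((Ψ (seg lam (i + 1) (l.headD 0 - i)) *
          K (pieces (fun u v => (ident * Ψ : WordSeries B B) (seg lam (u + 1) (v - u)))
            (l.headD 0) l.tail)) * lam (i + (n + 1)))
        have e : ∀ p ∈ legSet anyLegs i (i + (n + 1)),
            (∑ T ∈ trees anyLegs m i (p.2 0), treeValue (fun _ => K) lam T i) *
            K (List.ofFn fun t : Fin p.1 =>
              ∑ T ∈ trees anyLegs m (p.2 t.castSucc + 1) (p.2 t.succ),
                treeValue (fun _ => K) lam T (p.2 t.castSucc + 1)) *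
            ∑ T ∈ trees anyLegs m (p.2 (Fin.last p.1) + 1) (i + (n + 1)),
              treeValue (fun _ => K) lam T (p.2 (Fin.last p.1) + 1) =
            G (List.ofFn p.2) := by
          rintro ⟨k, legs⟩ hp
          have hl : IsLegs i (i + (n + 1)) legs := (mem_legSet.1 hp).1
          have h0 := hl.legs_lt 0
          have hlast := hl.last
          simp only at *
          rw [ih' i (legs 0) hl.le (by omega), hlast, trees_of_le le_rfl, sum_singleton, treeValue]
          have e1 : (List.ofFn fun t : Fin k =>
              ∑ T ∈ trees anyLegs m (legs t.castSucc + 1) (legs t.succ),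
                treeValue (fun _ => K) lam T (legs t.castSucc + 1)) =
              pieces (fun u v => (ident * Ψ : WordSeries B B) (seg lam (u + 1) (v - u)))
                (legs 0) (List.ofFn fun t : Fin k => legs t.succ) := by
            rw [← ofFn_eq_pieces]
            congr 1
            funext t
            have h1 : legs t.castSucc < legs t.succ := hl.mono Fin.castSucc_lt_succ
            have h2 := hl.legs_lt t.succ
            have h3 := hl.le_legs t.castSucc
            rw [ih' _ _ h1 (by omega), show legs t.succ - legs t.castSucc =
              legs t.succ - (legs t.castSucc + 1) + 1 by omega, ident_mul_seg]
          rw [e1, List.ofFn_succ]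
          simp only [G, List.headD_cons, List.tail_cons, mul_assoc]
        refine (sum_congr rfl e).trans ((sum_legSet_any hi G).trans ?_)
        rw [List.sum_map_mul_left, List.sum_map_mul_right,
          sum_cuts_mul _ _ _ _ _ _ le_rfl, seg_mul_ident]
        rw [show i + (n + 1) - 1 - i = n by omega, show i + 1 + n = i + (n + 1) by omega]
        simp
      have eq2 : ∀ l : List B, l.length = n + 1 → Ψ l =
          (1 + Ψ * comp K (ident * Ψ) * ident : WordSeries B B) l := by
        intro l hl
        have h1 : Ψ l = ∑ T ∈ trees anyLegs l.length 0 l.length,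
          treeValue (fun _ => K) (fun p => (1 :: l).getD p 1) T 0 := rfl
        have := step (fun p => (1 :: l).getD p 1) 0 (n + 1) le_rfl
        simp only [Nat.zero_add, ← hl, seg_getD] at this
        rw [h1, this]
        rcases l with _ | ⟨c, l⟩
        · simp at hl
        · simp
      refine ⟨fun lam i m hm => ?_, eq2⟩
      rw [step lam i m hm, eq2 _ (length_seg _ _ _)]
      rw [WordSeries.add_apply, seg_succ, one_cons, zero_add]

theorem sum_trees_any {K : WordSeries B B} (hK : IsAdd K) (lam : ℕ → B) (i n : ℕ) :
    ∑ T ∈ trees anyLegs n i (i + n), treeValue (fun _ => K) lam T i =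
      lam i * treeSeries K (seg lam (i + 1) n) :=
  (sum_trees_and_eq hK n).1 lam i n le_rfl

theorem treeSeries_eq {K : WordSeries B B} (hK : IsAdd K) :
    treeSeries K = 1 + treeSeries K * comp K (ident * treeSeries K) * ident :=
  ext' fun l => (sum_trees_and_eq hK _).2 l rfl

end AllTrees

end FreeProd

namespace FreeProd

open WordSeries

/-! ### The cumulant series -/

section CumulantSeries

variable {A B : Type*} [Ring A] [Algebra ℂ A] [Ring B] [Algebra ℂ B] (P : OVSpace A B)

/-- The series with values `κ_{n+1}(x c₁, …, x c_n, x)`. -/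
def OVSpace.cumulantSeries (x : A) : WordSeries B B :=
  ⟨fun l => P.cumulantMap x l.length l.get⟩

/-- The functions `κ` at arguments of the form `c x d` are given by the series `K`. -/
def OVSpace.IsBilinearAt (x : A) (κ : (n : ℕ) → (Fin n → A) → B) (K : WordSeries B B)
    (k : ℕ) : Prop :=
  ∀ C D : Fin (k + 1) → B, κ (k + 1) (fun t => P.ι (C t) * x * P.ι (D t)) =
    C 0 * K (List.ofFn fun t : Fin k => D t.castSucc * C t.succ) * D (Fin.last k)

variable {P} {x : A}

/-- The scalar `D p` to the right of the element `p - 1` and the scalar `C p` to the left of the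
element `p` meet in the leaf at position `p`. The outer factors `D i` and `C j` complete the first
and the last leaf. -/
theorem evalTree_eq_treeValue {κ : (n : ℕ) → (Fin n → A) → B} {K : WordSeries B B}
    (hκ : ∀ k, P.IsBilinearAt x κ K k) {C D : ℕ → B} {w : ℕ → A} {m i j : ℕ} (hm : j - i ≤ m)
    {T : GapTree} (hT : T ∈ trees anyLegs m i j) (hij : i ≤ j)
    (hw : ∀ t, i ≤ t → t < j → w t = P.ι (C t) * x * P.ι (D (t + 1))) :
    D i * P.evalTree κ w T * C j = treeValue (fun _ => K) (fun p => D p * C p) T i := by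
  refine trees_induction (C := fun i j T => i ≤ j →
    (∀ t, i ≤ t → t < j → w t = P.ι (C t) * x * P.ι (D (t + 1))) →
    D i * P.evalTree κ w T * C j = treeValue (fun _ => K) (fun p => D p * C p) T i)
    ?_ ?_ hm hT hij hw
  · intro i j hji hij _
    obtain rfl : i = j := by omega
    simp [OVSpace.evalTree, treeValue]
  · intro i j k legs child hl _ _ ih _ hw
    set c : Fin (k + 2) → B := fun t => P.evalTree κ w (child t) with hc
    have ih' : ∀ t, D (gapL i legs t) * c t * C (gapR legs j t) =
        treeValue (fun _ => K) (fun p => D p * C p) (child t) (gapL i legs t) := fun t =>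
      ih t (hl.gapL_le_gapR t) fun s h1 h2 =>
        hw s ((hl.le_gapL t).trans h1) (h2.trans_le (hl.gapR_le t))
    have hgw : P.gapWord (fun t => w (legs t)) c = fun t =>
        P.ι ((if t = 0 then c 0 else 1) * C (legs t)) * x * P.ι (D (legs t + 1) * c t.succ) := by
      funext t
      rw [OVSpace.gapWord, hw _ (hl.le_legs t) (hl.legs_lt t)]
      split_ifs <;> simp [mul_assoc]
    have h0 := ih' 0
    have hlast := ih' (Fin.last (k + 1))
    rw [gapL_zero, gapR_zero] at h0
    rw [gapL_last, gapR_last] at hlast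
    rw [OVSpace.evalTree, ← hc, hgw, hκ k, treeValue, ← h0, ← hlast]
    have hmid : (List.ofFn fun t : Fin k => D (legs t.castSucc + 1) * c t.castSucc.succ *
        ((if t.succ = 0 then c 0 else 1) * C (legs t.succ))) =
        List.ofFn fun t : Fin k => treeValue (fun _ => K) (fun p => D p * C p)
          (child t.castSucc.succ) (legs t.castSucc + 1) := by
      congr 1
      funext t
      have := ih' t.castSucc.succ
      rw [gapL_succ, Fin.succ_castSucc, gapR_castSucc] at this
      rw [if_neg (Fin.succ_ne_zero t), one_mul, Fin.succ_castSucc, this]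
    rw [hmid]
    simp only [if_true, mul_assoc, Fin.succ_last]

theorem sum_partitioned {κ : (n : ℕ) → (Fin n → A) → B} {K : WordSeries B B}
    (hκ : ∀ k, P.IsBilinearAt x κ K k) (hK : IsAdd K) (C D : ℕ → B) (n : ℕ) :
    D 0 * (∑ π ∈ NC n, P.partitioned κ π fun t : Fin n => P.ι (C t) * x * P.ι (D (t + 1))) * C n =
      D 0 * C 0 * treeSeries K (seg (fun p => D p * C p) 1 n) := by
  have h := sum_NC_eq_sum_trees (n := n) fun T => D 0 * P.evalTree κ
    (fun i => if h : i < n then P.ι (C i) * x * P.ι (D (i + 1)) else 1) T * C n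
  have h2 := sum_trees_any hK (fun p => D p * C p) 0 n
  simp only [Nat.zero_add] at h2
  rw [← h2, mul_sum, sum_mul]
  refine h.trans (sum_congr rfl fun T hT => ?_)
  exact evalTree_eq_treeValue hκ (by omega) hT n.zero_le fun t _ ht => by simp [ht]

theorem incl_ident : P.incl ident = letter P.ι :=
  ext' fun l => by rcases l with _ | ⟨c, _ | ⟨d, l⟩⟩ <;> simp [ident]

theorem word_nil : P.word x [] = 1 := rfl

theorem word_cons (c : B) (l : List B) : P.word x (c :: l) = x * P.ι c * P.word x l := by
  have h : P.word x = 1 + const x * P.incl ident * P.word x := geom_eq (by simp [ident])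
  conv_lhs => rw [h]
  rw [WordSeries.add_apply, one_cons, zero_add, mul_assoc, const_mul_apply, incl_ident,
    letter_mul_cons, mul_assoc]

theorem moment_eq_one_add :
    P.moment x = 1 + P.expect (P.word x * const x) * ident := by
  have h : P.word x = 1 + P.word x * const x * P.incl ident := by
    have := geom_mul_one_sub (F := const x * P.incl ident) (by simp [ident])
    rw [mul_sub, mul_one, ← mul_assoc, sub_eq_iff_eq_add] at this
    exact this
  rw [OVSpace.moment]
  nth_rw 1 [h]
  rw [map_add, P.expect_mul_incl, P.expect_one]

theorem isAdd_word : IsAdd (P.word x) := by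
  intro l₁ u v l₂
  induction l₁ with
  | nil => simp only [List.nil_append, word_cons, map_add, mul_add, add_mul]
  | cons c l ih => simp only [List.cons_append, word_cons, ih, mul_add]

theorem isAdd_moment : IsAdd (P.moment x) := fun l₁ u v l₂ => by
  simp only [OVSpace.moment, P.expect_apply]
  rw [isAdd_word, map_add]

theorem isAdd_expect_word_mul : IsAdd (P.expect (P.word x * const x)) := fun l₁ u v l₂ => by
  simp only [P.expect_apply, mul_const_apply]
  rw [isAdd_word, add_mul, map_add]

theorem ι_mul_prod_mul_ι (C D : ℕ → B) (n i : ℕ) :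
    P.ι (D i) * (List.ofFn fun t : Fin n => P.ι (C (i + t)) * x * P.ι (D (i + t + 1))).prod *
      P.ι (C (i + n)) = P.ι (D i * C i) * P.word x (seg (fun p => D p * C p) (i + 1) n) := by
  induction n generalizing i with
  | zero => simp [word_nil]
  | succ n ih =>
    have := ih (i + 1)
    have e : (fun t : Fin n => P.ι (C (i + 1 + t)) * x * P.ι (D (i + 1 + t + 1))) =
        fun t : Fin n => P.ι (C (i + t.succ)) * x * P.ι (D (i + t.succ + 1)) := by
      funext t
      simp only [Fin.val_succ, show i + 1 + (t : ℕ) = i + (t + 1) by omega]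
    rw [e] at this
    rw [List.ofFn_succ, List.prod_cons, seg_succ, word_cons, mul_assoc _ (P.ι (D (i + 1) * _)),
      ← mul_assoc x, mul_assoc x, ← this, show i + (n + 1) = i + 1 + n by omega]
    simp [mul_assoc]

theorem φ_prod (C D : ℕ → B) (n : ℕ) :
    D 0 * P.φ (List.ofFn fun t : Fin n => P.ι (C t) * x * P.ι (D (t + 1))).prod * C n =
      D 0 * C 0 * P.moment x (seg (fun p => D p * C p) 1 n) := by
  have := congrArg P.φ (ι_mul_prod_mul_ι (P := P) (x := x) C D n 0)
  simp only [Nat.zero_add] at this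
  rw [P.φ_bimodule, P.φ_left] at this
  exact this

/-- The functions `κ_m`, `m < n`. -/
def OVSpace.truncated (P : OVSpace A B) (n : ℕ) : (m : ℕ) → (Fin m → A) → B :=
  fun m v => if m < n then P.freeCumulant m v else 0

theorem freeCumulant_eq_sub (n : ℕ) (w : Fin (n + 1) → A) :
    P.freeCumulant (n + 1) w = P.φ (List.ofFn w).prod -
      ∑ π ∈ NC (n + 1), P.partitioned (P.truncated (n + 1)) π w := by
  classical
  rw [OVSpace.freeCumulant]
  congr 1
  refine sum_subset (filter_subset _ _) fun π hπ h => ?_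
  have hp : π.parts = {range (n + 1)} := by
    by_contra hne
    exact h (mem_filter.2 ⟨hπ, hne⟩)
  have := P.partitioned_one (P.truncated (n + 1)) π hp w
  rw [OVSpace.truncated, if_neg (lt_irrefl _)] at this
  exact this

theorem partitioned_truncated {m n : ℕ} (hmn : m < n) (π : Finpartition (range m))
    (w : Fin m → A) :
    P.partitioned P.freeCumulant π w = P.partitioned (P.truncated n) π w := by
  refine P.evalTree_congr _ (n := n) (fun k hk => ?_) (fun i j => ?_) 0 m
  · funext v
    simp [OVSpace.truncated, hk]
  · refine lt_of_le_of_lt ?_ hmn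
    refine (card_le_card fun v hv => ?_ : _ ≤ (range m).card).trans_eq (card_range m)
    obtain ⟨V, hV, hv, -⟩ := (mem_legsIn.1 hv).2.2
    exact π.le hV hv

/-- The recursion writes a cumulant of order n + 1 as a moment minus a sum that involves lower
cumulants only. By induction the latter are given by an additive series, so the sum is a tree sum
and satisfies the same kind of functional equation as the moments; in both terms the outer scalars
then factor out. Additivity has to be carried along, as it is what makes the tree sums factor. -/
theorem cumulantSeries_aux (n : ℕ) :
    P.IsBilinearAt x P.freeCumulant (P.cumulantSeries x) n ∧
    ∀ l₁ u v l₂, l₁.length + l₂.length + 1 = n → P.cumulantSeries x (l₁ ++ (u + v) :: l₂) =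
      P.cumulantSeries x (l₁ ++ u :: l₂) + P.cumulantSeries x (l₁ ++ v :: l₂) := by
  induction n using Nat.strong_induction_on with
  | _ n ih =>
    -- A block with k + 1 legs evaluates the series at a word of length k, so cutting off at length
    -- `n` matches the truncation of the cumulants at order `n + 1`.
    set K : WordSeries B B := ⟨fun l => if l.length < n then P.cumulantSeries x l else 0⟩ with hK'
    have hK : IsAdd K := by
      intro l₁ u v l₂
      simp only [hK', List.length_append, List.length_cons]
      split_ifs with h
      · exact (ih (l₁.length + l₂.length + 1) (by omega)).2 l₁ u v l₂ rfl
      · simp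
    have hκ : ∀ k, P.IsBilinearAt x (P.truncated (n + 1)) K k := by
      intro k C D
      simp only [OVSpace.truncated, hK', List.length_ofFn, Nat.succ_lt_succ_iff]
      split_ifs with h
      · exact (ih k h).1 C D
      · simp
    set Φ := P.moment x with hΦ
    set Ψ := treeSeries K with hΨ
    have hΦΨ : ∀ l : List B, l.length < n + 1 → Φ l = Ψ l := by
      intro l hl
      have h1 := φ_prod (P := P) (x := x) (fun _ => 1) (fun p => (1 :: l).getD p 1) l.length
      have h2 := sum_partitioned hκ hK (fun _ => 1) (fun p => (1 :: l).getD p 1) l.length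
      rw [P.moment_eq_sum, sum_congr rfl fun π _ => partitioned_truncated hl π _] at h1
      rw [h1] at h2
      simp only [mul_one, seg_getD] at h2
      simpa using h2
    set R := P.expect (P.word x * const x) - Ψ * comp K (ident * Ψ) with hR
    -- With the outermost scalars equal to 1, the last letter of the word is `D (n + 1)`; both
    -- functional equations end with the factor I, which splits off this letter and leaves `R`.
    have hcum : ∀ C D : ℕ → B, D 0 = 1 → C (n + 1) = 1 →
        P.freeCumulant (n + 1) (fun t => P.ι (C t) * x * P.ι (D (t + 1))) =
        C 0 * R (seg (fun p => D p * C p) 1 n) * D (n + 1) := by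
      intro C D hD hC
      have h1 := φ_prod (P := P) (x := x) C D (n + 1)
      have h2 := sum_partitioned hκ hK C D (n + 1)
      rw [hD, hC, mul_one, one_mul, one_mul] at h1 h2
      rw [freeCumulant_eq_sub, h1, h2, moment_eq_one_add, treeSeries_eq hK, ← hΨ, ← mul_sub,
        WordSeries.add_apply, WordSeries.add_apply, seg_mul_ident, seg_mul_ident, add_comm 1 n, hC,
        hR, WordSeries.sub_apply]
      simp only [mul_one]
      noncomm_ring
    have hKR : ∀ l : List B, l.length = n → P.cumulantSeries x l = R l := by
      rintro l rfl
      have h := hcum (fun _ => 1) (fun p => if p = 0 then 1 else l.getD (p - 1) 1) rfl rfl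
      simp only [mul_one, Nat.add_eq_zero_iff, one_ne_zero, and_false, if_false,
        Nat.add_sub_cancel, one_mul] at h
      have e1 : seg (fun p => if p = 0 then 1 else l.getD (p - 1) 1) 1 l.length = l := by
        refine List.ext_getElem (by simp) fun i h1 h2 => ?_
        simp [seg, h2]
      rw [e1] at h
      have e2 : l.getD l.length 1 = 1 := by simp
      rw [e2, mul_one] at h
      rw [← h]
      change P.freeCumulant _ _ = _
      congr 1
      funext t
      induction t using Fin.lastCases with
      | last => simp
      | cast t => simp
    refine ⟨fun C D => ?_, fun l₁ u v l₂ hl => ?_⟩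
    · have h := hcum (fun p => if h : p < n + 1 then C ⟨p, h⟩ else 1)
        (fun p => if h : p ≠ 0 ∧ p - 1 < n + 1 then D ⟨p - 1, by omega⟩ else 1) (by simp) (by simp)
      have e1 : seg (fun p => (if h : p ≠ 0 ∧ p - 1 < n + 1 then D ⟨p - 1, by omega⟩ else 1) *
          if h : p < n + 1 then C ⟨p, h⟩ else 1) 1 n =
          List.ofFn fun t : Fin n => D t.castSucc * C t.succ := by
        refine List.ext_getElem (by simp) fun i h1 h2 => ?_
        have hi : i < n := by simpa using h1
        have h3 : i < n + 1 := by omega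
        have h4 : 1 + i < n + 1 := by omega
        simp only [seg, List.getElem_map, List.getElem_range', List.getElem_ofFn]
        rw [dif_pos ⟨by omega, by omega⟩, dif_pos (by omega)]
        congr 2 <;> (apply Fin.ext; simp; try omega)
      rw [e1, ← hKR _ (by simp)] at h
      have e2 : (fun t : Fin (n + 1) => P.ι (C t) * x * P.ι (D t)) = fun t : Fin (n + 1) =>
          P.ι (if h : (t : ℕ) < n + 1 then C ⟨t, h⟩ else 1) * x *
          P.ι (if h : (t : ℕ) + 1 ≠ 0 ∧ (t : ℕ) + 1 - 1 < n + 1 then D ⟨t + 1 - 1, by omega⟩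
            else 1) := by
        funext t
        rw [dif_pos t.2, dif_pos ⟨by omega, by have := t.2; omega⟩]
        rfl
      rw [e2, h, dif_pos (by omega), dif_pos ⟨by omega, by omega⟩]
      rfl
    -- On words of length `n` only short words enter `Ψ`, where it agrees with `Φ`; and additivity
    -- of the moment series is evident.
    · have hRadd : IsAdd (P.expect (P.word x * const x) - Φ * comp K (ident * Φ)) :=
        isAdd_expect_word_mul.sub (isAdd_moment.mul (hK.comp (isAdd_letter.mul isAdd_moment)))
      have hRR : ∀ l : List B, l.length = n → P.cumulantSeries x l =
          (P.expect (P.word x * const x) - Φ * comp K (ident * Φ)) l := by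
        rintro l rfl
        rw [hKR l rfl, hR, WordSeries.sub_apply, WordSeries.sub_apply]
        congr 1
        refine mul_congr fun l₁ l₂ hl => ?_
        have hlen := congrArg List.length hl
        rw [List.length_append] at hlen
        rw [hΦΨ l₁ (by omega)]
        congr 1
        refine comp_congr (fun _ _ => rfl) fun l' hl' => ?_
        refine mul_congr fun l₃ l₄ hl3 => ?_
        have hlen' := congrArg List.length hl3
        rw [List.length_append] at hlen'
        rw [hΦΨ l₄ (by omega)]
      rw [hRR _ (by simp; omega), hRR _ (by simp; omega), hRR _ (by simp; omega)]
      exact hRadd l₁ u v l₂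

theorem isBilinearAt_cumulantSeries (k : ℕ) :
    P.IsBilinearAt x P.freeCumulant (P.cumulantSeries x) k := (cumulantSeries_aux k).1

theorem isAdd_cumulantSeries : IsAdd (P.cumulantSeries x) := fun l₁ u v l₂ =>
  (cumulantSeries_aux _).2 l₁ u v l₂ rfl

/-- The moment-cumulant relations, in terms of the series. -/
theorem moment_eq : P.moment x =
    1 + P.moment x * comp (P.cumulantSeries x) (ident * P.moment x) * ident := by
  have h : P.moment x = treeSeries (P.cumulantSeries x) := by
    refine ext' fun l => ?_
    have h1 := φ_prod (P := P) (x := x) (fun _ => 1) (fun p => (1 :: l).getD p 1) l.length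
    have h2 := sum_partitioned isBilinearAt_cumulantSeries (isAdd_cumulantSeries (P := P) (x := x))
      (fun _ => 1) (fun p => (1 :: l).getD p 1) l.length
    rw [P.moment_eq_sum, h2] at h1
    simp only [mul_one, seg_getD] at h1
    simpa using h1.symm
  rw [h]
  exact treeSeries_eq isAdd_cumulantSeries

theorem expect_resolvent_cumulantSeries : P.expect (P.resolvent (P.cumulantSeries x) x) = 1 :=
  expect_resolvent moment_eq

end CumulantSeries

end FreeProd

namespace FreeProd

open WordSeries

/-! ### The trees of a partition together with its Kreweras complement -/

/-- The block contains the first element, and its elements have the same parity. -/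
def spanLegs : ℕ → (k : ℕ) → (Fin (k + 1) → ℕ) → Prop :=
  fun i _ legs => legs 0 = i ∧ ∀ s, legs s % 2 = i % 2

section Interleave

variable {N : ℕ}

theorem related_interleave_even {π σ : Finpartition (range N)} {u v : ℕ} :
    Related (interleave π σ) (2 * u) (2 * v) ↔ Related π.parts u v := by
  constructor
  · rintro ⟨V, hV, hu, hv⟩
    simp only [interleave, mem_union, mem_image] at hV
    rcases hV with ⟨V, hV, rfl⟩ | ⟨V, hV, rfl⟩
    · obtain ⟨u', hu', h1⟩ := mem_image.1 hu
      obtain ⟨v', hv', h2⟩ := mem_image.1 hv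
      obtain rfl : u' = u := by omega
      obtain rfl : v' = v := by omega
      exact ⟨V, hV, hu', hv'⟩
    · obtain ⟨u', hu', h1⟩ := mem_image.1 hu
      omega
  · rintro ⟨V, hV, hu, hv⟩
    exact ⟨_, mem_union_left _ (mem_image_of_mem _ hV), mem_image_of_mem (fun i => 2 * i) hu,
      mem_image_of_mem (fun i => 2 * i) hv⟩

theorem related_interleave_odd {π σ : Finpartition (range N)} {u v : ℕ} :
    Related (interleave π σ) (2 * u + 1) (2 * v + 1) ↔ Related σ.parts u v := by
  constructor
  · rintro ⟨V, hV, hu, hv⟩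
    simp only [interleave, mem_union, mem_image] at hV
    rcases hV with ⟨V, hV, rfl⟩ | ⟨V, hV, rfl⟩
    · obtain ⟨u', hu', h1⟩ := mem_image.1 hu
      omega
    · obtain ⟨u', hu', h1⟩ := mem_image.1 hu
      obtain ⟨v', hv', h2⟩ := mem_image.1 hv
      obtain rfl : u' = u := by omega
      obtain rfl : v' = v := by omega
      exact ⟨V, hV, hu', hv'⟩
  · rintro ⟨V, hV, hu, hv⟩
    exact ⟨_, mem_union_right _ (mem_image_of_mem _ hV),
      mem_image_of_mem (fun i => 2 * i + 1) hu, mem_image_of_mem (fun i => 2 * i + 1) hv⟩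

theorem related_interleave_parity {π σ : Finpartition (range N)} {u v : ℕ}
    (h : Related (interleave π σ) u v) : u % 2 = v % 2 := by
  obtain ⟨V, hV, hu, hv⟩ := h
  simp only [interleave, mem_union, mem_image] at hV
  rcases hV with ⟨V, hV, rfl⟩ | ⟨V, hV, rfl⟩ <;>
    obtain ⟨u', -, rfl⟩ := mem_image.1 hu <;> obtain ⟨v', -, rfl⟩ := mem_image.1 hv <;> omega

theorem isDisjoint_interleave (π σ : Finpartition (range N)) : IsDisjoint (interleave π σ) := by
  intro V hV W hW v hvV hvW
  simp only [interleave, mem_union, mem_image] at hV hW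
  rcases hV with ⟨V, hV, rfl⟩ | ⟨V, hV, rfl⟩ <;> rcases hW with ⟨W, hW, rfl⟩ | ⟨W, hW, rfl⟩ <;>
    obtain ⟨x, hx, rfl⟩ := mem_image.1 hvV <;> obtain ⟨y, hy, h⟩ := mem_image.1 hvW
  · obtain rfl : y = x := by omega
    rw [π.eq_of_mem_parts hV hW hx hy]
  · omega
  · omega
  · obtain rfl : y = x := by omega
    rw [σ.eq_of_mem_parts hV hW hx hy]

theorem related_interleave_self (π σ : Finpartition (range N)) {v : ℕ} (hv : v < 2 * N) :
    Related (interleave π σ) v v := by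
  rcases Nat.even_or_odd' v with ⟨u, rfl | rfl⟩
  · exact related_interleave_even.2 (related_parts_self π (by omega))
  · exact related_interleave_odd.2 (related_parts_self σ (by omega))

theorem lt_of_related_parts {π : Finpartition (range N)} {u v : ℕ} (h : Related π.parts u v) :
    u < N ∧ v < N := by
  obtain ⟨V, hV, hu, hv⟩ := h
  exact ⟨mem_range.1 (π.le hV hu), mem_range.1 (π.le hV hv)⟩

theorem related_kreweras {π : Finpartition (range N)} {i j : ℕ} :
    Related (kreweras π).parts i j ↔ i < N ∧ j < N ∧
      ∀ u v, Related π.parts u v → ((i < u ↔ j < u) ↔ (i < v ↔ j < v)) := by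
  classical
  rw [related_parts_iff]
  unfold kreweras
  rw [Finpartition.mem_part_ofSetSetoid_iff_rel, mem_range, mem_range]
  constructor
  · rintro ⟨⟨h1, h2, h3⟩, -⟩
    exact ⟨h1, h2, fun u v ⟨V, hV, hu, hv⟩ => h3 V hV u hu v hv⟩
  · rintro ⟨h1, h2, h3⟩
    exact ⟨⟨h1, h2, fun V hV u hu v hv => h3 u v ⟨V, hV, hu, hv⟩⟩, h1⟩

/-- Between two successive elements of a block, the first and the last element share a block. -/
theorem related_between {π : Finpartition (range N)} (hπ : IsNonCrossing π.parts) {x y : ℕ}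
    (hxy : x < y) (h : Related (interleave π (kreweras π)) x y)
    (hz : ∀ z, x < z → z < y → ¬ Related (interleave π (kreweras π)) x z) :
    Related (interleave π (kreweras π)) (x + 1) (y - 1) := by
  have hpar := related_interleave_parity h
  have hd := isDisjoint_parts π
  rcases Nat.even_or_odd' x with ⟨u, rfl | rfl⟩
  · obtain ⟨v, rfl⟩ : ∃ v, y = 2 * v := ⟨y / 2, by omega⟩
    rw [related_interleave_even] at h
    have hlt := lt_of_related_parts h
    rw [show 2 * v - 1 = 2 * (v - 1) + 1 by omega, related_interleave_odd, related_kreweras]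
    refine ⟨hlt.1, by omega, ?_⟩
    -- A block with elements both strictly between `u` and `v` and elsewhere would cross the block
    -- of `u` and `v` or be equal to it; the latter contradicts that the two are successive.
    have key : ∀ s t, Related π.parts s t → u < s → s < v → ¬ (t ≤ u ∨ v ≤ t) := by
      intro s t hst h1 h2 h3
      have hus : ¬ Related π.parts u s := fun h =>
        hz (2 * s) (by omega) (by omega) (related_interleave_even.2 h)
      rcases h3 with h3 | h3
      · rcases h3.eq_or_lt with rfl | h3
        · exact hus hst.symm
        · exact hus ((hπ.related h3 h1 h2 hst.symm h).symm.trans hd hst.symm)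
      · rcases h3.eq_or_lt with rfl | h3
        · exact hus (h.trans hd hst.symm)
        · exact hus (hπ.related h1 h2 h3 h hst)
    intro s t hst
    have h1 := key s t hst
    have h2 := key t s hst.symm
    omega
  · obtain ⟨j, rfl⟩ : ∃ j, y = 2 * j + 1 := ⟨y / 2, by omega⟩
    rw [related_interleave_odd, related_kreweras] at h
    obtain ⟨hu, hj, h⟩ := h
    rw [show 2 * j + 1 - 1 = 2 * j by omega, show 2 * u + 1 + 1 = 2 * (u + 1) by omega,
      related_interleave_even]
    classical
    have hex : ∃ m, Related π.parts m j := ⟨j, related_parts_self π hj⟩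
    -- Let `m` be the first element of the black block of `j`. If `u + 1 < m`, then no block leaves
    -- `[m, j]`, so the blue element after `m - 1` lies in the complement block of `u`, strictly
    -- between two successive elements. Hence `m = u + 1`.
    set m := Nat.find hex with hm'
    have hm : Related π.parts m j := Nat.find_spec hex
    have hmin : ∀ t, Related π.parts t j → m ≤ t := fun t ht => Nat.find_min' hex ht
    have hmj := hmin j (related_parts_self π hj)
    have hle : ∀ t, Related π.parts t j → t ≤ j := by
      intro t ht
      have := h t j ht
      omega
    have hum := h m j hm
    rcases (show u + 1 ≤ m by omega).eq_or_lt with he | hlt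
    · rwa [he]
    · exfalso
      refine hz (2 * (m - 1) + 1) (by omega) (by omega) ?_
      rw [related_interleave_odd, related_kreweras]
      refine ⟨hu, by omega, ?_⟩
      have key : ∀ s t, Related π.parts s t → m ≤ s → s ≤ j → ¬ (t < m ∨ j < t) := by
        intro s t hst h1 h2 h3
        have hsj : ¬ Related π.parts s j := by
          intro hs
          have := hmin t (hst.symm.trans hd hs)
          have := hle t (hst.symm.trans hd hs)
          omega
        rcases h1.eq_or_lt with rfl | h1
        · exact hsj hm
        rcases h2.eq_or_lt with rfl | h2
        · exact hsj (related_parts_self π hj)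
        rcases h3 with h3 | h3
        · have := hmin t ((hπ.related h3 h1 h2 hst.symm hm).trans hd hm)
          omega
        · exact hsj ((hπ.related h1 h2 h3 hm hst).symm.trans hd hm)
      intro s t hst
      have h1 := h s t hst
      have h2 := key s t hst
      have h3 := key t s hst.symm
      omega

/-- The spanning property is inherited: a root containing both ends leaves its front and back gaps
empty, and `related_between` says that each nonempty inner gap is spanned by one block again. -/
theorem treeMonomial_interleave_mem {π : Finpartition (range N)} (hπ : IsNonCrossing π.parts)
    {m i j : ℕ} (hm : j - i ≤ m) (hj : j ≤ 2 * N)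
    (h : i < j → Related (interleave π (kreweras π)) i (j - 1)) :
    treeMonomial (interleave π (kreweras π)) i j ∈ trees spanLegs m i j := by
  set F := interleave π (kreweras π) with hF
  induction m generalizing i j with
  | zero => simp [trees, treeMonomial_of_le F (show j ≤ i by omega)]
  | succ m ih =>
    rcases Nat.lt_or_ge i j with hij | hij
    · obtain ⟨k, legs, hl, hr, he⟩ := exists_treeMonomial_eq_node hij
        (related_interleave_self π (kreweras π) (v := j - 1) (by omega))
      rw [he, mem_trees hij]
      have hrel := h hij
      have h0 : legs 0 = i := by
        obtain ⟨s, hs⟩ := (hr i).2 ⟨le_rfl, hij, hrel⟩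
        have h1 := hl.mono.monotone (Fin.zero_le s)
        have h2 := hl.le
        omega
      have hpar : ∀ s, legs s % 2 = i % 2 := fun s => by
        have h1 := related_interleave_parity ((hr _).1 ⟨s, rfl⟩).2.2
        have h2 := related_interleave_parity hrel
        omega
      refine ⟨k, legs, _, rfl, hl, ⟨h0, hpar⟩, fun t => ?_⟩
      refine ih (by have := hl.gap_lt t; omega) ((hl.gapR_le t).trans hj) ?_
      intro hgap
      induction t using Fin.cases with
      | zero => simp [h0] at hgap
      | succ t =>
        induction t using Fin.lastCases with
        | last =>
          rw [Fin.succ_last, gapL_last, gapR_last] at hgap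
          have := hl.last
          omega
        | cast s =>
          rw [gapL_succ, Fin.succ_castSucc, gapR_castSucc] at hgap ⊢
          have e1 := ((hr _).1 ⟨s.castSucc, rfl⟩).2.2
          have e2 := ((hr _).1 ⟨s.succ, rfl⟩).2.2
          have hd := isDisjoint_interleave π (kreweras π)
          refine related_between hπ (by omega) (e1.trans hd e2.symm) fun z hz1 hz2 hz => ?_
          have hzr : Related F z (j - 1) := hz.symm.trans hd e1
          have h3 := hl.le_legs s.castSucc
          have h4 := hl.legs_lt s.succ
          obtain ⟨u, hu⟩ := (hr z).2 ⟨by omega, by omega, hzr⟩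
          refine hl.notMem_gap u s.castSucc.succ ?_
          rw [gapL_succ, Fin.succ_castSucc, gapR_castSucc]
          omega
    · rw [trees_of_le hij, treeMonomial_of_le _ hij, mem_singleton]

end Interleave

/-! ### Parity and separation in trees with spanning blocks -/

section Span

theorem blocks_parity {m i j : ℕ} (hm : j - i ≤ m) {T : GapTree}
    (hT : T ∈ trees spanLegs m i j) {u v : ℕ} (h : Related (blocks T) u v) : u % 2 = v % 2 := by
  revert u v
  refine trees_induction (C := fun _ _ T => ∀ {u v : ℕ}, Related (blocks T) u v → u % 2 = v % 2)
    ?_ ?_ hm hT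
  · rintro i j - u v ⟨V, hV, -⟩
    simp [blocks] at hV
  · rintro i j k legs child hl hs - ih u v ⟨V, hV, hu, hv⟩
    rcases mem_blocks_node.1 hV with rfl | ⟨t, hV⟩
    · obtain ⟨s, -, rfl⟩ := mem_image.1 hu
      obtain ⟨s', -, rfl⟩ := mem_image.1 hv
      rw [hs.2, hs.2]
    · exact ih t ⟨V, hV, hu, hv⟩

theorem related_blocks_ends {m i j : ℕ} (hm : j - i ≤ m) (hij : i < j) {T : GapTree}
    (hT : T ∈ trees spanLegs m i j) : Related (blocks T) i (j - 1) := by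
  obtain ⟨m, rfl⟩ : ∃ m', m = m' + 1 := ⟨m - 1, by omega⟩
  obtain ⟨k, legs, child, rfl, hl, hs, hc⟩ := (mem_trees hij).1 hT
  refine ⟨_, mem_blocks_node.2 (Or.inl rfl), mem_image.2 ⟨0, mem_univ _, hs.1⟩,
    mem_image.2 ⟨Fin.last k, mem_univ _, ?_⟩⟩
  have := hl.last
  omega

/-- Odd elements in different blocks are separated by a block of even elements. -/
theorem exists_separating {m i j : ℕ} (hm : j - i ≤ m) {T : GapTree}
    (hT : T ∈ trees spanLegs m i j) {x y : ℕ} (hx : i ≤ x) (hxy : x < y) (hy : y < j)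
    (hxo : x % 2 = 1) (hyo : y % 2 = 1) (h : ¬ Related (blocks T) x y) :
    ∃ s t, Related (blocks T) s t ∧ s % 2 = 0 ∧ x < s ∧ s < y ∧ (t < x ∨ y < t) := by
  revert x y
  refine trees_induction (C := fun i j T => ∀ {x y : ℕ}, i ≤ x → x < y → y < j → x % 2 = 1 →
    y % 2 = 1 → ¬ Related (blocks T) x y →
    ∃ s t, Related (blocks T) s t ∧ s % 2 = 0 ∧ x < s ∧ s < y ∧ (t < x ∨ y < t)) ?_ ?_ hm hT
  · intro i j hij x y hx hxy hy
    omega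
  · intro i j k legs child hl hs hc ih x y hx hxy hy hxo hyo h
    obtain ⟨m, hm, hc⟩ := hc
    have hmono : ∀ t u v, Related (blocks (child t)) u v →
        Related (blocks (.node k legs child)) u v := by
      rintro t u v ⟨V, hV, huv⟩
      exact ⟨V, mem_blocks_node.2 (Or.inr ⟨t, hV⟩), huv⟩
    have hlegs : ∀ s t, Related (blocks (.node k legs child)) (legs s) (legs t) := fun s t =>
      ⟨_, mem_blocks_node.2 (Or.inl rfl), by simp, by simp⟩
    have same : ∀ t, gapL i legs t ≤ x → y < gapR legs j t →
        ∃ s t, Related (blocks (.node k legs child)) s t ∧ s % 2 = 0 ∧ x < s ∧ s < y ∧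
          (t < x ∨ y < t) := by
      intro t h1 h2
      obtain ⟨s, t', h3, h4⟩ := ih t h1 hxy h2 hxo hyo fun h' => h (hmono t _ _ h')
      exact ⟨s, t', hmono t _ _ h3, h4⟩
    -- An even root is itself the separating block for odd points in different gaps. Under an odd
    -- root every inner gap is spanned by an even block, whose two ends separate the points of the
    -- gap from those outside.
    rcases Nat.mod_two_eq_zero_or_one i with hi | hi
    · have hne : ∀ z, z % 2 = 1 → ∀ s, legs s ≠ z := fun z hz s hsz => by
        have := hs.2 s
        omega
      obtain ⟨t, h1, h2⟩ := hl.exists_gap hx (by omega) (hne x hxo)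
      obtain ⟨t', h3, h4⟩ := hl.exists_gap (by omega) hy (hne y hyo)
      rcases lt_trichotomy t t' with htt | rfl | htt
      · obtain ⟨s, h5, h6⟩ := hl.exists_between htt
        refine ⟨legs s, legs 0, hlegs s 0, by rw [hs.2, hi], by omega, by omega, Or.inl ?_⟩
        rw [hs.1]
        omega
      · exact same t h1 h4
      · obtain ⟨s, h5, h6⟩ := hl.exists_between htt
        omega
    · have hgap : ∀ z, i ≤ z → z < j → z % 2 = 1 → (∀ s, legs s ≠ z) →
          ∃ (t : Fin (k + 2)) (p q : ℕ), gapL i legs t = p + 1 ∧ gapR legs j t = q ∧ p < z ∧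
            z < q ∧ p % 2 = 1 ∧ q % 2 = 1 ∧
            Related (blocks (.node k legs child)) (p + 1) (q - 1) := by
        intro z hz1 hz2 hzo hz
        obtain ⟨t, h1, h2⟩ := hl.exists_gap hz1 hz2 hz
        induction t using Fin.cases with
        | zero =>
          rw [gapL_zero] at h1
          rw [gapR_zero, hs.1] at h2
          omega
        | succ t =>
          induction t using Fin.lastCases with
          | last =>
            rw [Fin.succ_last, gapL_last] at h1
            have := hl.last
            omega
          | cast s =>
            have hend := related_blocks_ends (m := m)
              (by have := hl.gap_lt s.castSucc.succ; omega) (by omega) (hc s.castSucc.succ)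
            have hR : gapR legs j s.castSucc.succ = legs s.succ := by
              rw [Fin.succ_castSucc, gapR_castSucc]
            rw [hR] at h2 hend
            rw [gapL_succ] at h1 hend
            exact ⟨s.castSucc.succ, legs s.castSucc, legs s.succ, gapL_succ _, hR, by omega, h2,
              by rw [hs.2, hi], by rw [hs.2, hi], hmono _ _ _ hend⟩
      by_cases hyl : ∀ s, legs s ≠ y
      · obtain ⟨t, p, q, h1, h2, h3, h4, h5, h6, h7⟩ := hgap y (by omega) hy hyo hyl
        by_cases hxp : p < x
        · exact same t (by omega) (by omega)
        · exact ⟨p + 1, q - 1, h7, by omega, by omega, by omega, Or.inr (by omega)⟩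
      · by_cases hxl : ∀ s, legs s ≠ x
        · obtain ⟨t, p, q, h1, h2, h3, h4, h5, h6, h7⟩ := hgap x hx (by omega) hxo hxl
          by_cases hyq : y < q
          · exact same t (by omega) (by omega)
          · exact ⟨q - 1, p + 1, h7.symm, by omega, by omega, by omega, Or.inl (by omega)⟩
        · push Not at hyl hxl
          obtain ⟨s, rfl⟩ := hxl
          obtain ⟨s', rfl⟩ := hyl
          exact absurd (hlegs s s') h

end Span

/-! ### Irreducible partitions and spanning trees -/

section Irreducible

variable {n : ℕ}

theorem mem_NCirr {π : Finpartition (range (n + 1))} :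
    π ∈ NCirr (n + 1) ↔ IsNonCrossing π.parts ∧ Related π.parts 0 n := by
  simp [NCirr, NC, Related]

/-- A sum over irreducible non-crossing partitions is a sum over trees. -/
theorem sum_NCirr_eq_sum_trees {M : Type*} [AddCommMonoid M] (g : GapTree → M) :
    ∑ π ∈ NCirr (n + 1), g (treeMonomial (interleave π (kreweras π)) 0 (2 * n + 1)) =
      ∑ T ∈ trees spanLegs (2 * n + 1) 0 (2 * n + 1), g T := by
  have hcov : ∀ π : Finpartition (range (n + 1)), ∀ v, 0 ≤ v → v < 2 * n + 1 →
      Related (interleave π (kreweras π)) v v :=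
    fun π v _ hv => related_interleave_self π _ (by omega)
  refine sum_nbij (fun π => treeMonomial (interleave π (kreweras π)) 0 (2 * n + 1))
    ?_ ?_ ?_ (fun _ _ => rfl)
  · intro π hπ
    obtain ⟨h1, h2⟩ := mem_NCirr.1 hπ
    exact treeMonomial_interleave_mem h1 (by omega) (by omega) fun _ =>
      (related_interleave_even (u := 0) (v := n)).2 h2
  · intro π hπ π' hπ' h
    have h1 := (mem_NCirr.1 (mem_coe.1 hπ)).1
    have h1' := (mem_NCirr.1 (mem_coe.1 hπ')).1
    refine partition_ext fun u v hu hv => ?_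
    rw [← related_interleave_even (σ := kreweras π), ← related_interleave_even (σ := kreweras π'),
      ← related_blocks_treeMonomial (hcov π) (isDisjoint_interleave _ _)
        (kreweras_isGreatest π h1).1 (Nat.zero_le _) (by omega) (Nat.zero_le _) (by omega),
      ← related_blocks_treeMonomial (hcov π') (isDisjoint_interleave _ _)
        (kreweras_isGreatest π' h1').1 (Nat.zero_le _) (by omega) (Nat.zero_le _) (by omega)]
    simp only at h
    rw [h]
  · intro T hT
    have hT' := mem_coe.1 hT
    have hm : 2 * n + 1 - 0 ≤ 2 * n + 1 := by omega
    have hp := isNCPartition_blocks hm hT'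
    have hpar : ∀ {u v}, Related (blocks T) u v → u % 2 = v % 2 := fun h => blocks_parity hm hT' h
    obtain ⟨π, hπ⟩ := exists_partition (n := n + 1)
      { r := fun u v => u = v ∨ Related (blocks T) (2 * u) (2 * v)
        iseqv := ⟨fun u => Or.inl rfl, fun {u v} h => h.imp Eq.symm Related.symm,
            fun {u v w} h h' => by
          rcases h with rfl | h
          · exact h'
          · rcases h' with rfl | h'
            · exact Or.inr h
            · exact Or.inr (h.trans hp.disjoint h')⟩ }
    have hπ' : ∀ u v, u < n + 1 → v < n + 1 →
        (Related π.parts u v ↔ Related (blocks T) (2 * u) (2 * v)) := by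
      intro u v hu hv
      rw [hπ u v hu hv]
      refine ⟨?_, Or.inr⟩
      rintro (rfl | h)
      · exact hp.cover _ (Nat.zero_le _) (by omega)
      · exact h
    have hnc : IsNonCrossing π.parts := by
      refine (isDisjoint_parts π).isNonCrossing fun a b c d hab hbc hcd h1 h2 => ?_
      have h3 := lt_of_related_parts h1
      have h4 := lt_of_related_parts h2
      rw [hπ' _ _ h3.1 h3.2] at h1
      rw [hπ' _ _ h4.1 h4.2] at h2
      rw [hπ' _ _ h3.1 h4.1]
      exact hp.nonCrossing.related (by omega) (by omega) (by omega) h1 h2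
    -- The odd blocks of the tree must be those of the Kreweras complement. Unrelated odd elements
    -- are separated by an even block (`exists_separating`); related ones cannot be, since
    -- non-crossing would then relate an odd to an even element.
    have hodd : ∀ i j, i < j → j < n → (Related (kreweras π).parts i j ↔
        Related (blocks T) (2 * i + 1) (2 * j + 1)) := by
      intro i j hij hj
      rw [related_kreweras]
      constructor
      · rintro ⟨-, -, h⟩
        by_contra hcon
        obtain ⟨s, t, h1, h2, h3, h4, h5⟩ := exists_separating hm hT' (Nat.zero_le _)
          (show 2 * i + 1 < 2 * j + 1 by omega) (by omega) (by omega) (by omega) hcon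
        have h6 := hpar h1
        have h7 : t < 2 * n + 1 := by
          obtain ⟨V, hV, -, ht⟩ := h1
          exact ((hp.mem V hV).2 t ht).2
        obtain ⟨s, rfl⟩ : ∃ s', s = 2 * s' := ⟨s / 2, by omega⟩
        obtain ⟨t, rfl⟩ : ∃ t', t = 2 * t' := ⟨t / 2, by omega⟩
        have := h s t ((hπ' s t (by omega) (by omega)).2 h1)
        omega
      · intro h
        refine ⟨by omega, by omega, ?_⟩
        have key : ∀ s t, Related π.parts s t → i < s → s ≤ j → ¬ (t ≤ i ∨ j < t) := by
          intro s t hst h1 h2 h3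
          have hlt := lt_of_related_parts hst
          rw [hπ' s t hlt.1 hlt.2] at hst
          rcases h3 with h3 | h3
          · have := hpar (hp.nonCrossing.related (show 2 * t < 2 * i + 1 by omega)
              (show 2 * i + 1 < 2 * s by omega) (show 2 * s < 2 * j + 1 by omega) hst.symm h)
            omega
          · have := hpar (hp.nonCrossing.related (show 2 * i + 1 < 2 * s by omega)
              (show 2 * s < 2 * j + 1 by omega) (show 2 * j + 1 < 2 * t by omega) h hst)
            omega
        intro s t hst
        have h1 := key s t hst
        have h2 := key t s hst.symm
        omega
    refine ⟨π, mem_coe.2 (mem_NCirr.2 ⟨hnc, ?_⟩), ?_⟩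
    · rw [hπ' 0 n (by omega) (by omega)]
      exact related_blocks_ends hm (by omega) hT'
    · simp only
      rw [treeMonomial_congr (hcov π) (F' := blocks T), treeMonomial_blocks hm hT']
      intro u v _ hu _ hv
      rcases Nat.even_or_odd' u with ⟨u, rfl | rfl⟩ <;>
        rcases Nat.even_or_odd' v with ⟨v, rfl | rfl⟩
      · rw [related_interleave_even, hπ' u v (by omega) (by omega)]
      · exact iff_of_false (fun h => by have := related_interleave_parity h; omega)
          (fun h => by have := hpar h; omega)
      · exact iff_of_false (fun h => by have := related_interleave_parity h; omega)
          (fun h => by have := hpar h; omega)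
      · rw [related_interleave_odd]
        rcases lt_trichotomy u v with h | rfl | h
        · exact hodd u v h (by omega)
        · exact iff_of_true (related_parts_self _ (by omega)) (hp.cover _ (Nat.zero_le _) hu)
        · have := hodd v u h (by omega)
          exact ⟨fun h => (this.1 h.symm).symm, fun h => (this.2 h.symm).symm⟩

/-- The black block through `0` and `n` separates the last blue element from all others. So the root
is a singleton, with everything else in its front gap. -/
theorem linked_eq {π : Finpartition (range (n + 1))} (hπ : π ∈ NCirr (n + 1)) :
    linked π = .outer 0 fun t => eraseLeaves
      (if t = 0 then treeMonomial (interleave π (kreweras π)) 0 (2 * n + 1) else .leaf) := by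
  have h0 := (mem_NCirr.1 hπ).2
  rw [linked, treeMonomial_eq_node (k := 0) (legs := fun _ => 2 * n + 1)]
  · rw [linkedOfTree]
    congr 1
    funext t
    congr 1
    induction t using Fin.cases with
    | zero => simp
    | succ t =>
      obtain rfl : t = 0 := Subsingleton.elim _ _
      rw [if_neg (Fin.succ_ne_zero _), gapL_succ]
      exact treeMonomial_of_le _ (by change 2 * (n + 1) ≤ _; omega)
  · exact fun s t h => absurd h (by have := s.2; have := t.2; rw [Fin.lt_def]; omega)
  · intro v
    rw [mem_legsIn, show 2 * (n + 1) - 1 = 2 * n + 1 by omega]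
    constructor
    · rintro ⟨-, h1, h2⟩
      refine ⟨0, ?_⟩
      have hpar := related_interleave_parity h2
      obtain ⟨i, rfl⟩ : ∃ i, v = 2 * i + 1 := ⟨v / 2, by omega⟩
      rw [related_interleave_odd, related_kreweras] at h2
      have := h2.2.2 0 n h0
      omega
    · rintro ⟨-, rfl⟩
      exact ⟨Nat.zero_le _, by omega, related_interleave_self _ _ (by omega)⟩

end Irreducible

end FreeProd

namespace FreeProd

open WordSeries

/-! ### Sums over the trees whose blocks span their intervals -/

/-- With the parity and the first leg prescribed, halving the remaining legs turns a root block into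
an arbitrary list of cuts. -/
theorem sum_legSet_span {M : Type*} [AddCommMonoid M] (q : ℕ) {r : ℕ} (hr : r < 2) (n : ℕ)
    (G : List ℕ → M) :
    ∑ p ∈ legSet spanLegs (2 * q + r) (2 * q + r + (2 * n + 1)),
      G (List.ofFn fun t : Fin p.1 => p.2 t.succ / 2) = ((cutsFrom q n).map G).sum := by
  have hcut : ∀ {k : ℕ} (e : Fin (k + 1) → ℕ), e 0 = q →
      (List.ofFn (fun t : Fin k => e t.succ) ∈ cutsFrom q n ↔ IsLegs q (q + n + 1) e) := by
    intro k e h0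
    rw [mem_cutsFrom, ← ofFn_mem_cuts (by omega), List.ofFn_succ, h0,
      show q + n + 1 - 1 - q = n by omega]
  have hhalf : ∀ p ∈ legSet spanLegs (2 * q + r) (2 * q + r + (2 * n + 1)),
      ∀ t, p.2 t = 2 * (p.2 t / 2) + r := by
    intro p hp t
    have := (mem_legSet.1 hp).2.2 t
    omega
  rw [← List.sum_toFinset _ (nodup_cutsFrom _ _)]
  refine sum_nbij (fun p => List.ofFn fun t : Fin p.1 => p.2 t.succ / 2) ?_ ?_ ?_ fun _ _ => rfl
  · intro p hp
    have hh := hhalf p hp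
    obtain ⟨hl, h0, -⟩ := mem_legSet.1 hp
    refine List.mem_toFinset.2 ((hcut (fun t => p.2 t / 2) (by omega)).2 ⟨?_, by omega, ?_⟩)
    · intro s t hst
      have h1 := hl.mono hst
      have h2 := hh s
      have h3 := hh t
      change p.2 s / 2 < p.2 t / 2
      omega
    · have h1 := hl.last
      have h2 := hh (Fin.last _)
      omega
  · intro p hp p' hp' h
    have hh := hhalf p (mem_coe.1 hp)
    have hh' := hhalf p' (mem_coe.1 hp')
    obtain ⟨k, e⟩ := p
    obtain ⟨k', e'⟩ := p'
    obtain rfl : k = k' := by simpa using congrArg List.length h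
    have h0 := (mem_legSet.1 (mem_coe.1 hp)).2.1
    have h0' := (mem_legSet.1 (mem_coe.1 hp')).2.1
    have h1 := List.ofFn_injective h
    congr 1
    funext t
    induction t using Fin.cases with
    | zero => exact h0.trans h0'.symm
    | succ t =>
      have h2 := congrFun h1 t
      have h3 := hh t.succ
      have h4 := hh' t.succ
      simp only at *
      omega
  · intro l hl
    have hl' := List.mem_toFinset.1 (mem_coe.1 hl)
    have he : List.ofFn (fun t : Fin l.length => (q :: l).get t.succ) = l := List.ofFn_get l
    have hL := (hcut (fun t : Fin (l.length + 1) => (q :: l).get t) rfl).1 (by rwa [he])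
    refine ⟨⟨l.length, fun t => 2 * (q :: l).get t + r⟩, ?_, ?_⟩
    · refine mem_coe.2 (mem_legSet.2 ⟨⟨fun s t hst => ?_, ?_, ?_⟩, ?_, fun t => ?_⟩)
      · have : (q :: l).get s < (q :: l).get t := hL.mono hst
        simp only
        omega
      · have : q ≤ (q :: l).get 0 := hL.le
        simp only
        omega
      · have : (q :: l).get (Fin.last _) + 1 = q + n + 1 := hL.last
        simp only
        omega
      · simp
      · simp only
        omega
    · conv_rhs => rw [← he]
      simp only
      congr 1
      funext t
      omega

section SpanSeries

variable {B : Type*} [Ring B] (Ka Kb : WordSeries B B)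

/-- The series used at the blocks starting at `s`. -/
def parityKernel (s : ℕ) : WordSeries B B := if Even s then Ka else Kb

/-- The leaf at the even position `2 p` has the value `y p`, and the ones at odd positions have the
value `1`. -/
def parityLeaf (y : ℕ → B) (p : ℕ) : B := if Even p then y (p / 2) else 1

@[simp] theorem parityLeaf_even (y : ℕ → B) (p : ℕ) : parityLeaf y (2 * p) = y p := by
  simp [parityLeaf]

@[simp] theorem parityLeaf_odd (y : ℕ → B) (p : ℕ) : parityLeaf y (2 * p + 1) = 1 := by
  simp [parityLeaf]

/-- The sum of the values of the trees whose blocks span their intervals, as a series. -/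
def spanSeries : WordSeries B B :=
  ⟨fun l => ∑ T ∈ trees spanLegs (2 * l.length + 1) 0 (2 * l.length + 1),
    treeValue (parityKernel Ka Kb) (parityLeaf fun p => (1 :: l).getD p 1) T 0⟩

variable {Ka Kb}

/-- The root spans the interval, so its outer gaps are single leaves. The inner gaps start at the
opposite parity, and their sums are the values of `f`. -/
theorem sum_trees_span_step (ha : IsAdd Ka) (hb : IsAdd Kb) (y : ℕ → B) (q : ℕ) {r : ℕ}
    (hr : r < 2) (n m : ℕ) (f : WordSeries B B)
    (hf : ∀ u v, u < v → v - u ≤ n →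
      ∑ T ∈ trees spanLegs m (2 * u + r + 1) (2 * v + r),
        treeValue (parityKernel Ka Kb) (parityLeaf y) T (2 * u + r + 1) =
      f (seg y (u + 1) (v - u))) :
    ∑ T ∈ trees spanLegs (m + 1) (2 * q + r) (2 * q + r + (2 * n + 1)),
      treeValue (parityKernel Ka Kb) (parityLeaf y) T (2 * q + r) =
    parityLeaf y (2 * q + r) * comp (parityKernel Ka Kb r) f (seg y (q + 1) n) *
      parityLeaf y (2 * (q + n) + r + 1) := by
  have hK : ∀ s, IsAdd (parityKernel Ka Kb s) := fun s => by
    unfold parityKernel; split_ifs; exacts [ha, hb]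
  rw [sum_treeValue hK _ (by omega), ← sum_cutsFrom, ← List.sum_map_mul_left,
    ← List.sum_map_mul_right, ← sum_legSet_span q hr n]
  refine sum_congr rfl fun p hp => ?_
  obtain ⟨k, legs⟩ := p
  obtain ⟨hl, h0, hpar⟩ := mem_legSet.1 hp
  simp only at *
  have hlast := hl.last
  have h1 : parityKernel Ka Kb (legs 0) = parityKernel Ka Kb r := by
    rw [h0]; simp [parityKernel, Nat.even_add]
  rw [h1, trees_of_le h0.le, trees_of_le hlast.ge, sum_singleton, sum_singleton, treeValue,
    treeValue, hlast, show 2 * q + r + (2 * n + 1) = 2 * (q + n) + r + 1 by omega]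
  congr 3
  have e := ofFn_eq_pieces (fun u v => f (seg y (u + 1) (v - u))) fun t => legs t / 2
  rw [show legs 0 / 2 = q by omega] at e
  rw [← e]
  congr 1
  funext t
  have h2 : legs t.castSucc < legs t.succ := hl.mono Fin.castSucc_lt_succ
  have h3 := hl.legs_lt t.succ
  have h4 := hl.le_legs t.castSucc
  have h5 := hpar t.castSucc
  have h6 := hpar t.succ
  rw [← hf (legs t.castSucc / 2) (legs t.succ / 2) (by omega) (by omega),
    show 2 * (legs t.castSucc / 2) + r = legs t.castSucc by omega,
    show 2 * (legs t.succ / 2) + r = legs t.succ by omega]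

/-- Black and blue intervals call each other at smaller lengths. Leaves at odd positions count as 1,
so a black root keeps only its front leaf and a blue root only its back leaf: black gaps contribute
IV, while blue gaps contribute K_b∘(IV) followed by I. -/
theorem sum_trees_span (ha : IsAdd Ka) (hb : IsAdd Kb) (n : ℕ) :
    (∀ y q m, 2 * n + 1 ≤ m → ∑ T ∈ trees spanLegs m (2 * q) (2 * q + (2 * n + 1)),
      treeValue (parityKernel Ka Kb) (parityLeaf y) T (2 * q) =
        y q * spanSeries Ka Kb (seg y (q + 1) n)) ∧
    (∀ y q m, 2 * n + 1 ≤ m → ∑ T ∈ trees spanLegs m (2 * q + 1) (2 * q + 1 + (2 * n + 1)),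
      treeValue (parityKernel Ka Kb) (parityLeaf y) T (2 * q + 1) =
        (comp Kb (ident * spanSeries Ka Kb) * ident : WordSeries B B) (seg y (q + 1) (n + 1))) ∧
    ∀ l : List B, l.length = n → spanSeries Ka Kb l =
      comp Ka (comp Kb (ident * spanSeries Ka Kb) * ident) l := by
  induction n using Nat.strong_induction_on with
  | _ n ih =>
    set V := spanSeries Ka Kb with hV
    have black : ∀ y q m, 2 * n + 1 ≤ m → ∑ T ∈ trees spanLegs m (2 * q) (2 * q + (2 * n + 1)),
        treeValue (parityKernel Ka Kb) (parityLeaf y) T (2 * q) =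
        y q * comp Ka (comp Kb (ident * V) * ident) (seg y (q + 1) n) := by
      intro y q m hm
      obtain ⟨m, rfl⟩ : ∃ m', m = m' + 1 := ⟨m - 1, by omega⟩
      have := sum_trees_span_step ha hb y q (r := 0) (by omega) n m
        (comp Kb (ident * V) * ident) fun u v huv hlt => by
          have := (ih (v - u - 1) (by omega)).2.1 y u m (by omega)
          rw [show v - u - 1 + 1 = v - u by omega,
            show 2 * u + 1 + (2 * (v - u - 1) + 1) = 2 * v by omega] at this
          exact this
      simpa [parityKernel] using this
    have eq : ∀ l : List B, l.length = n →
        V l = comp Ka (comp Kb (ident * V) * ident) l := by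
      rintro l rfl
      have := black (fun p => (1 :: l).getD p 1) 0 (2 * l.length + 1) le_rfl
      simp only [Nat.zero_add, mul_zero, seg_getD] at this
      have h1 : V l = ∑ T ∈ trees spanLegs (2 * l.length + 1) 0 (2 * l.length + 1),
        treeValue (parityKernel Ka Kb) (parityLeaf fun p => (1 :: l).getD p 1) T 0 := rfl
      rw [h1, this]
      simp
    refine ⟨fun y q m hm => ?_, fun y q m hm => ?_, eq⟩
    · rw [black y q m hm, eq _ (length_seg _ _ _)]
    · obtain ⟨m, rfl⟩ : ∃ m', m = m' + 1 := ⟨m - 1, by omega⟩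
      rw [sum_trees_span_step ha hb y q (r := 1) (by omega) n m (ident * V)
        fun u v huv hlt => ?_]
      · rw [seg_mul_ident, parityLeaf_odd, show 2 * (q + n) + 1 + 1 = 2 * (q + 1 + n) by omega,
          parityLeaf_even]
        simp [parityKernel]
      · have := (ih (v - u - 1) (by omega)).1 y (u + 1) m (by omega)
        rw [show v - u = v - u - 1 + 1 by omega, ident_mul_seg, ← this,
          show 2 * (u + 1) + (2 * (v - u - 1) + 1) = 2 * v + 1 by omega]
        rfl

theorem spanSeries_eq (ha : IsAdd Ka) (hb : IsAdd Kb) : spanSeries Ka Kb =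
    comp Ka (comp Kb (ident * spanSeries Ka Kb) * ident) :=
  ext' fun l => (sum_trees_span ha hb _).2.2 l rfl

end SpanSeries

end FreeProd

namespace FreeProd

open WordSeries

/-! ### Series of maps as functions on words -/

section Hat

variable {B : Type*}

/-- A series of maps `B^n → B` as a function on words. -/
def hat (α : MSeries B) : WordSeries B B := ⟨fun l => α l.length l.get⟩

theorem hat_ofFn (α : MSeries B) {n : ℕ} (f : Fin n → B) : hat α (List.ofFn f) = α n f :=
  congrArg (fun p : Σ n, Fin n → B => α p.1 p.2) (List.equivSigmaTuple.right_inv ⟨n, f⟩)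

theorem hat_injective {α β : MSeries B} (h : hat α = hat β) : α = β := by
  funext n f
  rw [← hat_ofFn α f, h, hat_ofFn]

variable [Ring B]

theorem hat_I : hat (MSeries.I : MSeries B) = ident := by
  refine ext' fun l => ?_
  rcases l with _ | ⟨c, _ | ⟨d, l⟩⟩ <;> rfl

theorem mul_eq_sum (F G : WordSeries B B) (l : List B) : (F * G : WordSeries B B) l =
    ∑ k : Fin (l.length + 1), F (l.take k) * G (l.drop k) := by
  induction l generalizing F with
  | nil => simp
  | cons c l ih =>
    rw [mul_cons, ih]
    exact (Fin.sum_univ_succ (n := l.length + 1)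
      fun k => F ((c :: l).take k) * G ((c :: l).drop k)).symm

theorem hat_dot (α β : MSeries B) : hat (α.dot β) = hat α * hat β := by
  refine ext' fun l => ?_
  rw [mul_eq_sum]
  change MSeries.dot α β l.length l.get = _
  refine sum_congr rfl fun k _ => ?_
  rw [← hat_ofFn α, ← hat_ofFn β]
  congr 2
  · refine List.ext_getElem (by simp; omega) fun i h1 h2 => ?_
    simp
  · refine List.ext_getElem (by simp) fun i h1 h2 => ?_
    simp

theorem length_cuts (m p : ℕ) : (cuts m p).length = 2 ^ m := by
  induction m generalizing p with
  | zero => rfl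
  | succ m ih => rw [cuts, List.length_append, List.length_map, ih, pow_succ]; omega

theorem length_cutsFrom (o m : ℕ) : (cutsFrom o m).length = 2 ^ (m - 1) := by
  cases m with
  | zero => rfl
  | succ m => exact length_cuts _ _

/-- The partial sums of a composition. -/
def partialSums {n : ℕ} (p : Composition n) : List ℕ :=
  List.ofFn fun t : Fin p.length => p.sizeUpTo (t + 1)

theorem pieces_partialSums {M : Type*} {n : ℕ} (p : Composition n) (g : ℕ → ℕ → M) :
    pieces g 0 (partialSums p) =
      List.ofFn fun t : Fin p.length => g (p.sizeUpTo t) (p.sizeUpTo t + p.blocksFun t) := by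
  have h := ofFn_eq_pieces g fun t : Fin (p.length + 1) => p.sizeUpTo t
  rw [Fin.val_zero, p.sizeUpTo_zero] at h
  rw [partialSums]
  refine h.symm.trans (congrArg List.ofFn (funext fun t => ?_))
  rw [Fin.val_succ, p.sizeUpTo_succ', Fin.val_castSucc]

theorem partialSums_injective {n : ℕ} : Function.Injective (partialSums (n := n)) := by
  intro p q h
  have h1 : ∀ p : Composition n, pieces (fun u v => v - u) 0 (partialSums p) = p.blocks := by
    intro p
    rw [pieces_partialSums]
    simp only [Nat.add_sub_cancel_left]
    exact p.ofFn_blocksFun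
  exact Composition.ext (by rw [← h1, h, h1])

theorem partialSums_mem {n : ℕ} (p : Composition n) : partialSums p ∈ cutsFrom 0 n := by
  rw [mem_cutsFrom]
  have h : 0 :: partialSums p = List.ofFn fun t : Fin (p.length + 1) => p.sizeUpTo t := by
    rw [List.ofFn_succ]
    simp [partialSums]
  rw [h]
  refine (ofFn_mem_cuts (i := 0) (j := n + 1) (by omega)).2 ⟨?_, Nat.zero_le _, ?_⟩
  · exact fun s t hst => p.boundary.strictMono hst
  · simp

/-- Partial sums embed the compositions into the lists of cuts, and both sets have 2^(n-1) elements.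
-/
theorem sum_composition {M : Type*} [AddCommMonoid M] (n : ℕ) (G : List ℕ → M) :
    ∑ p : Composition n, G (partialSums p) = ((cutsFrom 0 n).map G).sum := by
  rw [← List.sum_toFinset _ (nodup_cutsFrom _ _)]
  have h : (univ.image (partialSums (n := n))) = (cutsFrom 0 n).toFinset := by
    refine eq_of_subset_of_card_le (fun l hl => ?_) ?_
    · obtain ⟨p, -, rfl⟩ := mem_image.1 hl
      exact List.mem_toFinset.2 (partialSums_mem p)
    · rw [card_image_of_injective _ partialSums_injective, List.toFinset_card_of_nodup
        (nodup_cutsFrom _ _), length_cutsFrom, card_univ, composition_card]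
  rw [← h, sum_image fun p _ q _ h => partialSums_injective h]

theorem hat_times (α β : MSeries B) : hat (α.times β) = comp (hat α) (hat β) := by
  refine ext' fun l => ?_
  have h := sum_cutsFrom (hat α) (hat β) (fun p => (1 :: l).getD p 1) l.length 0
  rw [Nat.zero_add, seg_getD, ← sum_composition] at h
  rw [← h]
  change MSeries.times α β l.length l.get = _
  refine sum_congr rfl fun p _ => ?_
  rw [pieces_partialSums, ← hat_ofFn α]
  congr 2
  funext t
  rw [← hat_ofFn β, Nat.add_sub_cancel_left]
  congr 1
  refine List.ext_getElem (by simp) fun i h1 h2 => ?_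
  have h3 : p.sizeUpTo t + i < l.length := by
    have := (p.embedding t ⟨i, by simpa using h1⟩).2
    simpa using this
  simp [seg, show p.sizeUpTo t + 1 + i = p.sizeUpTo t + i + 1 by omega, h3]

end Hat

/-! ### The evaluation of linked partitions -/

/-- Computes input offsets: `h` will be the index of the first input of a child, and `g` the arity
of that child. -/
theorem telescope {n : ℕ} {h : Fin (n + 1) → ℕ} {g : Fin n → ℕ}
    (hg : ∀ t : Fin n, h t.succ = h t.castSucc + g t) :
    (∀ t : Fin n, h t.castSucc = h 0 + ∑ s ∈ Iio t, g s) ∧ h (Fin.last n) = h 0 + ∑ s, g s := by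
  have key : ∀ m (hm : m < n + 1), h ⟨m, hm⟩ = h 0 +
      ∑ s ∈ range m, if hs : s < n then g ⟨s, hs⟩ else 0 := by
    intro m
    induction m with
    | zero => intro _; simp
    | succ m ih =>
      intro hm
      rw [sum_range_succ, dif_pos (by omega), ← add_assoc, ← ih (by omega)]
      exact hg ⟨m, by omega⟩
  constructor
  · intro t
    rw [show t.castSucc = ⟨t, by omega⟩ from rfl, key]
    congr 1
    rw [← Nat.Iio_eq_range, ← Fin.map_valEmbedding_Iio, sum_map]
    simp
  · rw [show Fin.last n = ⟨n, by omega⟩ from rfl, key]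
    congr 1
    rw [sum_range]
    simp

section Linked

variable {A B : Type*} [Ring A] [Algebra ℂ A] [Ring B] [Algebra ℂ B] {P : OVSpace A B} {a b : A}

theorem cumulantSeries_eq_hat (x : A) : P.cumulantSeries x = hat (P.cumulantMap x) := rfl

theorem cumulantSeries_nil (x : A) : P.cumulantSeries x [] = P.φ x := by
  have h := congrArg (fun F : WordSeries B B => F [1]) (moment_eq (P := P) (x := x))
  have h1 : P.moment x [1] = P.φ x := by
    rw [OVSpace.moment, P.expect_apply, word_cons, word_nil]
    simp
  have h2 : P.moment x [] = 1 := by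
    rw [OVSpace.moment, P.expect_apply, word_nil]
    simpa using P.φ_ι 1
  simp only [WordSeries.add_apply, one_cons, zero_add] at h
  rw [h1, show ([1] : List B) = [] ++ [1] from rfl, ident, mul_letter_append] at h
  simp [h2] at h
  exact h.symm

theorem kL_eq (m : ℕ) (c : Fin (m + 1) → B) : P.kL a m c =
    c 0 * P.cumulantSeries a (List.ofFn fun t : Fin m => c t.succ) := by
  have h := isBilinearAt_cumulantSeries (P := P) (x := a) m c fun _ => 1
  simp only [map_one, mul_one, one_mul] at h
  exact h

theorem kR_eq (m : ℕ) (c : Fin (m + 1) → B) : P.kR b m c =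
    P.cumulantSeries b (List.ofFn fun t : Fin m => c t.castSucc) * c (Fin.last m) := by
  rw [cumulantSeries_eq_hat, hat_ofFn]
  rfl

/-- The back leaf of a black vertex and the front leaf of a blue one sit at odd positions, so the
erased leaves are those of value 1. The inputs left are the even positions in `[i, j]`, beginning
with index `(i + 1) / 2`. A vertex with a single input evaluates to its subtree times φ(a) or φ(b).
An empty interval at an odd position carries an erased leaf and is excluded by `hij`. -/
theorem Khat_eraseLeaves (ha : P.φ a = 1) (hb : P.φ b = 1) (y : ℕ → B) {m i j : ℕ}
    (hm : j - i ≤ m) {T : GapTree} (hT : T ∈ trees spanLegs m i j)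
    (hij : i < j ∨ i = j ∧ Even i) :
    (eraseLeaves T).arity + (i + 1) / 2 = j / 2 + 1 ∧
      P.Khat a b (eraseLeaves T) (fun p => y ((i + 1) / 2 + p)) =
        treeValue (parityKernel (P.cumulantSeries a) (P.cumulantSeries b)) (parityLeaf y) T i := by
  set K := parityKernel (P.cumulantSeries a) (P.cumulantSeries b) with hK
  -- The first conjunct records the value of an empty gap; it is what remains to be known about the
  -- erased leaves.
  refine (trees_induction (C := fun i j T =>
    (j ≤ i → treeValue K (parityLeaf y) T i = parityLeaf y i) ∧
    (i < j ∨ i = j ∧ Even i → (eraseLeaves T).arity + (i + 1) / 2 = j / 2 + 1 ∧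
      P.Khat a b (eraseLeaves T) (fun p => y ((i + 1) / 2 + p)) = treeValue K (parityLeaf y) T i))
    ?_ ?_ hm hT).2 hij
  · intro i j hji
    refine ⟨fun _ => rfl, fun h => ?_⟩
    obtain ⟨rfl, p, rfl⟩ := h.resolve_left (by omega)
    refine ⟨?_, ?_⟩
    · rw [eraseLeaves, LinkedTree.arity]
      omega
    · rw [eraseLeaves, OVSpace.Khat, treeValue, ← two_mul, parityLeaf_even]
      congr 1
      omega
  · intro i j k legs child hl hq _ ih
    refine ⟨fun h => absurd hl.lt (by omega), fun _ => ?_⟩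
    obtain ⟨h0, hpar⟩ := hq
    have hlast := hl.last
    have hparl := hpar (Fin.last k)
    have vlast := (ih (Fin.last (k + 1))).1 (by simp [hlast])
    rw [gapL_last] at vlast
    have vzero := (ih 0).1 (by simp [h0])
    rw [gapL_zero] at vzero
    have hsucc : ∀ t : Fin k, legs t.castSucc + 1 < legs t.succ := by
      intro t
      have h1 : legs t.castSucc < legs t.succ := hl.mono Fin.castSucc_lt_succ
      have h2 := hpar t.castSucc
      have h3 := hpar t.succ
      omega
    rcases Nat.even_or_odd i with hi | hi
    · have hi2 : i % 2 = 0 := Nat.even_iff.1 hi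
      have hKi : K (legs 0) = P.cumulantSeries a := by rw [hK, parityKernel, h0, if_pos hi]
      have vlast' : treeValue K (parityLeaf y) (child (Fin.last (k + 1)))
          (legs (Fin.last k) + 1) = 1 := by
        rw [vlast, show legs (Fin.last k) + 1 = 2 * (legs (Fin.last k) / 2) + 1 by omega,
          parityLeaf_odd]
      have ih0 := (ih 0).2 (Or.inr ⟨by simp [h0], by simpa using hi⟩)
      rw [gapL_zero, gapR_zero] at ih0
      rw [treeValue, hKi, vlast', mul_one]
      rcases k with _ | k
      · rw [eraseLeaves, if_pos (h0.symm ▸ hi)]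
        refine ⟨?_, ?_⟩
        · have : legs (Fin.last 0) = legs 0 := rfl
          omega
        · rw [ih0.2, List.ofFn_zero, cumulantSeries_nil, ha, mul_one]
      · rw [eraseLeaves, if_pos (h0.symm ▸ hi)]
        have ih' : ∀ t : Fin (k + 2), _ := fun t => (ih t.castSucc).2 (by
          induction t using Fin.cases with
          | zero => exact Or.inr ⟨by simp [h0], by simpa using hi⟩
          | succ t =>
            refine Or.inl ?_
            rw [gapR_castSucc, ← Fin.succ_castSucc, gapL_succ]
            exact hsucc t)
        obtain ⟨hoff, htot⟩ := telescope (h := fun s => (gapL i legs s + 1) / 2)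
          (g := fun t : Fin (k + 2) => (eraseLeaves (child t.castSucc)).arity) fun t => by
            have h1 := (ih' t).1
            have h2 := hpar t
            rw [gapR_castSucc] at h1
            rw [gapL_succ]
            omega
        rw [gapL_zero] at hoff htot
        refine ⟨?_, ?_⟩
        · rw [gapL_last] at htot
          change (∑ t : Fin (k + 2), (eraseLeaves (child t.castSucc)).arity) + _ = _
          have htot' : _ = _ + ∑ t : Fin (k + 2), (eraseLeaves (child t.castSucc)).arity := htot
          omega
        · rw [OVSpace.Khat, kL_eq]
          have hval : ∀ t : Fin (k + 2), P.Khat a b (eraseLeaves (child t.castSucc)) (fun p =>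
              y ((i + 1) / 2 + ((∑ s ∈ Iio t, (eraseLeaves (child s.castSucc)).arity) + p))) =
              treeValue K (parityLeaf y) (child t.castSucc) (gapL i legs t.castSucc) := by
            intro t
            rw [← (ih' t).2, hoff t]
            simp only [add_assoc]
          simp only [hval]
          rw [Fin.castSucc_zero, gapL_zero]
          congr 3
    · have hi2 : i % 2 = 1 := Nat.odd_iff.1 hi
      have hi' : ¬ Even i := Nat.not_even_iff_odd.2 hi
      have hKi : K (legs 0) = P.cumulantSeries b := by rw [hK, parityKernel, h0, if_neg hi']
      have vzero' : treeValue K (parityLeaf y) (child 0) i = 1 := by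
        rw [vzero, show i = 2 * (i / 2) + 1 by omega, parityLeaf_odd]
      have ihl := (ih (Fin.last (k + 1))).2 (Or.inr ⟨by simp [hlast], by
        rw [gapL_last, Nat.even_iff]; omega⟩)
      rw [gapL_last, gapR_last] at ihl
      rw [treeValue, hKi, vzero', one_mul]
      rcases k with _ | k
      · rw [eraseLeaves, if_neg (h0.symm ▸ hi')]
        have e : legs (Fin.last 0) = i := h0
        rw [e] at ihl hlast ⊢
        rw [List.ofFn_zero, cumulantSeries_nil, hb, one_mul, ← ihl.2,
          show (i + 1 + 1) / 2 = (i + 1) / 2 by omega]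
        refine ⟨?_, rfl⟩
        rw [← ihl.1, show (i + 1 + 1) / 2 = (i + 1) / 2 by omega]
        rfl
      · rw [eraseLeaves, if_neg (h0.symm ▸ hi')]
        have ih' : ∀ t : Fin (k + 2), _ := fun t => (ih t.succ).2 (by
          induction t using Fin.lastCases with
          | last =>
            rw [Fin.succ_last]
            exact Or.inr ⟨by simp [hlast], by rw [gapL_last, Nat.even_iff]; omega⟩
          | cast t =>
            refine Or.inl ?_
            rw [gapL_succ, Fin.succ_castSucc, gapR_castSucc]
            exact hsucc t)
        simp only [gapL_succ] at ih'
        obtain ⟨hoff, htot⟩ := telescope (h := fun s => gapR legs j s / 2 + 1)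
          (g := fun t : Fin (k + 2) => (eraseLeaves (child t.succ)).arity) fun t => by
            have h1 := (ih' t).1
            have h2 := hpar t
            rw [gapR_castSucc]
            omega
        simp only [gapR_zero, gapR_castSucc, gapR_last] at hoff htot
        refine ⟨?_, ?_⟩
        · change (∑ t : Fin (k + 2), (eraseLeaves (child t.succ)).arity) + _ = _
          have htot' : _ = _ + ∑ t : Fin (k + 2), (eraseLeaves (child t.succ)).arity := htot
          omega
        · rw [OVSpace.Khat, kR_eq]
          have hval : ∀ t : Fin (k + 2), P.Khat a b (eraseLeaves (child t.succ)) (fun p =>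
              y ((i + 1) / 2 + ((∑ s ∈ Iio t, (eraseLeaves (child s.succ)).arity) + p))) =
              treeValue K (parityLeaf y) (child t.succ) (legs t + 1) := by
            intro t
            have h1 := hoff t
            have h2 := hpar t
            rw [← (ih' t).2]
            congr 1
            funext p
            congr 1
            omega
          simp only [hval]
          rw [Fin.succ_last]

theorem hat_V (ha : P.φ a = 1) (hb : P.φ b = 1) :
    hat (P.V a b) = spanSeries (P.cumulantSeries a) (P.cumulantSeries b) := by
  refine ext' fun l => ?_
  rcases l with _ | ⟨c, l⟩
  · rw [spanSeries_eq isAdd_cumulantSeries isAdd_cumulantSeries, comp_nil, cumulantSeries_nil, ha]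
    rfl
  -- The leading 1 and the default value 1 supply the two outer inputs in the definition of `V`.
  · set x : ℕ → B := fun p => (1 :: c :: l).getD p 1 with hx
    have h1 : hat (P.V a b) (c :: l) = ∑ π ∈ NCirr (l.length + 1 + 1),
        P.Khat a b (linked π) x := by
      change P.V a b (l.length + 1) (c :: l).get = _
      refine sum_congr rfl fun π _ => congrArg _ (funext fun i => ?_)
      rcases i with _ | i
      · simp [hx]
      · by_cases h : i < l.length + 1
        · rw [dif_pos (by omega)]
          simp [hx, h]
        · rw [dif_neg (by omega)]
          simp [hx, h]
    rw [h1, sum_congr rfl fun π hπ => by rw [linked_eq hπ]]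
    refine (sum_NCirr_eq_sum_trees fun T => P.Khat a b (.outer 0 fun t =>
      eraseLeaves (if t = 0 then T else .leaf)) x).trans (sum_congr rfl fun T hT => ?_)
    obtain ⟨har, hval⟩ := Khat_eraseLeaves (P := P) ha hb x (by omega) hT (Or.inl (by omega))
    simp only [Nat.zero_add, show (0 + 1) / 2 = 0 from rfl] at har hval
    rw [List.length_cons] at har
    refine Eq.trans ?_ hval
    have hlast : ∀ n, l.length + 2 ≤ n → x n = 1 := fun n hn => by
      rw [hx]
      simp only [List.getD_eq_getElem?_getD]
      rw [List.getElem?_eq_none (by simp only [List.length_cons]; omega)]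
      rfl
    -- The root is a singleton, so it contributes φ(b) = 1 between its two inputs; the right one is
    -- the last input, equal to 1.
    rw [OVSpace.Khat, OVSpace.kLR, kR_eq, List.ofFn_zero, cumulantSeries_nil, hb, one_mul]
    have e2 : Iio (Fin.succ (Fin.last 0) : Fin 2) = {0} := by decide
    have e1 : Iio (0 : Fin 2) = ∅ := by decide
    rw [e1, e2]
    simp only [sum_singleton, sum_empty, Nat.zero_add, if_true,
      if_neg (Fin.succ_ne_zero (Fin.last 0)), eraseLeaves]
    rw [OVSpace.Khat, hlast _ (by omega), mul_one]

/-- The constant term 1 in the definition of `K` is the first cumulant, because of the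
normalization. -/
theorem hat_K {x : A} (hx : P.φ x = 1) : hat (P.K x) = P.cumulantSeries x := by
  refine ext' fun l => ?_
  cases l with
  | nil => rw [cumulantSeries_nil, hx]; rfl
  | cons c l => rfl

theorem hat_V_eq (ha : P.φ a = 1) (hb : P.φ b = 1) : hat (P.V a b) =
    comp (P.cumulantSeries a) (comp (P.cumulantSeries b) (ident * hat (P.V a b)) * ident) := by
  rw [hat_V ha hb]
  exact spanSeries_eq isAdd_cumulantSeries isAdd_cumulantSeries

end Linked

end FreeProd

end

/-! ### The theorem, translated back from words to series of maps -/

theorem mainTheorem3 {A B : Type*} [Ring A] [Algebra ℂ A] [Ring B] [Algebra ℂ B]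
    (P : FreeProd.OVSpace A B) (a b : A) (ha : P.φ a = 1) (hb : P.φ b = 1)
    (hfree : P.IsFree a b) :
    P.V a b = (P.K a).times
        (((P.K b).times (FreeProd.MSeries.I.dot (P.V a b))).dot FreeProd.MSeries.I) ∧
      P.K (a * b) = (P.V a b).dot ((P.K b).times (FreeProd.MSeries.I.dot (P.V a b))) := by
  have hV := FreeProd.hat_V_eq ha hb
  have hK := FreeProd.cumulant_mul_of_free hfree FreeProd.expect_resolvent_cumulantSeries
    FreeProd.expect_resolvent_cumulantSeries FreeProd.expect_resolvent_cumulantSeries hV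
  -- The normalization of `a * b`, needed to pass to `K (a * b)`, is read off from the constant term
  -- of the product formula.
  have hab : P.φ (a * b) = 1 := by
    rw [← FreeProd.cumulantSeries_nil, hK, FreeProd.WordSeries.mul_nil,
      FreeProd.WordSeries.comp_nil, FreeProd.cumulantSeries_nil, hb, mul_one]
    rfl
  constructor
  · refine FreeProd.hat_injective ?_
    rw [FreeProd.hat_times, FreeProd.hat_dot, FreeProd.hat_times, FreeProd.hat_dot,
      FreeProd.hat_I, FreeProd.hat_K ha, FreeProd.hat_K hb]
    exact hV
  · refine FreeProd.hat_injective ?_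
    rw [FreeProd.hat_dot, FreeProd.hat_times, FreeProd.hat_dot, FreeProd.hat_I,
      FreeProd.hat_K hab, FreeProd.hat_K hb]
    exact hK
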